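/- **Setting.** Let $x^+=f(x,u)$, $x\in\mathbb R^n$, $u\in\mathbb R^2$, be a discrete-time system, $f$ smooth near an equilibrium $(x_0,u_0)$ (i.e. $f(x_0,u_0)=x_0$), with $\operatorname{rank}\partial_u f=2$ and $\operatorname{rank}\partial_{(x,u)}f=n$ at $(x_0,u_0)$. Let $\zeta=g(x,u)\in\mathbb R^2$ be smooth functions such that $(x,u)\mapsto(x^+,\zeta)=(f(x,u),g(x,u))$ is a local diffeomorphism, with local inverse $(x,u)=\psi(x^+,\zeta)$. On the space with coordinates $(\ldots,\zeta_{[-2]},\zeta_{[-1]},x,u,u_{[1]},\ldots)$, near the point given by the equilibrium, forward-shifts of functions are obtained by substituting $\zeta_{[-k-1]}\mapsto\zeta_{[-k]}$, $\zeta_{[-1]}\mapsto g(x,u)$, $x\mapsto f(x,u)$, $u_{[k]}\mapsto u_{[k+1]}$ (with $u_{[0]}=u$), and backward-shifts by the inverse substitution, with $(x,u)\mapsto\psi(x,\zeta_{[-1]})$; $h_{[k]}$ denotes the $k$-fold shift of $h$ (backward for $k<0$). Let $y^j=\varphi^j(x,u)$, $j=1,2$, be a flat output around $(x_0,u_0)$: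 $\varphi$ is smooth, and locally $$x=F_x(y_{[-R_1,R_2-1]}),\qquad u=F_u(y_{[-R_1,R_2]})$$ with smooth $F_x,F_u$ (unique as germs) and multi-indices $R_1=(r_{1,1},r_{1,2})$, $R_2=(r_{2,1},r_{2,2})$ of non-negative integers, where $y_{[A,B]}$ stands for all $y^j_{[k]}$ with $A_j\le k\le B_j$. Let $R_1,R_2$ be the minimal such multi-indices and put $\#R=r_{1,1}+r_{1,2}+r_{2,1}+r_{2,2}$. Assume the following regularity around the equilibrium. 1. The Jacobian submatrices $\partial_{y_{[-R_1]}}F_x$ and $\partial_{y_{[R_2]}}F_u$ (derivatives with respect to $y^j_{[-r_{1,j}]}$, resp. $y^j_{[r_{2,j}]}$, $j=1,2$) have constant rank in a neighbourhood of the equilibrium. 2. For $j=1,2$ the relative degree $\rho_j\ge 0$ of $y^j$ is well defined: $\partial_u\varphi^j_{[k]}\equiv 0$ locally for $0\le k<\rho_j$, and $\partial_u\varphi^j_{[\rho_j]}\ne0$ at the equilibrium. Likewise $\gamma_j\ge1$ is well defined: $\partial_{\zeta_{[-1]}}\varphi^j_{[-k]}\equiv0$ locally for $1\le k<\gamma_j$,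 and $\partial_{\zeta_{[-1]}}\varphi^j_{[-\gamma_j]}\neq0$ at the equilibrium. **Proposition.** Put $d_1=r_{1,1}+1-\gamma_1$ and $d_2=r_{2,1}-\rho_1$. Then $d_1,d_2\ge0$ and $d_1+d_2=d:=\#R-n$, and there exist an input transformation $u=\hat\Phi_u(x,\bar u)$ and a transformation $\zeta_{[-1]}=\hat\Phi_\zeta(x,\bar\zeta_{[-1]})$, both locally invertible (for given $x$) around the equilibrium, such that the following holds. Let $\bar\zeta_{[-1]}=\theta(x,\zeta_{[-1]})$ be the inverse of the second transformation and $\bar g^1(x,u)=\theta^1(f(x,u),g(x,u))$ the forward-shift of $\bar\zeta^1_{[-1]}$. Then the system extended by a $d_1$-fold prelongation and a $d_2$-fold prolongation, $$\begin{aligned}\bar\zeta^{1,+}_{[-k]}&=\bar\zeta^1_{[-k+1]}\quad(k=d_1,\ldots,2),\\ \bar\zeta^{1,+}_{[-1]}&=\bar g^1(x,\hat\Phi_u(x,\bar u))\quad(\text{present if }d_1\ge1),\\ x^+&=f(x,\hat\Phi_u(x,\bar u)),\\ \bar u^{1,+}_{[k]}&=\bar u^1_{[k+1]}\quad(k=0,\ldots,d_2-1),\end{aligned}$$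 with state $(\bar\zeta^1_{[-d_1]},\ldots,\bar\zeta^1_{[-1]},x,\bar u^1,\ldots,\bar u^1_{[d_2-1]})$ and input $(\bar u^1_{[d_2]},\bar u^2)$, is static feedback linearizable around its equilibrium corresponding to $(x_0,u_0)$: a local diffeomorphism of the state and an invertible static feedback transform it into a controllable linear system. -/

import Mathlib

open Filter
open scoped Topology ContDiff

noncomputable section

namespace FlatDT

/-- Coordinate space `ℝᵏ`; only its smooth structure is used, never a specific norm. -/
abbrev Vec (k : ℕ) := Fin k → ℝ

/-- `a` is smooth on a neighbourhood of `p`. -/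
def SmoothNear {E F : Type*} [NormedAddCommGroup E] [NormedSpace ℝ E]
    [NormedAddCommGroup F] [NormedSpace ℝ F] (a : E → F) (p : E) : Prop :=
  ∀ᶠ q in 𝓝 p, ContDiffAt ℝ ∞ a q

/-- `a` is a local diffeomorphism around `p`, with local inverse `b` around `a p`. -/
def LocalInverse {E F : Type*} [NormedAddCommGroup E] [NormedSpace ℝ E]
    [NormedAddCommGroup F] [NormedSpace ℝ F] (a : E → F) (b : F → E) (p : E) : Prop :=
  SmoothNear a p ∧ SmoothNear b (a p) ∧
    (∀ᶠ q in 𝓝 p, b (a q) = q) ∧ (∀ᶠ q in 𝓝 (a p), a (b q) = q)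

/-- `a` is a local diffeomorphism around `p`. -/
def IsLocalDiffeo {E F : Type*} [NormedAddCommGroup E] [NormedSpace ℝ E]
    [NormedAddCommGroup F] [NormedSpace ℝ F] (a : E → F) (p : E) : Prop :=
  ∃ b, LocalInverse a b p

/-! ### Discrete-time systems and their shifts -/

/-- A smooth discrete-time system `x⁺ = f(x,u)` with `n` states and `m` inputs, considered around
an equilibrium `(x₀,u₀)`, with independent inputs (`rank ∂_u f = m`) and submersive
(`rank ∂_(x,u) f = n`). The ranks are open conditions, so they hold near the equilibrium. -/
structure DTSystem (n m : ℕ) where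
  f : Vec n × Vec m → Vec n
  x₀ : Vec n
  u₀ : Vec m
  smooth : SmoothNear f (x₀, u₀)
  equilibrium : f (x₀, u₀) = x₀
  rank_u : Function.Injective (fderiv ℝ (fun u => f (x₀, u)) u₀)
  rank_xu : Function.Surjective (fderiv ℝ f (x₀, u₀))

/-- Functions `ζ = g(x,u)` that complete `x⁺ = f(x,u)` to a local diffeomorphism
`(x,u) ↦ (x⁺,ζ)`, with its local inverse `(x⁺,ζ) ↦ (x,u) = (ψ_x(x⁺,ζ), ψ_u(x⁺,ζ))`. -/
structure Completion {n m : ℕ} (S : DTSystem n m) where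
  g : Vec n × Vec m → Vec m
  ψ : Vec n × Vec m → Vec n × Vec m
  inverse : LocalInverse (fun p => (S.f p, g p)) ψ (S.x₀, S.u₀)

/-- A point of the space with coordinates `(…, ζ_[-2], ζ_[-1], x, u, u_[1], u_[2], …)`:
`past k = ζ_[-(k+1)]` and `future k = u_[k]`. In the product topology a neighbourhood restricts
finitely many coordinates. -/
abbrev Point (n m : ℕ) := (ℕ → Vec m) × Vec n × (ℕ → Vec m)

namespace Completion

variable {n m : ℕ} {S : DTSystem n m} (C : Completion S)

/-- The value of `ζ` at the equilibrium. -/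
def ζ₀ : Vec m := C.g (S.x₀, S.u₀)

/-- The point that corresponds to the equilibrium. -/
def base : Point n m := (fun _ => C.ζ₀, S.x₀, fun _ => S.u₀)

/-- The point map of the forward-shift: `ζ_[-1] ↦ g(x,u)`, `x ↦ f(x,u)`, `u ↦ u_[1]`, and so on. -/
def fwd (p : Point n m) : Point n m :=
  (fun k => Nat.casesOn k (C.g (p.2.1, p.2.2 0)) p.1, S.f (p.2.1, p.2.2 0), fun k => p.2.2 (k + 1))

/-- The point map of the backward-shift:
`ζ_[-1] ↦ ζ_[-2]`, `x ↦ ψ_x(x,ζ_[-1])`, `u ↦ ψ_u(x,ζ_[-1])`, `u_[1] ↦ u`, and so on. -/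
def bwd (p : Point n m) : Point n m :=
  (fun k => p.1 (k + 1), (C.ψ (p.2.1, p.1 0)).1,
    fun k => Nat.casesOn k (C.ψ (p.2.1, p.1 0)).2 p.2.2)

/-- The `k`-fold shift; backward for negative `k`. -/
def shift : ℤ → Point n m → Point n m
  | Int.ofNat k => C.fwd^[k]
  | Int.negSucc k => C.bwd^[k + 1]

/-- The `k`-fold shift `y^j_[k] = φ^j_[k]` of the `j`-th component of `y = φ(x,u)`. -/
def yShift (φ : Vec n × Vec m → Vec m) (j : Fin m) (k : ℤ) (p : Point n m) : ℝ :=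
  φ ((C.shift k p).2.1, (C.shift k p).2.2 0) j

/-- `∂_u φ^j_[k]` at `p`. -/
def dyDu (φ : Vec n × Vec m → Vec m) (j : Fin m) (k : ℤ) (p : Point n m) : Vec m →L[ℝ] ℝ :=
  fderiv ℝ (fun v => C.yShift φ j k (p.1, p.2.1, Function.update p.2.2 0 v)) (p.2.2 0)

/-- `∂_{ζ_[-1]} φ^j_[k]` at `p`. -/
def dyDζ (φ : Vec n × Vec m → Vec m) (j : Fin m) (k : ℤ) (p : Point n m) : Vec m →L[ℝ] ℝ :=
  fderiv ℝ (fun v => C.yShift φ j k (Function.update p.1 0 v, p.2)) (p.1 0)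

/-- `ρ` is the relative degree of `y^j = φ^j(x,u)` around the equilibrium: `φ^j_[0], …, φ^j_[ρ-1]`
do not depend on `u`, and `∂_u φ^j_[ρ]` does not vanish at the equilibrium. -/
def IsRelativeDegree (φ : Vec n × Vec m → Vec m) (j : Fin m) (ρ : ℕ) : Prop :=
  (∀ k < ρ, ∀ᶠ p in 𝓝 C.base, C.dyDu φ j k p = 0) ∧ C.dyDu φ j ρ C.base ≠ 0

/-- The backward counterpart: `γ ≥ 1` is the order of the first backward-shift of `y^j` in which
`ζ_[-1]` appears, i.e. `φ^j_[-1], …, φ^j_[-γ+1]` do not depend on `ζ_[-1]`, and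
`∂_{ζ_[-1]} φ^j_[-γ]` does not vanish at the equilibrium. -/
def IsBackwardDegree (φ : Vec n × Vec m → Vec m) (j : Fin m) (γ : ℕ) : Prop :=
  1 ≤ γ ∧ (∀ k : ℕ, 1 ≤ k → k < γ → ∀ᶠ p in 𝓝 C.base, C.dyDζ φ j (-k) p = 0) ∧
    C.dyDζ φ j (-γ) C.base ≠ 0

end Completion

/-! ### Flat outputs -/

/-- Index set of the variables `y^j_[k]` with `a j ≤ k ≤ b j`, i.e. of `y_[a,b]`. -/
abbrev Window {m : ℕ} (a b : Fin m → ℤ) := Σ j : Fin m, Finset.Icc (a j) (b j)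

/-- The orders of the backward-shifts, with their sign: `-R₁`. -/
abbrev lo {m : ℕ} (R₁ : Fin m → ℕ) : Fin m → ℤ := fun j => -(R₁ j : ℤ)

/-- The orders of the forward-shifts, as integers: `R₂`. -/
abbrev hi {m : ℕ} (R₂ : Fin m → ℕ) : Fin m → ℤ := fun j => (R₂ j : ℤ)

/-- `R₂ - 1`, componentwise, as integers. -/
abbrev hi' {m : ℕ} (R₂ : Fin m → ℕ) : Fin m → ℤ := fun j => (R₂ j : ℤ) - 1

namespace Completion

variable {n m : ℕ} {S : DTSystem n m} (C : Completion S)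

/-- The values `y_[a,b]` at the point `p`. -/
def yWindow (φ : Vec n × Vec m → Vec m) (a b : Fin m → ℤ) (p : Point n m) : Window a b → ℝ :=
  fun i => C.yShift φ i.1 (i.2 : ℤ) p

/-- Locally, `x = F_x(y_[-R₁,R₂-1])` and `u = F_u(y_[-R₁,R₂])` with smooth `F_x` and `F_u`. -/
def IsParam (φ : Vec n × Vec m → Vec m) (R₁ R₂ : Fin m → ℕ)
    (Fx : (Window (lo R₁) (hi' R₂) → ℝ) → Vec n)
    (Fu : (Window (lo R₁) (hi R₂) → ℝ) → Vec m) : Prop :=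
  SmoothNear Fx (C.yWindow φ _ _ C.base) ∧ SmoothNear Fu (C.yWindow φ _ _ C.base) ∧
    (∀ᶠ p in 𝓝 C.base, Fx (C.yWindow φ _ _ p) = p.2.1) ∧
    (∀ᶠ p in 𝓝 C.base, Fu (C.yWindow φ _ _ p) = p.2.2 0)

/-- `y = φ(x,u)` is an `(x,u)`-flat output around the equilibrium: `x` and `u` can be expressed
locally by `y` and its shifts up to some finite order, and this parameterization is unique. -/
def IsFlatOutput (φ : Vec n × Vec m → Vec m) : Prop :=
  SmoothNear φ (S.x₀, S.u₀) ∧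
    (∃ R₁ R₂ Fx Fu, C.IsParam φ R₁ R₂ Fx Fu) ∧
    ∀ R₁ R₂ Fx Fu Fx' Fu', C.IsParam φ R₁ R₂ Fx Fu → C.IsParam φ R₁ R₂ Fx' Fu' →
      Fx =ᶠ[𝓝 (C.yWindow φ _ _ C.base)] Fx' ∧ Fu =ᶠ[𝓝 (C.yWindow φ _ _ C.base)] Fu'

/-- `(F_x, F_u)` is a parameterization with the (unique) minimal multi-indices `R₁`, `R₂`. -/
def IsMinimalParam (φ : Vec n × Vec m → Vec m) (R₁ R₂ : Fin m → ℕ)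
    (Fx : (Window (lo R₁) (hi' R₂) → ℝ) → Vec n)
    (Fu : (Window (lo R₁) (hi R₂) → ℝ) → Vec m) : Prop :=
  C.IsParam φ R₁ R₂ Fx Fu ∧
    ∀ R₁' R₂' Fx' Fu', C.IsParam φ R₁' R₂' Fx' Fu' → R₁ ≤ R₁' ∧ R₂ ≤ R₂'

end Completion

/-- The submatrix `∂_{y_[k]} F` of the Jacobian of `F(y_[a,b])` at `w`: column `j` holds the partial
derivatives with respect to `y^j_[k j]` (zero if this variable is not in the window). -/
def jacobianAt {m l : ℕ} {a b : Fin m → ℤ} (F : (Window a b → ℝ) → Vec l) (k : Fin m → ℤ)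
    (w : Window a b → ℝ) : Matrix (Fin l) (Fin m) ℝ :=
  Matrix.of fun i j =>
    fderiv ℝ F w (fun q => if q.1 = j ∧ (q.2 : ℤ) = k j then 1 else 0) i

/-- `∂_{y_[k]} F` has constant rank near `w₀`. -/
def HasConstRankAt {m l : ℕ} {a b : Fin m → ℤ} (F : (Window a b → ℝ) → Vec l) (k : Fin m → ℤ)
    (w₀ : Window a b → ℝ) : Prop :=
  ∀ᶠ w in 𝓝 w₀, (jacobianAt F k w).rank = (jacobianAt F k w₀).rank

/-! ### Static feedback linearizability -/

/-- The linear system `z⁺ = A z + B w` is controllable. -/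
def Controllable {Z V : Type*} [AddCommGroup Z] [Module ℝ Z] [AddCommGroup V] [Module ℝ V]
    (A : Z →ₗ[ℝ] Z) (B : V →ₗ[ℝ] Z) : Prop :=
  (⨆ k : ℕ, LinearMap.range ((A ^ k) ∘ₗ B)) = ⊤

/-- The system `z⁺ = h(z,v)` is static feedback linearizable around the equilibrium `(z₀,v₀)`: a
local state transformation `T` and an invertible static feedback `v = α(z,w)` turn it into a
controllable linear system. -/
def StaticFeedbackLinearizable {Z V : Type*} [NormedAddCommGroup Z] [NormedSpace ℝ Z]
    [NormedAddCommGroup V] [NormedSpace ℝ V] (h : Z × V → Z) (z₀ : Z) (v₀ : V) : Prop :=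
  ∃ (T : Z → Z) (α : Z × V → V) (w₀ : V) (A : Z →ₗ[ℝ] Z) (B : V →ₗ[ℝ] Z),
    IsLocalDiffeo T z₀ ∧
    α (z₀, w₀) = v₀ ∧
    IsLocalDiffeo (fun q : Z × V => (q.1, α q)) (z₀, w₀) ∧
    Controllable A B ∧
    ∀ᶠ q in 𝓝 (z₀, w₀), T (h (q.1, α q)) = A (T q.1) + B q.2

/-! ### Prelongation and prolongation of two-input systems -/

/-- State `(a, x, b)` of the extended system, with `a k = ζ̄¹_[-(k+1)]` for `k < d₁` and
`b k = ū¹_[k]` for `k < d₂`. -/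
abbrev ExtState (n d₁ d₂ : ℕ) := Vec d₁ × Vec n × Vec d₂

/-- The transformed input `ū = (ū¹, ū²)` of the extended system, whose own input is
`v = (ū¹_[d₂], ū²)`: the first entry `ū¹` of the chain `ū¹, …, ū¹_[d₂]`, and `ū²`. -/
def ubar {d₂ : ℕ} (b : Vec d₂) (v : Vec 2) : Vec 2 :=
  ![(Fin.snoc (α := fun _ => ℝ) b (v 0) : Vec (d₂ + 1)) 0, v 1]

/-- The right-hand side of the system extended by a `d₁`-fold prelongation of `ḡ¹` and a `d₂`-fold
prolongation of `ū¹`, with input transformation `u = Φ_u(x,ū)`: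
`ζ̄¹_[-k]⁺ = ζ̄¹_[-k+1]` for `1 < k ≤ d₁`, `ζ̄¹_[-1]⁺ = ḡ¹(x,Φ_u(x,ū))`, `x⁺ = f(x,Φ_u(x,ū))`, and
`ū¹_[k]⁺ = ū¹_[k+1]` for `0 ≤ k < d₂`. -/
def extend {n d₁ d₂ : ℕ} (f : Vec n × Vec 2 → Vec n) (gbar1 : Vec n × Vec 2 → ℝ)
    (Φu : Vec n × Vec 2 → Vec 2) (q : ExtState n d₁ d₂ × Vec 2) : ExtState n d₁ d₂ :=
  let x := q.1.2.1
  let u := Φu (x, ubar q.1.2.2 q.2)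
  (Fin.init (α := fun _ => ℝ) (Fin.cons (α := fun _ => ℝ) (gbar1 (x, u)) q.1.1),
    f (x, u),
    Fin.tail (α := fun _ => ℝ) (Fin.snoc (α := fun _ => ℝ) q.1.2.2 (q.2 0)))

end FlatDT

end

namespace FlatDT

/-! ### Responses of linear systems -/

/-! The variables y_[-R₁,R₂-1] are to become the coordinates of two shift chains. Flatness includes
uniqueness of the parameterization as germs, so these variables are functionally independent
(`IsParam.eventuallyEq`, `IsParam.exists_variation`): an identity that holds along the points of the
system lifts to an identity between functions of the window, which can be differentiated variable by
variable.

The core is a statement on linear responses, `exists_common_length`. It is applied to the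
linearization at the equilibrium in forward time, and in backward time with input ζ, first output
y_[-1] and degrees γ_j - 1. In both cases the differentiated parameterization reconstructs the
initial input from the two output responses. Call r_j minus the degree of y^j its excess. If one
output had a positive excess larger than that of the other, a single input could be changed so that
only the extreme entry of this output moves inside the window; F_x would not depend on that entry,
contradicting minimality. So as soon as one excess is positive, both are equal. By constant rank,
the leading coefficients cannot both vanish at the equilibrium in that case. Delaying inputs then
shows that a nonzero leading coefficient of one output makes this output vanish on its window
whenever the other does; equality of the excesses allows the implication to be reversed by counting
dimensions. A separate argument covers nonpositive excesses. The result is that y¹ controls y² on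
the windows in both time directions, and that F_u depends to first order on y²_[r_22].

Hence the map `extChart` from the window to (y¹_[-γ_1],…,y¹_[-r_11], x, y¹_[ρ_1],…,y¹_[r_21-1]) has
a bijective differential (`IsParam.extChart_bijective`): injectivity is the control of y² by y¹,
surjectivity comes from steering y¹. Comparing dimensions gives d₁ + d₂ = #R - n. Since y¹_[ρ_1] is
a function of (x,u) and y¹_[-γ_1] one of (x,ζ_[-1]), with nonzero partial derivatives, they can be
chosen as ū¹ and ζ̄¹_[-1]. The added states are then exactly the shifts of y¹ in the chart, the
dynamics become two shift chains with input y_[R₂] (`IsParam.extend_extChart`), and the feedback is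
invertible because of the first-order dependence on y²_[r_22]. -/

/-- The response `∑_{i ≤ k} H_{k-i} u_i` to the input sequence `u` for the impulse response `H`. -/
noncomputable def response (H : ℕ → Vec 2 →ₗ[ℝ] ℝ) (u : ℕ → Vec 2) (k : ℕ) : ℝ :=
  ∑ i ∈ Finset.range (k + 1), H (k - i) (u i)

theorem response_add (H : ℕ → Vec 2 →ₗ[ℝ] ℝ) (u v : ℕ → Vec 2) (k : ℕ) :
    response H (u + v) k = response H u k + response H v k := by
  simp [response, Finset.sum_add_distrib]

theorem response_smul (H : ℕ → Vec 2 →ₗ[ℝ] ℝ) (c : ℝ) (u : ℕ → Vec 2) (k : ℕ) :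
    response H (c • u) k = c * response H u k := by
  simp [response, Finset.mul_sum]

theorem response_zero (H : ℕ → Vec 2 →ₗ[ℝ] ℝ) (u : ℕ → Vec 2) :
    response H u 0 = H 0 (u 0) := by
  simp [response]

theorem response_succ (H : ℕ → Vec 2 →ₗ[ℝ] ℝ) (u : ℕ → Vec 2) (k : ℕ) :
    response H u (k + 1) = H (k + 1) (u 0) + response H (fun i => u (i + 1)) k := by
  rw [response, Finset.sum_range_succ']
  simp [response, add_comm]

/-- The input sequence delayed by `s` steps. -/
noncomputable def delay (s : ℕ) (u : ℕ → Vec 2) (i : ℕ) : Vec 2 := if i < s then 0 else u (i - s)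

theorem response_delay_add (H : ℕ → Vec 2 →ₗ[ℝ] ℝ) (u : ℕ → Vec 2) (s k : ℕ) :
    response H (delay s u) (s + k) = response H u k := by
  unfold response
  rw [add_assoc, Finset.sum_range_add]
  rw [Finset.sum_eq_zero (fun i hi => by simp [delay, Finset.mem_range.1 hi]), zero_add]
  refine Finset.sum_congr rfl fun i _ => ?_
  rw [Nat.add_sub_add_left]
  simp [delay]

theorem response_delay_of_lt (H : ℕ → Vec 2 →ₗ[ℝ] ℝ) (u : ℕ → Vec 2) {s k : ℕ} (h : k < s) :
    response H (delay s u) k = 0 := by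
  unfold response
  refine Finset.sum_eq_zero fun i hi => ?_
  have : i < s := by have := Finset.mem_range.1 hi; omega
  simp [delay, this]

theorem response_of_lt {H : ℕ → Vec 2 →ₗ[ℝ] ℝ} {ρ : ℕ} (h : ∀ k < ρ, H k = 0) (u : ℕ → Vec 2)
    {k : ℕ} (hk : k < ρ) : response H u k = 0 := by
  unfold response
  refine Finset.sum_eq_zero fun i _ => ?_
  rw [h _ (by omega)]; rfl

/-- Inputs after time i have not yet passed the delay ρ, and the input at time i enters only through
H ρ. This triangular form is what `steer` solves recursively. -/
theorem response_degree_add {H : ℕ → Vec 2 →ₗ[ℝ] ℝ} {ρ : ℕ} (h : ∀ k < ρ, H k = 0)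
    (u : ℕ → Vec 2) (i : ℕ) :
    response H u (ρ + i) = H ρ (u i) + ∑ l : Fin i, H (ρ + i - l) (u l) := by
  unfold response
  rw [show ρ + i + 1 = (i + 1) + ρ by ring, Finset.sum_range_add, Finset.sum_range_succ,
    Finset.sum_eq_zero (s := Finset.range ρ), add_zero, add_comm,
    Finset.sum_range (fun l => H (ρ + i - l) (u l)), Nat.add_sub_cancel]
  intro l hl
  have := Finset.mem_range.1 hl
  rw [h _ (by omega)]; rfl

/-- An input sequence along `d` that makes the response, from time `ρ` on, equal to `t`. -/
noncomputable def steer (H : ℕ → Vec 2 →ₗ[ℝ] ℝ) (ρ : ℕ) (d : Vec 2) (t : ℕ → ℝ) (i : ℕ) : Vec 2 :=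
  ((t i - ∑ l : Fin i, H (ρ + i - l) (steer H ρ d t l)) / H ρ d) • d
termination_by i
decreasing_by exact l.2

theorem response_steer {H : ℕ → Vec 2 →ₗ[ℝ] ℝ} {ρ : ℕ} (h : ∀ k < ρ, H k = 0) {d : Vec 2}
    (hd : H ρ d ≠ 0) (t : ℕ → ℝ) (i : ℕ) : response H (steer H ρ d t) (ρ + i) = t i := by
  rw [response_degree_add h]
  conv_lhs => enter [1]; rw [steer]
  rw [map_smul, smul_eq_mul, div_mul_cancel₀ _ hd]
  ring

theorem exists_response_eq {H : ℕ → Vec 2 →ₗ[ℝ] ℝ} {ρ : ℕ} (h : ∀ k < ρ, H k = 0)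
    (hρ : H ρ ≠ 0) (t : ℕ → ℝ) : ∃ u, ∀ i, response H u (ρ + i) = t i := by
  obtain ⟨d, hd⟩ : ∃ d, H ρ d ≠ 0 := by
    by_contra! hc
    exact hρ (LinearMap.ext hc)
  exact ⟨_, response_steer h hd t⟩

/-- The impulse b produces nothing up to time ρ because H ρ b = 0; everything it produces later can
be cancelled by inputs from time 1 on, so the initial input stays b. -/
theorem exists_response_eq_zero {H : ℕ → Vec 2 →ₗ[ℝ] ℝ} {ρ : ℕ} (h : ∀ k < ρ, H k = 0)
    (hρ : H ρ ≠ 0) {b : Vec 2} (hb : H ρ b = 0) : ∃ u, u 0 = b ∧ ∀ k, response H u k = 0 := by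
  set s : ℕ → Vec 2 := Pi.single 0 b with hs
  -- The correction is applied with one step of delay, so its target at index i is minus the
  -- response to the impulse at time ρ + i + 1.
  obtain ⟨u, hu⟩ := exists_response_eq h hρ (fun i => - response H s (ρ + i + 1))
  refine ⟨s + delay 1 u, by simp [hs, delay], fun k => ?_⟩
  rcases lt_or_ge k ρ with hk | hk
  · exact response_of_lt h _ hk
  obtain ⟨i, rfl⟩ := Nat.exists_eq_add_of_le hk
  rw [response_add]
  cases i with
  | zero =>
    rw [response_degree_add h, response_degree_add h]
    simp [hs, hb, delay]
  | succ i =>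
    rw [show ρ + (i + 1) = 1 + (ρ + i) by ring, response_delay_add, hu,
      show 1 + (ρ + i) = ρ + i + 1 by ring]
    ring

/-- The response as a linear map, restricted to the times `ρ, …, ρ + e - 1`. -/
noncomputable def responseMap (H : ℕ → Vec 2 →ₗ[ℝ] ℝ) (ρ e : ℕ) :
    (ℕ → Vec 2) →ₗ[ℝ] (Fin e → ℝ) where
  toFun u i := response H u (ρ + i)
  map_add' u v := by ext i; exact response_add ..
  map_smul' c u := by ext i; exact response_smul ..

/-- The kernel inclusion makes L₁ factor through L₂; the factor is a surjective endomorphism of a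
finite-dimensional space, hence injective. -/
theorem ker_le_of_surjective {E : Type*} [AddCommGroup E] [Module ℝ E] {e : ℕ}
    {L₁ L₂ : E →ₗ[ℝ] (Fin e → ℝ)} (h₁ : Function.Surjective L₁) (h₂ : Function.Surjective L₂)
    (h : LinearMap.ker L₂ ≤ LinearMap.ker L₁) : LinearMap.ker L₁ ≤ LinearMap.ker L₂ := by
  obtain ⟨g, hg⟩ := L₂.exists_rightInverse_of_surjective (LinearMap.range_eq_top.2 h₂)
  have key : ∀ u, L₁ u = (L₁ ∘ₗ g) (L₂ u) := fun u => by
    have : u - g (L₂ u) ∈ LinearMap.ker L₁ := h (by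
      have := LinearMap.congr_fun hg (L₂ u)
      simp only [LinearMap.comp_apply, LinearMap.id_apply] at this
      simp [this])
    simpa [sub_eq_zero] using this
  have hs : Function.Surjective (L₁ ∘ₗ g) := fun y => by
    obtain ⟨u, rfl⟩ := h₁ y
    exact ⟨L₂ u, (key u).symm⟩
  have hi := LinearMap.injective_iff_surjective.2 hs
  intro u hu
  rw [LinearMap.mem_ker] at hu ⊢
  apply hi
  rw [← key, hu, map_zero]

/-- If one leading coefficient of the inverse system does not vanish, the vanishing of the other
response on its window forces the vanishing of this one. -/
theorem response_eq_zero_of_leading {H : Fin 2 → ℕ → Vec 2 →ₗ[ℝ] ℝ} {r : Fin 2 → ℕ}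
    {c : Fin 2 → ℕ → Vec 2}
    (hdec : ∀ u : ℕ → Vec 2, u 0 = ∑ j, ∑ k ∈ Finset.range (r j + 1), response (H j) u k • c j k)
    {i j : Fin 2} (hij : i ≠ j) (hc : c j (r j) ≠ 0) {u : ℕ → Vec 2}
    (hu : ∀ k < r i, response (H i) u k = 0) : ∀ k < r j, response (H j) u k = 0 := by
  intro k
  induction k using Nat.strong_induction_on with
  | _ k ih =>
    intro hk
    -- This delay moves the response of output j at time k to the leading position r j, while the
    -- initial input becomes 0. By induction all other terms of the reconstruction formula vanish.
    have hd := hdec (delay (r j - k) u)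
    have hpos : 0 < r j - k := by omega
    have hz : ∀ l < r i + 1, response (H i) (delay (r j - k) u) l = 0 := fun l hl => by
      rcases lt_or_ge l (r j - k) with h | h
      · exact response_delay_of_lt _ _ h
      · obtain ⟨a, rfl⟩ := Nat.exists_eq_add_of_le h
        rw [response_delay_add]
        exact hu _ (by omega)
    have hz' : ∀ l < r j, response (H j) (delay (r j - k) u) l = 0 := fun l hl => by
      rcases lt_or_ge l (r j - k) with h | h
      · exact response_delay_of_lt _ _ h
      · obtain ⟨a, rfl⟩ := Nat.exists_eq_add_of_le h
        rw [response_delay_add]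
        exact ih _ (by omega) (by omega)
    rw [Finset.sum_eq_single j (fun j' _ hj' => ?_) (by simp), Finset.sum_range_succ,
      Finset.sum_eq_zero (fun l hl => by rw [hz' l (Finset.mem_range.1 hl), zero_smul]), zero_add,
      show response (H j) (delay (r j - k) u) (r j) = response (H j) u k by
        conv_lhs => rw [show r j = (r j - k) + k by omega, Nat.add_sub_cancel]
        exact response_delay_add ..] at hd
    · have h0 : delay (r j - k) u 0 = 0 := by simp [delay, hpos]
      rw [h0] at hd
      exact (smul_eq_zero.1 hd.symm).resolve_right hc
    · obtain rfl : j' = i := by omega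
      exact Finset.sum_eq_zero fun l hl => by rw [hz l (Finset.mem_range.1 hl), zero_smul]

/-- The linear core: the two windows exceed the degrees by the same length `e`, one output
determines the other on the window, and the leading coefficient of the second one is nonzero. -/
theorem exists_common_length {H : Fin 2 → ℕ → Vec 2 →ₗ[ℝ] ℝ} {ρ r : Fin 2 → ℕ}
    {c : Fin 2 → ℕ → Vec 2} (h0 : ∀ j, ∀ k < ρ j, H j k = 0) (hρ : ∀ j, H j (ρ j) ≠ 0)
    (hdec : ∀ u : ℕ → Vec 2, u 0 = ∑ j, ∑ k ∈ Finset.range (r j + 1), response (H j) u k • c j k)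
    (hle : ∀ i j, ρ i < r i → r i + ρ j ≤ r j + ρ i)
    (hc : (∀ j, ρ j < r j) → ∃ j, c j (r j) ≠ 0) :
    ∃ e, (∀ j, r j = ρ j + e) ∧
      (∀ u, (∀ k < r 0, response (H 0) u k = 0) → ∀ k < r 1, response (H 1) u k = 0) ∧
      c 1 (r 1) ≠ 0 := by
  have hsurj : ∀ j e, Function.Surjective (responseMap (H j) (ρ j) e) := fun j e t => by
    obtain ⟨u, hu⟩ := exists_response_eq (h0 j) (hρ j) (fun i => if h : i < e then t ⟨i, h⟩ else 0)
    exact ⟨u, funext fun i => by simp [responseMap, hu]⟩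
  by_cases hlt : ∃ i, ρ i < r i
  -- A positive excess is at most the excess of the other output, which is therefore positive too;
  -- the inequality then holds in both directions.
  · obtain ⟨e, he, hre⟩ : ∃ e, 0 < e ∧ ∀ j, r j = ρ j + e := by
      obtain ⟨i, hi⟩ := hlt
      refine ⟨r i - ρ i, by omega, fun j => ?_⟩
      have h1 := hle i j hi
      have h2 := hle j i (by omega)
      omega
    have hker : ∀ j u, u ∈ LinearMap.ker (responseMap (H j) (ρ j) e) ↔
        ∀ k < r j, response (H j) u k = 0 := fun j u => by
      rw [LinearMap.mem_ker]
      constructor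
      · intro h k hk
        rcases lt_or_ge k (ρ j) with h' | h'
        · exact response_of_lt (h0 j) u h'
        · obtain ⟨a, rfl⟩ := Nat.exists_eq_add_of_le h'
          exact congrFun h ⟨a, by have := hre j; omega⟩
      · intro h
        ext i
        exact h _ (by have := hre j; omega)
    have h01 : ∀ u, (∀ k < r 0, response (H 0) u k = 0) → ∀ k < r 1, response (H 1) u k = 0 := by
      -- If the nonzero leading coefficient belongs to output 1, the implication is direct. If it
      -- belongs to output 0, only the converse is available, and it is reversed using that both
      -- responses map onto the same space of dimension e.
      obtain ⟨j, hj⟩ := hc fun j => by have := hre j; omega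
      intro u hu
      by_cases hj1 : j = 1
      · subst hj1
        exact response_eq_zero_of_leading hdec (i := 0) (by decide) hj hu
      · obtain rfl : j = 0 := by omega
        rw [← hker 1]
        refine ker_le_of_surjective (hsurj 0 e) (hsurj 1 e) (fun v hv => ?_) ((hker 0 u).2 hu)
        rw [hker] at hv ⊢
        exact response_eq_zero_of_leading hdec (i := 1) (by decide) hj hv
    refine ⟨e, hre, h01, fun hc1 => ?_⟩
    -- With two inputs and one scalar condition there is a nonzero initial input that can be hidden
    -- from output 0 forever. Were the leading coefficient of output 1 zero, both outputs would
    -- contribute nothing and this input would be reconstructed as 0.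
    obtain ⟨b, hb0, hb⟩ : ∃ b : Vec 2, b ≠ 0 ∧ H 0 (ρ 0) b = 0 := by
      have : LinearMap.ker (H 0 (ρ 0)) ≠ ⊥ :=
        LinearMap.ker_ne_bot_of_finrank_lt (by simp)
      obtain ⟨b, hb, hb0⟩ := Submodule.exists_mem_ne_zero_of_ne_bot this
      exact ⟨b, hb0, hb⟩
    obtain ⟨u, hu0, hu⟩ := exists_response_eq_zero (h0 0) (hρ 0) hb
    have hd := hdec u
    rw [Fin.sum_univ_two, Finset.sum_eq_zero (fun k _ => by rw [hu, zero_smul]), zero_add,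
      Finset.sum_range_succ, hc1, smul_zero, add_zero,
      Finset.sum_eq_zero (fun k hk => by
        rw [h01 u (fun k _ => hu k) k (Finset.mem_range.1 hk), zero_smul]), hu0] at hd
    exact hb0 hd
  · push Not at hlt
    -- Without positive excess, an impulse is seen in the window of output j at most at its last
    -- entry, and only if r j = ρ j. The identity of ℝ² is thus a sum of two maps of rank at most
    -- one, so both must be present and nonzero.
    have hd : ∀ b : Vec 2, b = ∑ j, (if r j = ρ j then H j (ρ j) b else 0) • c j (r j) := by
      intro b
      have := hdec (Pi.single 0 b)
      rw [Pi.single_eq_same] at this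
      refine this.trans (Finset.sum_congr rfl fun j _ => ?_)
      rw [Finset.sum_range_succ, Finset.sum_eq_zero (fun k hk => by
        rw [response_of_lt (h0 j) _ ((Finset.mem_range.1 hk).trans_le (hlt j)), zero_smul]),
        zero_add]
      congr 1
      split_ifs with h
      · have := response_degree_add (h0 j) (Pi.single 0 b) 0
        simpa [h] using this
      · exact response_of_lt (h0 j) _ (lt_of_le_of_ne (hlt j) h)
    have hspan : ∀ (ℓ : Vec 2 →ₗ[ℝ] ℝ) (v : Vec 2), ∃ b, b ≠ ℓ b • v := fun ℓ v => by
      have : LinearMap.ker ℓ ≠ ⊥ := LinearMap.ker_ne_bot_of_finrank_lt (by simp)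
      obtain ⟨b, hb, hb0⟩ := Submodule.exists_mem_ne_zero_of_ne_bot this
      exact ⟨b, by rw [LinearMap.mem_ker.1 hb, zero_smul]; exact hb0⟩
    have h1 : r 1 = ρ 1 ∧ c 1 (r 1) ≠ 0 := by
      by_contra hcon
      obtain ⟨b, hb⟩ := hspan (if r 0 = ρ 0 then H 0 (ρ 0) else 0) (c 0 (r 0))
      refine hb ((hd b).trans ?_)
      have hz : (if r 1 = ρ 1 then H 1 (ρ 1) b else 0) • c 1 (r 1) = 0 := by
        split_ifs with h
        · rw [not_and_not_right.1 hcon h, smul_zero]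
        · exact zero_smul ..
      rw [Fin.sum_univ_two, hz, add_zero]
      split_ifs <;> simp
    have h0' : r 0 = ρ 0 := by
      by_contra hcon
      obtain ⟨b, hb⟩ := hspan (H 1 (ρ 1)) (c 1 (r 1))
      refine hb ((hd b).trans ?_)
      simp [Fin.sum_univ_two, hcon, h1.1]
    exact ⟨0, Fin.forall_fin_two.2 ⟨h0', h1.1⟩,
      fun u _ k hk => response_of_lt (h0 1) u (h1.1 ▸ hk), h1.2⟩

/-! ### Smooth functions near a point -/

section Smooth

variable {E F G : Type*} [NormedAddCommGroup E] [NormedSpace ℝ E] [NormedAddCommGroup F]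
  [NormedSpace ℝ F] [NormedAddCommGroup G] [NormedSpace ℝ G]

theorem _root_.ContDiff.smoothNear {a : E → F} (h : ContDiff ℝ ∞ a) (p : E) : SmoothNear a p :=
  Eventually.of_forall fun _ => h.contDiffAt

theorem SmoothNear.contDiffAt {a : E → F} {p : E} (h : SmoothNear a p) : ContDiffAt ℝ ∞ a p :=
  Eventually.self_of_nhds h

theorem SmoothNear.continuousAt {a : E → F} {p : E} (h : SmoothNear a p) : ContinuousAt a p :=
  h.contDiffAt.continuousAt

theorem SmoothNear.differentiableAt {a : E → F} {p : E} (h : SmoothNear a p) :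
    DifferentiableAt ℝ a p :=
  h.contDiffAt.differentiableAt (by simp)

theorem SmoothNear.eventually_differentiableAt {a : E → F} {p : E} (h : SmoothNear a p) :
    ∀ᶠ q in 𝓝 p, DifferentiableAt ℝ a q :=
  h.mono fun _ hq => hq.differentiableAt (by simp)

theorem SmoothNear.comp {b : F → G} {a : E → F} {p : E} (hb : SmoothNear b (a p))
    (ha : SmoothNear a p) : SmoothNear (fun q => b (a q)) p := by
  filter_upwards [ha, ha.continuousAt.eventually hb] with q h1 h2
  exact h2.comp q h1

theorem SmoothNear.comp_of_eq {b : F → G} {a : E → F} {p : E} {z : F} (hb : SmoothNear b z)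
    (ha : SmoothNear a p) (h : a p = z) : SmoothNear (fun q => b (a q)) p := by
  subst h
  exact hb.comp ha

theorem SmoothNear.prodMk {a : E → F} {b : E → G} {p : E} (ha : SmoothNear a p)
    (hb : SmoothNear b p) : SmoothNear (fun q => (a q, b q)) p := by
  filter_upwards [ha, hb] with q h1 h2
  exact h1.prodMk h2

theorem SmoothNear.fst {a : E → F × G} {p : E} (ha : SmoothNear a p) :
    SmoothNear (fun q => (a q).1) p :=
  (contDiff_fst.smoothNear (a p)).comp ha

theorem SmoothNear.snd {a : E → F × G} {p : E} (ha : SmoothNear a p) :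
    SmoothNear (fun q => (a q).2) p :=
  (contDiff_snd.smoothNear (a p)).comp ha

theorem smoothNear_pi {ι : Type*} [Fintype ι] {a : E → ι → ℝ} {p : E} :
    SmoothNear a p ↔ ∀ i, SmoothNear (fun q => a q i) p := by
  simp only [SmoothNear, contDiffAt_pi, eventually_all]

theorem smoothNear_const (c : F) (p : E) : SmoothNear (fun _ => c) p :=
  contDiff_const.smoothNear p

theorem smoothNear_id (p : E) : SmoothNear (fun q => q) p :=
  contDiff_id.smoothNear p

theorem SmoothNear.sub {a b : E → F} {p : E} (ha : SmoothNear a p) (hb : SmoothNear b p) :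
    SmoothNear (fun q => a q - b q) p := by
  filter_upwards [ha, hb] with q h1 h2
  exact h1.sub h2

theorem SmoothNear.add {a b : E → F} {p : E} (ha : SmoothNear a p) (hb : SmoothNear b p) :
    SmoothNear (fun q => a q + b q) p := by
  filter_upwards [ha, hb] with q h1 h2
  exact h1.add h2

theorem SmoothNear.fderiv_apply {a : E → F} {p : E} (ha : SmoothNear a p) (d : E) :
    SmoothNear (fun q => fderiv ℝ a q d) p := by
  filter_upwards [ha] with q h
  exact (h.fderiv_right (m := ∞) (by simp)).clm_apply contDiffAt_const

theorem SmoothNear.congr {a b : E → F} {p : E} (ha : SmoothNear a p) (h : b =ᶠ[𝓝 p] a) :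
    SmoothNear b p := by
  filter_upwards [ha, h.eventually_nhds] with q h1 h2
  exact h1.congr_of_eventuallyEq h2

theorem LocalInverse.eq {a : E → F} {b : F → E} {p : E} (h : LocalInverse a b p) :
    b (a p) = p :=
  h.2.2.1.self_of_nhds

theorem LocalInverse.symm {a : E → F} {b : F → E} {p : E} (h : LocalInverse a b p) :
    LocalInverse b a (a p) := by
  have hp := h.eq
  exact ⟨h.2.1, by rw [hp]; exact h.1, h.2.2.2, by rw [hp]; exact h.2.2.1⟩

/-- This is the inverse function theorem. Invertibility of the derivative is an open condition,
which gives smoothness of the inverse at all points near `a p` and not only at `a p`. -/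
theorem exists_localInverse [FiniteDimensional ℝ E] [FiniteDimensional ℝ F] {a : E → F} {p : E}
    (ha : SmoothNear a p) (hbij : Function.Bijective (fderiv ℝ a p)) : ∃ b, LocalInverse a b p := by
  have : CompleteSpace E := FiniteDimensional.complete ℝ E
  let f' : E ≃L[ℝ] F :=
    (LinearEquiv.ofBijective (fderiv ℝ a p : E →ₗ[ℝ] F) hbij).toContinuousLinearEquiv
  have hf' : (f' : E →L[ℝ] F) = fderiv ℝ a p := by ext x; rfl
  have hd : HasFDerivAt a (f' : E →L[ℝ] F) p := by
    rw [hf']; exact ha.differentiableAt.hasFDerivAt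
  let e := ha.contDiffAt.toOpenPartialHomeomorph a hd (by simp)
  have he : (e : E → F) = a := ha.contDiffAt.toOpenPartialHomeomorph_coe hd (by simp)
  have hps : p ∈ e.source := ha.contDiffAt.mem_toOpenPartialHomeomorph_source hd (by simp)
  have hpt : a p ∈ e.target := he ▸ e.map_source hps
  have hsymm : e.symm (a p) = p := by
    have := e.left_inv hps
    rwa [he] at this
  have hcont : ContinuousAt e.symm (a p) := e.continuousAt_symm hpt
  refine ⟨e.symm, ha, ?_, ?_, ?_⟩
  · have hev : ∀ᶠ q in 𝓝 p, ContDiffAt ℝ ∞ a q ∧ ∃ A : E ≃L[ℝ] F, (A : E →L[ℝ] F) = fderiv ℝ a q := by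
      have hc : ContinuousAt (fderiv ℝ a) p :=
        (ha.contDiffAt.fderiv_right (m := ∞) (by simp)).continuousAt
      refine ha.and (hc.eventually (p := fun L => ∃ A : E ≃L[ℝ] F, (A : E →L[ℝ] F) = L) ?_)
      rw [← hf']
      exact f'.nhds
    rw [← hsymm] at hev
    filter_upwards [hcont.eventually hev, e.open_target.mem_nhds hpt] with q ⟨h1, A, hA⟩ h2
    refine e.contDiffAt_symm h2 (f₀' := A) ?_ (he ▸ h1)
    rw [he, hA]
    exact (h1.differentiableAt (by simp)).hasFDerivAt
  · filter_upwards [e.open_source.mem_nhds hps] with q hq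
    have := e.left_inv hq
    rwa [he] at this
  · filter_upwards [e.open_target.mem_nhds hpt] with q hq
    have := e.right_inv hq
    rwa [he] at this

/-- A function whose derivative along `d` vanishes near `p` does not change along `d`. -/
theorem eventually_eq_of_fderiv_apply_eq_zero {a : E → F} {p : E} (ha : SmoothNear a p) {d : E}
    (h0 : ∀ᶠ q in 𝓝 p, fderiv ℝ a q d = 0) {ℓ : E → ℝ} (hℓ : ContinuousAt ℓ p) (hℓp : ℓ p = 0) :
    ∀ᶠ q in 𝓝 p, a (q - ℓ q • d) = a q := by
  obtain ⟨r, hr, hball⟩ := Metric.eventually_nhds_iff_ball.1 (ha.eventually_differentiableAt.and h0)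
  have hmem : ∀ᶠ q in 𝓝 p, q - ℓ q • d ∈ Metric.ball p r := by
    have : ContinuousAt (fun q => q - ℓ q • d) p :=
      continuousAt_id.sub (hℓ.smul continuousAt_const)
    refine this.eventually (p := fun z => z ∈ Metric.ball p r) ?_
    change ∀ᶠ y in 𝓝 (p - ℓ p • d), _
    rw [hℓp, zero_smul, sub_zero]
    exact Metric.ball_mem_nhds p hr
  filter_upwards [hmem, Metric.ball_mem_nhds p hr] with q hq1 hq2
  have hseg : ∀ t ∈ Set.Icc (0 : ℝ) 1, q - (t * ℓ q) • d ∈ Metric.ball p r := fun t ht => by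
    have := (convex_ball p r).add_smul_sub_mem hq2 hq1 ht
    convert this using 1
    module
  have hder : ∀ t ∈ Set.Icc (0 : ℝ) 1, HasDerivWithinAt (fun t : ℝ => a (q - (t * ℓ q) • d)) 0
      (Set.Icc 0 1) t := fun t ht => by
    obtain ⟨h1, h2⟩ := hball _ (hseg t ht)
    have h3 : HasDerivAt (fun t : ℝ => q - (t * ℓ q) • d) (-(ℓ q • d)) t := by
      have := (((hasDerivAt_id t).mul_const (ℓ q)).smul_const d).const_sub q
      simpa using this
    have := h1.hasFDerivAt.comp_hasDerivAt t h3
    rw [map_neg, map_smul, h2, smul_zero, neg_zero] at this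
    exact this.hasDerivWithinAt
  have := constant_of_has_deriv_right_zero (a := (0 : ℝ)) (b := 1)
    (f := fun t : ℝ => a (q - (t * ℓ q) • d))
    (fun t ht => (hder t ht).continuousWithinAt)
    (fun t ht => ((hder t (Set.Ico_subset_Icc_self ht)).mono_of_mem_nhdsWithin
      (Icc_mem_nhdsGE_of_mem ht))) 1 (by simp)
  simpa using this

/-- A function whose partial derivative in the second variable vanishes near `(x₀, v₀)` does not
depend on this variable. -/
theorem eventually_eq_of_fderiv_snd_eq_zero {a : E × F → G} {x₀ : E} {v₀ : F}
    (ha : SmoothNear a (x₀, v₀))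
    (h0 : ∀ᶠ q in 𝓝 (x₀, v₀), fderiv ℝ (fun v => a (q.1, v)) q.2 = 0) :
    ∀ᶠ q in 𝓝 (x₀, v₀), a q = a (q.1, v₀) := by
  obtain ⟨r, hr, hball⟩ := Metric.eventually_nhds_iff_ball.1 (ha.eventually_differentiableAt.and h0)
  filter_upwards [Metric.ball_mem_nhds _ hr] with q hq
  have hq' := hq
  rw [← ball_prod_same, Set.mem_prod] at hq'
  have hin : ∀ v ∈ Metric.ball v₀ r, (q.1, v) ∈ Metric.ball (x₀, v₀) r := fun v hv => by
    rw [← ball_prod_same]; exact ⟨hq'.1, hv⟩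
  refine (Metric.isOpen_ball.is_const_of_fderiv_eq_zero (𝕜 := ℝ) (f := fun v => a (q.1, v))
    (convex_ball v₀ r).isPreconnected (fun v hv => ?_) (fun v hv => ?_) hq'.2
    (Metric.mem_ball_self hr))
  · have h1 := (hball _ (hin v hv)).1
    exact (h1.comp v (by fun_prop : DifferentiableAt ℝ (fun v => (q.1, v)) v)).differentiableWithinAt
  · exact (hball _ (hin v hv)).2

/-- A map `(x, v) ↦ (x, α(x, v))` with injective partial derivative of `α` in `v` is a local
diffeomorphism. -/
theorem exists_localInverse_prodMk_fst [FiniteDimensional ℝ E] [FiniteDimensional ℝ F]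
    {α : E × F → F} {x₀ : E} {v₀ : F} (hα : SmoothNear α (x₀, v₀))
    (hinj : ∀ v, fderiv ℝ α (x₀, v₀) (0, v) = 0 → v = 0) :
    ∃ Φ : E × F → F, LocalInverse (fun q => (q.1, α q)) (fun q => (q.1, Φ q)) (x₀, v₀) := by
  have hs : SmoothNear (fun q : E × F => (q.1, α q)) (x₀, v₀) :=
    (contDiff_fst.smoothNear _).prodMk hα
  have hfd : ∀ d, fderiv ℝ (fun q : E × F => (q.1, α q)) (x₀, v₀) d =
      (d.1, fderiv ℝ α (x₀, v₀) d) := fun d => by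
    have : HasFDerivAt (fun q : E × F => (q.1, α q))
      ((ContinuousLinearMap.fst ℝ E F).prod (fderiv ℝ α (x₀, v₀))) (x₀, v₀) :=
      hasFDerivAt_fst.prodMk hα.differentiableAt.hasFDerivAt
    rw [this.fderiv]; rfl
  have hinj' : Function.Injective (fderiv ℝ (fun q : E × F => (q.1, α q)) (x₀, v₀)) := by
    rw [injective_iff_map_eq_zero]
    rintro ⟨x, v⟩ h
    rw [hfd, Prod.mk_eq_zero] at h
    obtain ⟨rfl, h2⟩ := h
    rw [hinj v h2]; rfl
  obtain ⟨b, hb⟩ := exists_localInverse hs ⟨hinj',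
    (LinearMap.injective_iff_surjective (f := (fderiv ℝ (fun q : E × F => (q.1, α q))
      (x₀, v₀) : E × F →ₗ[ℝ] E × F))).1 hinj'⟩
  have hbe : (fun q : E × F => (q.1, (b q).2)) =ᶠ[𝓝 (x₀, α (x₀, v₀))] b := by
    filter_upwards [hb.2.2.2] with q hq
    have := congrArg Prod.fst hq
    exact Prod.ext this.symm rfl
  refine ⟨fun q => (b q).2, hs, hb.2.1.congr hbe, ?_, ?_⟩
  · filter_upwards [hs.continuousAt.eventually hbe, hb.2.2.1] with q h1 h2
    exact h1.trans h2
  · filter_upwards [hbe, hb.2.2.2] with q h1 h2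
    rw [← h1] at h2
    exact h2

/-- A scalar function with nonvanishing partial derivative can be completed to a transformation. -/
theorem exists_completion [FiniteDimensional ℝ E] {η : E × Vec 2 → ℝ} {x₀ : E} {v₀ : Vec 2}
    (hη : SmoothNear η (x₀, v₀)) (h0 : fderiv ℝ η (x₀, v₀) ∘L ContinuousLinearMap.inr ℝ E (Vec 2) ≠ 0) :
    ∃ θ Φ : E × Vec 2 → Vec 2, (∀ q, θ q 0 = η q) ∧
      LocalInverse (fun q => (q.1, θ q)) (fun q => (q.1, Φ q)) (x₀, v₀) ∧
      ∀ v, fderiv ℝ θ (x₀, v₀) (0, v) = 0 → v = 0 := by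
  set A := fderiv ℝ η (x₀, v₀) ∘L ContinuousLinearMap.inr ℝ E (Vec 2) with hA
  -- The complementary function is a coordinate projection: `v 0` if the partial derivative of η
  -- along it vanishes, and `v 1` otherwise.
  obtain ⟨β, hβ⟩ : ∃ β : Vec 2 →L[ℝ] ℝ, ∀ v, A v = 0 → β v = 0 → v = 0 := by
    have hv : ∀ v : Vec 2, A v = v 0 * A (Pi.single 0 1) + v 1 * A (Pi.single 1 1) := fun v => by
      have hvv : v = v 0 • Pi.single 0 1 + v 1 • Pi.single 1 1 := by
        ext i; fin_cases i <;> simp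
      have := congrArg A hvv
      rwa [map_add, map_smul, map_smul] at this
    by_cases h : A (Pi.single 0 1) = 0
    · have h1 : A (Pi.single 1 1) ≠ 0 := fun h1 => h0 (by
        refine ContinuousLinearMap.ext fun v => ?_
        rw [hv, h, h1]; simp)
      refine ⟨ContinuousLinearMap.proj 0, fun v hv0 hv1 => ?_⟩
      rw [hv, h] at hv0
      have : v 1 = 0 := by simpa [h1] using hv0
      ext i; fin_cases i
      · exact hv1
      · exact this
    · refine ⟨ContinuousLinearMap.proj 1, fun v hv0 hv1 => ?_⟩
      have hv1' : v 1 = 0 := hv1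
      rw [hv, hv1'] at hv0
      have : v 0 = 0 := by simpa [h] using hv0
      ext i; fin_cases i
      · exact this
      · exact hv1'
  let θ : E × Vec 2 → Vec 2 := fun q => ![η q, β q.2]
  have hθ : SmoothNear θ (x₀, v₀) := by
    refine smoothNear_pi.2 fun i => ?_
    fin_cases i
    · exact hη
    · exact (β.contDiff.comp contDiff_snd).smoothNear _
  have hθ' : ∀ d, fderiv ℝ θ (x₀, v₀) d = ![fderiv ℝ η (x₀, v₀) d, β d.2] := fun d => by
    have : HasFDerivAt θ (ContinuousLinearMap.pi
        ![fderiv ℝ η (x₀, v₀), β ∘L ContinuousLinearMap.snd ℝ E (Vec 2)]) (x₀, v₀) := by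
      rw [hasFDerivAt_pi']
      intro i
      fin_cases i
      · exact hη.differentiableAt.hasFDerivAt
      · exact (β ∘L ContinuousLinearMap.snd ℝ E (Vec 2)).hasFDerivAt
    rw [this.fderiv]
    ext i; fin_cases i <;> rfl
  have hinj : ∀ v, fderiv ℝ θ (x₀, v₀) (0, v) = 0 → v = 0 := fun v hv => by
    rw [hθ'] at hv
    exact hβ v (congrFun hv 0) (congrFun hv 1)
  obtain ⟨Φ, hΦ⟩ := exists_localInverse_prodMk_fst hθ hinj
  exact ⟨θ, Φ, fun q => rfl, hΦ, hinj⟩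

end Smooth

/-! ### Trajectories and outputs of systems in one time direction -/

section Trajectory

variable {X V : Type*}

/-- The state at time `k` for the initial state `x` and the input sequence `u`. -/
def traj (h : X × V → X) (x : X) (u : ℕ → V) : ℕ → X
  | 0 => x
  | k + 1 => h (traj h x u k, u k)

/-- The output `out` at time `k` for the initial state and the input sequence `q`. -/
def obs (h : X × V → X) (out : X × V → ℝ) (q : X × (ℕ → V)) (k : ℕ) : ℝ :=
  out (traj h q.1 q.2 k, q.2 k)

theorem traj_add (h : X × V → X) (x : X) (u : ℕ → V) (s k : ℕ) :
    traj h x u (s + k) = traj h (traj h x u s) (fun i => u (s + i)) k := by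
  induction k with
  | zero => rfl
  | succ k ih => rw [← add_assoc, traj, ih, traj]

theorem traj_congr (h : X × V → X) (x : X) {u u' : ℕ → V} {k : ℕ} (hu : ∀ i < k, u i = u' i) :
    traj h x u k = traj h x u' k := by
  induction k with
  | zero => rfl
  | succ k ih => rw [traj, traj, ih fun i hi => hu i (by omega), hu k (by omega)]

theorem obs_congr (h : X × V → X) (out : X × V → ℝ) {q q' : X × (ℕ → V)} {k : ℕ}
    (hx : q.1 = q'.1) (hu : ∀ i ≤ k, q.2 i = q'.2 i) : obs h out q k = obs h out q' k := by
  rw [obs, obs, hx, traj_congr h _ fun i hi => hu i hi.le, hu k le_rfl]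

theorem obs_add (h : X × V → X) (out : X × V → ℝ) (q : X × (ℕ → V)) (s k : ℕ) :
    obs h out q (s + k) = obs h out (traj h q.1 q.2 s, fun i => q.2 (s + i)) k := by
  rw [obs, traj_add, obs]

theorem obs_succ (h : X × V → X) (out : X × V → ℝ) (q : X × (ℕ → V)) (k : ℕ) :
    obs h out q (k + 1) = obs h out (h (q.1, q.2 0), fun i => q.2 (i + 1)) k := by
  rw [add_comm, obs_add]
  simp [traj, add_comm]

end Trajectory

/-! ### Observed systems: degrees and dependence on the initial input -/

/-- A system with two inputs and a scalar output, smooth around an equilibrium. -/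
structure ObservedSystem (X : Type*) [NormedAddCommGroup X] [NormedSpace ℝ X] where
  h : X × Vec 2 → X
  out : X × Vec 2 → ℝ
  x₀ : X
  v₀ : Vec 2
  smooth_h : SmoothNear h (x₀, v₀)
  smooth_out : SmoothNear out (x₀, v₀)
  equilibrium : h (x₀, v₀) = x₀

namespace ObservedSystem

variable {X : Type*} [NormedAddCommGroup X] [NormedSpace ℝ X] (O : ObservedSystem X)

/-- The equilibrium with constant input sequence. -/
def base : X × (ℕ → Vec 2) := (O.x₀, fun _ => O.v₀)

/-- `ρ` is the degree of the output: the first time at which the initial input appears. -/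
def IsDegree (ρ : ℕ) : Prop :=
  (∀ k < ρ, ∀ᶠ q in 𝓝 O.base,
    fderiv ℝ (fun v => obs O.h O.out (q.1, Function.update q.2 0 v) k) (q.2 0) = 0) ∧
  fderiv ℝ (fun v => obs O.h O.out (O.x₀, Function.update (fun _ => O.v₀) 0 v) ρ) O.v₀ ≠ 0

/-- The output at time `k` for the constant input of the equilibrium. -/
def κ (k : ℕ) (x : X) : ℝ := obs O.h O.out (x, fun _ => O.v₀) k

/-- The output at time `k` when only the initial input differs from the equilibrium. -/
def η : ℕ → X × Vec 2 → ℝ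
  | 0 => O.out
  | k + 1 => fun q => O.κ k (O.h q)

theorem κ_eq_η (k : ℕ) (x : X) : O.κ k x = O.η k (x, O.v₀) := by
  cases k with
  | zero => rfl
  | succ k => rw [κ, obs_succ]; rfl

theorem traj_base (k : ℕ) : traj O.h O.x₀ (fun _ => O.v₀) k = O.x₀ := by
  induction k with
  | zero => rfl
  | succ k ih => rw [traj, ih, O.equilibrium]

theorem obs_base (k : ℕ) : obs O.h O.out O.base k = O.out (O.x₀, O.v₀) := by
  simp [obs, base, traj_base]

section Smooth

variable {E : Type*} [NormedAddCommGroup E] [NormedSpace ℝ E] {e : E} {x : E → X} {u : E → ℕ → Vec 2}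

theorem smoothNear_traj (hx : SmoothNear x e) (hx0 : x e = O.x₀)
    (hu : ∀ i, SmoothNear (fun t => u t i) e) (hu0 : ∀ i, u e i = O.v₀) (k : ℕ) :
    SmoothNear (fun t => traj O.h (x t) (u t) k) e ∧ traj O.h (x e) (u e) k = O.x₀ := by
  induction k with
  | zero => exact ⟨hx, hx0⟩
  | succ k ih =>
    refine ⟨O.smooth_h.comp_of_eq (ih.1.prodMk (hu k)) (by rw [ih.2, hu0]), ?_⟩
    rw [traj, ih.2, hu0, O.equilibrium]

theorem smoothNear_obs (hx : SmoothNear x e) (hx0 : x e = O.x₀)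
    (hu : ∀ i, SmoothNear (fun t => u t i) e) (hu0 : ∀ i, u e i = O.v₀) (k : ℕ) :
    SmoothNear (fun t => obs O.h O.out (x t, u t) k) e := by
  obtain ⟨h1, h2⟩ := O.smoothNear_traj hx hx0 hu hu0 k
  exact O.smooth_out.comp_of_eq (h1.prodMk (hu k)) (by simp only [h2, hu0])

end Smooth

theorem smoothNear_κ (k : ℕ) : SmoothNear (O.κ k) O.x₀ :=
  O.smoothNear_obs (smoothNear_id _) rfl (fun _ => smoothNear_const _ _) (fun _ => rfl) k

theorem smoothNear_η (k : ℕ) : SmoothNear (O.η k) (O.x₀, O.v₀) := by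
  cases k with
  | zero => exact O.smooth_out
  | succ k => exact (O.smoothNear_κ k).comp_of_eq O.smooth_h O.equilibrium

theorem continuousAt_traj (k : ℕ) :
    ContinuousAt (fun q : X × (ℕ → Vec 2) => traj O.h q.1 q.2 k) O.base := by
  induction k with
  | zero => exact continuousAt_fst
  | succ k ih =>
    refine ContinuousAt.comp_of_eq O.smooth_h.continuousAt
      (ih.prodMk ((continuous_apply k).comp continuous_snd).continuousAt) ?_
    simp [base, traj_base]

theorem tendsto_traj (s : ℕ) :
    Tendsto (fun q : X × (ℕ → Vec 2) => (traj O.h q.1 q.2 s, fun i => q.2 (s + i)))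
      (𝓝 O.base) (𝓝 O.base) := by
  have : ContinuousAt (fun q : X × (ℕ → Vec 2) => (traj O.h q.1 q.2 s, fun i => q.2 (s + i)))
      O.base := (O.continuousAt_traj s).prodMk (by fun_prop)
  simpa [ContinuousAt, base, traj_base] using this

theorem tendsto_initial (s : ℕ) :
    Tendsto (fun q : X × (ℕ → Vec 2) => (traj O.h q.1 q.2 s, q.2 s)) (𝓝 O.base)
      (𝓝 (O.x₀, O.v₀)) := by
  have : ContinuousAt (fun q : X × (ℕ → Vec 2) => (traj O.h q.1 q.2 s, q.2 s))
      O.base := (O.continuousAt_traj s).prodMk (by fun_prop)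
  simpa [ContinuousAt, base, traj_base] using this

theorem tendsto_update_const :
    Tendsto (fun q : X × Vec 2 => (q.1, Function.update (fun _ : ℕ => O.v₀) 0 q.2))
      (𝓝 (O.x₀, O.v₀)) (𝓝 O.base) := by
  have : ContinuousAt (fun q : X × Vec 2 => (q.1, Function.update (fun _ : ℕ => O.v₀) 0 q.2))
      (O.x₀, O.v₀) := by
    refine continuousAt_fst.prodMk (Continuous.continuousAt ?_)
    exact continuous_const.update 0 continuous_snd
  simpa [ContinuousAt, base] using this

variable {O}

/-- Both claims advance together. If the output at time k < ρ depends on the state and the initial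
input only, its vanishing derivative removes the input; one step later the initial input can then
enter only through the successor state. -/
theorem IsDegree.eventually_obs {ρ : ℕ} (hρ : O.IsDegree ρ) (k : ℕ) :
    (k ≤ ρ → ∀ᶠ q in 𝓝 O.base, obs O.h O.out q k = O.η k (q.1, q.2 0)) ∧
    (k < ρ → ∀ᶠ q in 𝓝 O.base, obs O.h O.out q k = O.κ k q.1) := by
  have step : ∀ k < ρ, (∀ᶠ q in 𝓝 O.base, obs O.h O.out q k = O.η k (q.1, q.2 0)) →
      ∀ᶠ q in 𝓝 O.base, obs O.h O.out q k = O.κ k q.1 := fun k hk hη => by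
    have h1 := O.tendsto_update_const.eventually (hρ.1 k hk)
    have h2 := (O.tendsto_update_const.eventually hη).eventually_nhds
    have h3 : ∀ᶠ q in 𝓝 (O.x₀, O.v₀), fderiv ℝ (fun v => O.η k (q.1, v)) q.2 = 0 := by
      filter_upwards [h1, h2] with q hq1 hq2
      simp only [Function.update_idem, Function.update_self] at hq1 hq2
      rw [← hq1]
      refine Filter.EventuallyEq.fderiv_eq ?_
      have hc : ContinuousAt (fun v => (q.1, v)) q.2 := by fun_prop
      filter_upwards [hc.eventually hq2] with v hv
      exact hv.symm
    have h4 := eventually_eq_of_fderiv_snd_eq_zero (O.smoothNear_η k) h3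
    filter_upwards [hη, (O.tendsto_initial 0).eventually h4] with q hq1 hq2
    rw [hq1, κ_eq_η]
    exact hq2
  induction k with
  | zero =>
    have : ∀ᶠ q in 𝓝 O.base, obs O.h O.out q 0 = O.η 0 (q.1, q.2 0) :=
      Eventually.of_forall fun q => rfl
    exact ⟨fun _ => this, fun h => step 0 h this⟩
  | succ k ih =>
    have : k + 1 ≤ ρ →
        ∀ᶠ q in 𝓝 O.base, obs O.h O.out q (k + 1) = O.η (k + 1) (q.1, q.2 0) := fun hk => by
      filter_upwards [(O.tendsto_traj 1).eventually (ih.2 (by omega))] with q hq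
      rw [add_comm, obs_add, hq, add_comm]
      rfl
    exact ⟨this, fun h => step (k + 1) h (this h.le)⟩

theorem IsDegree.eventually_obs_add_lt {ρ : ℕ} (hρ : O.IsDegree ρ) (s : ℕ) {k : ℕ} (hk : k < ρ) :
    ∀ᶠ q in 𝓝 O.base, obs O.h O.out q (s + k) = O.κ k (traj O.h q.1 q.2 s) := by
  filter_upwards [(O.tendsto_traj s).eventually ((hρ.eventually_obs k).2 hk)] with q hq
  rw [obs_add, hq]

theorem IsDegree.eventually_obs_add {ρ : ℕ} (hρ : O.IsDegree ρ) (s : ℕ) :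
    ∀ᶠ q in 𝓝 O.base, obs O.h O.out q (s + ρ) = O.η ρ (traj O.h q.1 q.2 s, q.2 s) := by
  filter_upwards [(O.tendsto_traj s).eventually ((hρ.eventually_obs ρ).1 le_rfl)] with q hq
  rw [obs_add, hq]
  rfl

theorem IsDegree.fderiv_η_ne_zero {ρ : ℕ} (hρ : O.IsDegree ρ) :
    fderiv ℝ (O.η ρ) (O.x₀, O.v₀) ∘L ContinuousLinearMap.inr ℝ X (Vec 2) ≠ 0 := by
  have h1 := O.tendsto_update_const.eventually ((hρ.eventually_obs ρ).1 le_rfl)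
  have hc : ContinuousAt (fun v : Vec 2 => (O.x₀, v)) O.v₀ := by fun_prop
  have h2 : (fun v => obs O.h O.out (O.x₀, Function.update (fun _ => O.v₀) 0 v) ρ) =ᶠ[𝓝 O.v₀]
      fun v => O.η ρ (O.x₀, v) := by
    filter_upwards [hc.eventually h1] with v hv
    simpa using hv
  have h3 := hρ.2
  rw [h2.fderiv_eq] at h3
  have h4 : HasFDerivAt (fun v => O.η ρ (O.x₀, v))
      (fderiv ℝ (O.η ρ) (O.x₀, O.v₀) ∘L ContinuousLinearMap.inr ℝ X (Vec 2)) O.v₀ :=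
    (O.smoothNear_η ρ).differentiableAt.hasFDerivAt.comp O.v₀ (hasFDerivAt_prodMk_right _ _)
  rwa [h4.fderiv] at h3

/-! ### Linearization and impulse response of an observed system -/

variable (O)

/-- The output at time `k` of the linearization at the equilibrium. -/
noncomputable def linObs (q : X × (ℕ → Vec 2)) (k : ℕ) : ℝ :=
  obs (fderiv ℝ O.h (O.x₀, O.v₀)) (fderiv ℝ O.out (O.x₀, O.v₀)) q k

theorem hasDerivAt_obs {x : ℝ → X} {u : ℝ → ℕ → Vec 2} {ξ : X} {υ : ℕ → Vec 2}
    (hx : HasDerivAt x ξ 0) (hx0 : x 0 = O.x₀)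
    (hu : ∀ i, HasDerivAt (fun t => u t i) (υ i) 0) (hu0 : ∀ i, u 0 i = O.v₀) (k : ℕ) :
    HasDerivAt (fun t => obs O.h O.out (x t, u t) k) (O.linObs (ξ, υ) k) 0 := by
  have key : HasDerivAt (fun t => traj O.h (x t) (u t) k)
      (traj (fderiv ℝ O.h (O.x₀, O.v₀)) ξ υ k) 0 ∧ traj O.h (x 0) (u 0) k = O.x₀ := by
    induction k with
    | zero => exact ⟨hx, hx0⟩
    | succ k ih =>
      refine ⟨?_, by rw [traj, ih.2, hu0, O.equilibrium]⟩
      have := O.smooth_h.differentiableAt.hasFDerivAt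
      rw [← ih.2, ← hu0 k] at this
      have := this.comp_hasDerivAt 0 (ih.1.prodMk (hu k))
      rw [ih.2, hu0] at this
      exact this
  have := O.smooth_out.differentiableAt.hasFDerivAt
  rw [← key.2, ← hu0 k] at this
  have := this.comp_hasDerivAt 0 (key.1.prodMk (hu k))
  rw [key.2, hu0] at this
  exact this

/-- The impulse response of the linearization. -/
noncomputable def impulse : ℕ → Vec 2 →ₗ[ℝ] ℝ
  | 0 => (fderiv ℝ O.out (O.x₀, O.v₀)).toLinearMap ∘ₗ LinearMap.inr ℝ X (Vec 2)
  | k + 1 => (fderiv ℝ O.out (O.x₀, O.v₀)).toLinearMap ∘ₗ LinearMap.inl ℝ X (Vec 2) ∘ₗ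
      (((fderiv ℝ O.h (O.x₀, O.v₀)).toLinearMap ∘ₗ LinearMap.inl ℝ X (Vec 2)) ^ k) ∘ₗ
      (fderiv ℝ O.h (O.x₀, O.v₀)).toLinearMap ∘ₗ LinearMap.inr ℝ X (Vec 2)

/-- Superposition of the free response of the initial state and the forced response of the inputs.
-/
theorem linObs_eq (ξ : X) (υ : ℕ → Vec 2) (k : ℕ) :
    O.linObs (ξ, υ) k = fderiv ℝ O.out (O.x₀, O.v₀)
      ((((fderiv ℝ O.h (O.x₀, O.v₀)).toLinearMap ∘ₗ LinearMap.inl ℝ X (Vec 2)) ^ k) ξ, 0) +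
      response O.impulse υ k := by
  have hsplit : ∀ (a : X) (b : Vec 2), fderiv ℝ O.out (O.x₀, O.v₀) (a, b) =
      fderiv ℝ O.out (O.x₀, O.v₀) (a, 0) + fderiv ℝ O.out (O.x₀, O.v₀) (0, b) := fun a b => by
    rw [← map_add]; simp
  have hsplit' : ∀ (a : X) (b : Vec 2), fderiv ℝ O.h (O.x₀, O.v₀) (a, b) =
      fderiv ℝ O.h (O.x₀, O.v₀) (a, 0) + fderiv ℝ O.h (O.x₀, O.v₀) (0, b) := fun a b => by
    rw [← map_add]; simp
  induction k generalizing ξ υ with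
  | zero =>
    rw [response_zero, linObs, obs, traj, hsplit]
    rfl
  | succ k ih =>
    have hi := ih (fderiv ℝ O.h (O.x₀, O.v₀) (ξ, υ 0)) (fun i => υ (i + 1))
    rw [linObs, obs_succ, ← linObs]
    simp only
    rw [hi, response_succ, hsplit' ξ, map_add, pow_succ, ← add_assoc]
    congr 1
    rw [← Prod.mk_zero_add_mk_zero, map_add]
    rfl

theorem linObs_zero (υ : ℕ → Vec 2) (k : ℕ) :
    O.linObs (0, υ) k = response O.impulse υ k := by
  rw [linObs_eq, map_zero, ← Prod.zero_eq_mk, map_zero, zero_add]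

theorem linObs_add (q q' : X × (ℕ → Vec 2)) (k : ℕ) :
    O.linObs (q + q') k = O.linObs q k + O.linObs q' k := by
  rcases q with ⟨ξ, υ⟩
  rcases q' with ⟨ξ', υ'⟩
  rw [Prod.mk_add_mk, linObs_eq, linObs_eq, linObs_eq, map_add, response_add,
    ← Prod.mk_zero_add_mk_zero, map_add]
  ring

variable {O}

/-- This translates the degree conditions into conditions on the impulse response: it vanishes
before time ρ and is nonzero at time ρ. -/
theorem fderiv_obs_update (k : ℕ) (b : Vec 2) :
    fderiv ℝ (fun v => obs O.h O.out (O.x₀, Function.update (fun _ => O.v₀) 0 v) k) O.v₀ b =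
      O.impulse k b := by
  have hs : SmoothNear
      (fun v => obs O.h O.out (O.x₀, Function.update (fun _ => O.v₀) 0 v) k) O.v₀ := by
    refine O.smoothNear_obs (smoothNear_const _ _) rfl (fun i => ?_) (fun i => by simp) k
    by_cases hi : i = 0
    · subst hi; simpa using smoothNear_id O.v₀
    · simpa [hi] using smoothNear_const O.v₀ O.v₀
  have hl : HasDerivAt (fun t : ℝ => O.v₀ + t • b) b 0 := by
    simpa using ((hasDerivAt_id (0 : ℝ)).smul_const b).const_add O.v₀
  have h1 := hs.differentiableAt.hasFDerivAt
  have h2 := h1.comp_hasDerivAt_of_eq 0 hl (by simp)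
  have h3 := O.hasDerivAt_obs (x := fun _ => O.x₀)
    (u := fun t => Function.update (fun _ => O.v₀) 0 (O.v₀ + t • b))
    (υ := Pi.single 0 b) (hasDerivAt_const _ _) rfl (fun i => by
      by_cases hi : i = 0
      · subst hi; simpa using hl
      · simpa [hi] using hasDerivAt_const (0 : ℝ) O.v₀) (fun i => by simp) k
  rw [linObs_zero] at h3
  have h4 : response O.impulse (Pi.single 0 b) k = O.impulse k b := by
    rw [response, Finset.sum_eq_single 0 (fun i _ hi => by simp [hi]) (by simp)]
    simp
  rw [h4] at h3
  exact h2.unique h3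

theorem IsDegree.impulse_eq_zero {ρ : ℕ} (hρ : O.IsDegree ρ) : ∀ k < ρ, O.impulse k = 0 := by
  intro k hk
  refine LinearMap.ext fun b => ?_
  rw [← fderiv_obs_update, show fderiv ℝ (fun v => obs O.h O.out
    (O.x₀, Function.update (fun _ => O.v₀) 0 v) k) O.v₀ = 0 from (hρ.1 k hk).self_of_nhds]
  rfl

theorem IsDegree.impulse_ne_zero {ρ : ℕ} (hρ : O.IsDegree ρ) : O.impulse ρ ≠ 0 := by
  intro h
  refine hρ.2 (ContinuousLinearMap.ext fun b => ?_)
  rw [fderiv_obs_update, h]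
  rfl

end ObservedSystem

/-! ### Windows -/

section Window

variable {a b a' b' : Fin 2 → ℤ}

/-- Restriction of the window `[a,b]`, shifted by `i`, to the window `[a',b']`; missing entries are
filled with `y₀`. -/
noncomputable def reindex (y₀ : Vec 2) (i : ℤ) (w : Window a b → ℝ) (q : Window a' b') : ℝ :=
  if h : (q.2 : ℤ) + i ∈ Finset.Icc (a q.1) (b q.1) then w ⟨q.1, ⟨_, h⟩⟩ else y₀ q.1

theorem reindex_mk {y₀ : Vec 2} {i : ℤ} {w : Window a b → ℝ} {j : Fin 2} {l k : ℤ}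
    {hl : l ∈ Finset.Icc (a' j) (b' j)} (hk : l + i = k) (h : k ∈ Finset.Icc (a j) (b j)) :
    (reindex y₀ i w : Window a' b' → ℝ) ⟨j, ⟨l, hl⟩⟩ = w ⟨j, ⟨k, h⟩⟩ := by
  subst hk
  exact dif_pos h

theorem exists_window_extension (a' b' : Fin 2 → ℤ) (z : Window a b → ℝ) :
    ∃ v : Window a' b' → ℝ, ∀ (q : Window a b) (h : (q.2 : ℤ) ∈ Finset.Icc (a' q.1) (b' q.1)),
      v ⟨q.1, ⟨q.2, h⟩⟩ = z q := by
  refine ⟨reindex 0 0 z, fun q h => ?_⟩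
  rw [reindex_mk (add_zero _) q.2.2]

theorem contDiff_reindex (y₀ : Vec 2) (i : ℤ) :
    ContDiff ℝ ∞ (reindex y₀ i : (Window a b → ℝ) → (Window a' b' → ℝ)) := by
  refine contDiff_pi.2 fun q => ?_
  unfold reindex
  split_ifs with h
  · exact contDiff_apply ..
  · exact contDiff_const

theorem reindex_const (y₀ : Vec 2) (i : ℤ) :
    (reindex y₀ i (fun q : Window a b => y₀ q.1) : Window a' b' → ℝ) = fun q => y₀ q.1 := by
  ext q
  simp [reindex]

end Window

namespace Completion

variable {n : ℕ} {S : DTSystem n 2} (C : Completion S)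

theorem ψ_equilibrium : C.ψ (S.x₀, C.ζ₀) = (S.x₀, S.u₀) := by
  have := C.inverse.eq
  rwa [S.equilibrium] at this

theorem smooth_fg : SmoothNear (fun p => (S.f p, C.g p)) (S.x₀, S.u₀) := C.inverse.1

theorem smooth_g : SmoothNear C.g (S.x₀, S.u₀) := C.smooth_fg.snd

theorem smooth_ψ : SmoothNear C.ψ (S.x₀, C.ζ₀) := by
  have := C.inverse.2.1
  simp only [S.equilibrium] at this
  exact this

/-! ### Shifts of points near the base point -/

theorem fwd_base : C.fwd C.base = C.base := by
  unfold fwd base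
  refine Prod.ext (funext fun k => ?_) (Prod.ext S.equilibrium rfl)
  cases k <;> rfl

theorem bwd_base : C.bwd C.base = C.base := by
  unfold bwd base
  refine Prod.ext rfl (Prod.ext ?_ (funext fun k => ?_))
  · simp only [ψ_equilibrium]
  · cases k
    · exact congrArg Prod.snd C.ψ_equilibrium
    · rfl

theorem tendsto_fwd : Tendsto C.fwd (𝓝 C.base) (𝓝 C.base) := by
  have hx : ContinuousAt (fun p : Point n 2 => (p.2.1, p.2.2 0)) C.base := by fun_prop
  have : ContinuousAt C.fwd C.base := by
    refine ContinuousAt.prodMk (continuousAt_pi.2 fun k => ?_) (ContinuousAt.prodMk ?_ (by fun_prop))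
    · cases k with
      | zero => exact ContinuousAt.comp_of_eq C.smooth_g.continuousAt hx rfl
      | succ k => fun_prop
    · exact ContinuousAt.comp_of_eq S.smooth.continuousAt hx rfl
  have h := this.tendsto
  rwa [fwd_base] at h

theorem tendsto_bwd : Tendsto C.bwd (𝓝 C.base) (𝓝 C.base) := by
  have hx : ContinuousAt (fun p : Point n 2 => C.ψ (p.2.1, p.1 0)) C.base :=
    ContinuousAt.comp_of_eq C.smooth_ψ.continuousAt (f := fun p : Point n 2 => (p.2.1, p.1 0))
      (by fun_prop) rfl
  have : ContinuousAt C.bwd C.base := by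
    refine ContinuousAt.prodMk (by fun_prop) (ContinuousAt.prodMk hx.fst (continuousAt_pi.2 fun k => ?_))
    cases k with
    | zero => exact hx.snd
    | succ k => fun_prop
  have h := this.tendsto
  rwa [bwd_base] at h

theorem eventually_bwd_fwd : ∀ᶠ p in 𝓝 C.base, C.bwd (C.fwd p) = p := by
  have hx : Tendsto (fun p : Point n 2 => (p.2.1, p.2.2 0)) (𝓝 C.base) (𝓝 (S.x₀, S.u₀)) :=
    (by fun_prop : ContinuousAt (fun p : Point n 2 => (p.2.1, p.2.2 0)) C.base)
  filter_upwards [hx.eventually C.inverse.2.2.1] with p hp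
  have h1 := congrArg Prod.fst hp
  refine Prod.ext rfl (Prod.ext h1 (funext fun k => ?_))
  cases k
  · exact congrArg Prod.snd hp
  · rfl

theorem eventually_fwd_bwd : ∀ᶠ p in 𝓝 C.base, C.fwd (C.bwd p) = p := by
  have hx : Tendsto (fun p : Point n 2 => (p.2.1, p.1 0)) (𝓝 C.base) (𝓝 (S.x₀, C.ζ₀)) :=
    (by fun_prop : ContinuousAt (fun p : Point n 2 => (p.2.1, p.1 0)) C.base)
  have h := C.inverse.2.2.2
  simp only [S.equilibrium] at h
  filter_upwards [hx.eventually h] with p hp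
  have h1 := congrArg Prod.fst hp
  refine Prod.ext (funext fun k => ?_) (Prod.ext h1 rfl)
  cases k
  · exact congrArg Prod.snd hp
  · rfl

theorem tendsto_fwd_iterate (i : ℕ) : Tendsto C.fwd^[i] (𝓝 C.base) (𝓝 C.base) := by
  induction i with
  | zero => exact tendsto_id
  | succ i ih => exact ih.comp C.tendsto_fwd

theorem tendsto_bwd_iterate (i : ℕ) : Tendsto C.bwd^[i] (𝓝 C.base) (𝓝 C.base) := by
  induction i with
  | zero => exact tendsto_id
  | succ i ih => exact ih.comp C.tendsto_bwd

/-- The two point maps are inverse to each other only locally. A single cancellation suffices for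
every k, so one neighbourhood serves all shifts at once. -/
theorem eventually_shift_fwd : ∀ᶠ p in 𝓝 C.base, ∀ k, C.shift k (C.fwd p) = C.shift (k + 1) p := by
  filter_upwards [C.eventually_bwd_fwd] with p hp k
  match k with
  | Int.ofNat k => rfl
  | Int.negSucc 0 => exact hp
  | Int.negSucc (k + 1) =>
    change C.bwd^[k + 1] (C.bwd (C.fwd p)) = C.bwd^[k + 1] p
    rw [hp]

theorem eventually_shift_bwd : ∀ᶠ p in 𝓝 C.base, ∀ k, C.shift k (C.bwd p) = C.shift (k - 1) p := by
  filter_upwards [C.eventually_fwd_bwd] with p hp k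
  match k with
  | Int.ofNat 0 => rfl
  | Int.ofNat (k + 1) =>
    rw [show Int.ofNat (k + 1) - 1 = Int.ofNat k by simp]
    change C.fwd^[k] (C.fwd (C.bwd p)) = C.fwd^[k] p
    rw [hp]
  | Int.negSucc k => rfl

theorem eventually_shift_fwd_iterate (i : ℕ) :
    ∀ᶠ p in 𝓝 C.base, ∀ k, C.shift k (C.fwd^[i] p) = C.shift (k + i) p := by
  induction i with
  | zero => exact Eventually.of_forall fun p k => by simp
  | succ i ih =>
    filter_upwards [C.tendsto_fwd.eventually ih, C.eventually_shift_fwd] with p h1 h2 k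
    rw [Function.iterate_succ_apply, h1, h2]
    congr 1
    push_cast; ring

theorem eventually_shift_bwd_iterate (i : ℕ) :
    ∀ᶠ p in 𝓝 C.base, ∀ k, C.shift k (C.bwd^[i] p) = C.shift (k - i) p := by
  induction i with
  | zero => exact Eventually.of_forall fun p k => by simp
  | succ i ih =>
    filter_upwards [C.tendsto_bwd.eventually ih, C.eventually_shift_bwd] with p h1 h2 k
    rw [Function.iterate_succ_apply, h1, h2]
    congr 1
    push_cast; ring

theorem fwd_iterate (k : ℕ) (p : Point n 2) :
    (C.fwd^[k] p).2 = (traj S.f p.2.1 p.2.2 k, fun i => p.2.2 (k + i)) := by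
  induction k with
  | zero => simp [traj]
  | succ k ih =>
    rw [Function.iterate_succ_apply']
    simp only [fwd, ih, traj]
    refine Prod.ext rfl (funext fun i => ?_)
    exact congrArg p.2.2 (show k + (i + 1) = k + 1 + i by ring)

theorem bwd_iterate (k : ℕ) (p : Point n 2) :
    (C.bwd^[k] p).1 = (fun i => p.1 (k + i)) ∧
      (C.bwd^[k] p).2.1 = traj (fun q => (C.ψ q).1) p.2.1 p.1 k := by
  induction k with
  | zero => simp [traj]
  | succ k ih =>
    rw [Function.iterate_succ_apply']
    simp only [bwd, ih, traj]
    refine ⟨?_, rfl⟩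
    exact funext fun i => congrArg p.1 (show k + (i + 1) = k + 1 + i by ring)

variable {φ : Vec n × Vec 2 → Vec 2}

/-- The value of `y` at the equilibrium. -/
def yBase (_ : Completion S) (φ : Vec n × Vec 2 → Vec 2) : Vec 2 := φ (S.x₀, S.u₀)

theorem shift_base (k : ℤ) : C.shift k C.base = C.base := by
  cases k with
  | ofNat k => exact Function.iterate_fixed C.fwd_base k
  | negSucc k => exact Function.iterate_fixed C.bwd_base (k + 1)

theorem yWindow_base (a b : Fin 2 → ℤ) :
    C.yWindow φ a b C.base = fun q => C.yBase φ q.1 := by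
  ext q
  simp only [yWindow, yShift, shift_base]
  rfl

theorem yShift_natCast (j : Fin 2) (k : ℕ) (p : Point n 2) :
    C.yShift φ j k p = obs S.f (fun q => φ q j) p.2 k := by
  change φ ((C.fwd^[k] p).2.1, (C.fwd^[k] p).2.2 0) j = _
  rw [fwd_iterate]
  rfl

/-- The time-reversed system evaluates φ after one application of ψ, so its output at time 0 is
y_[-1]. This offset is why γ corresponds to the degree γ - 1. -/
theorem yShift_negSucc (j : Fin 2) (k : ℕ) (p : Point n 2) :
    C.yShift φ j (Int.negSucc k) p =
      obs (fun q => (C.ψ q).1) (fun q => φ (C.ψ q) j) (p.2.1, p.1) k := by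
  change φ ((C.bwd^[k + 1] p).2.1, (C.bwd^[k + 1] p).2.2 0) j = _
  rw [Function.iterate_succ_apply']
  simp only [bwd, bwd_iterate]
  rfl

theorem eventually_yShift_fwd_iterate (φ : Vec n × Vec 2 → Vec 2) (i : ℕ) :
    ∀ᶠ p in 𝓝 C.base, ∀ j k, C.yShift φ j k (C.fwd^[i] p) = C.yShift φ j (k + i) p := by
  filter_upwards [C.eventually_shift_fwd_iterate i] with p hp j k
  rw [yShift, hp, yShift]

theorem eventually_yShift_bwd_iterate (φ : Vec n × Vec 2 → Vec 2) (i : ℕ) :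
    ∀ᶠ p in 𝓝 C.base, ∀ j k, C.yShift φ j k (C.bwd^[i] p) = C.yShift φ j (k - i) p := by
  filter_upwards [C.eventually_shift_bwd_iterate i] with p hp j k
  rw [yShift, hp, yShift]

theorem tendsto_yWindow (hφ : SmoothNear φ (S.x₀, S.u₀)) (a b : Fin 2 → ℤ) :
    Tendsto (C.yWindow φ a b) (𝓝 C.base) (𝓝 (C.yWindow φ a b C.base)) := by
  refine tendsto_pi_nhds.2 fun q => ?_
  have hs : Tendsto (C.shift q.2) (𝓝 C.base) (𝓝 C.base) := by
    cases (q.2 : ℤ) with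
    | ofNat k => exact C.tendsto_fwd_iterate k
    | negSucc k => exact C.tendsto_bwd_iterate (k + 1)
  have hx : Tendsto (fun p : Point n 2 => φ (p.2.1, p.2.2 0) q.1) (𝓝 C.base)
      (𝓝 (C.yShift φ q.1 q.2 C.base)) := by
    rw [yShift, shift_base]
    exact (continuousAt_pi.1 hφ.continuousAt q.1).comp_of_eq
      (f := fun p : Point n 2 => (p.2.1, p.2.2 0)) (x := C.base) (by fun_prop) rfl
  exact hx.comp hs

theorem reindex_yWindow {a b a' b' : Fin 2 → ℤ} {y₀ : Vec 2} {i : ℤ} {p p' : Point n 2}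
    (h : ∀ j, a j ≤ a' j + i ∧ b' j + i ≤ b j)
    (hp : ∀ j k, C.yShift φ j k p' = C.yShift φ j (k + i) p) :
    reindex y₀ i (C.yWindow φ a b p) = C.yWindow φ a' b' p' := by
  ext q
  have h1 := h q.1
  have h2 := Finset.mem_Icc.1 q.2.2
  have : (q.2 : ℤ) + i ∈ Finset.Icc (a q.1) (b q.1) := by rw [Finset.mem_Icc]; omega
  rw [reindex, dif_pos this, yWindow, yWindow, hp]

theorem reindex_zero_yWindow {a b a' b' : Fin 2 → ℤ} {y₀ : Vec 2} (p : Point n 2)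
    (h : ∀ j, a j ≤ a' j ∧ b' j ≤ b j) :
    reindex y₀ 0 (C.yWindow φ a b p) = C.yWindow φ a' b' p :=
  C.reindex_yWindow (by simpa using h) (by simp)

/-- Composition with a shifted restriction of the window stays smooth. -/
theorem smoothNear_comp_reindex {a b a' b' : Fin 2 → ℤ} {F : Type*} [NormedAddCommGroup F]
    [NormedSpace ℝ F] {A : (Window a' b' → ℝ) → F}
    (hA : SmoothNear A (C.yWindow φ a' b' C.base)) (i : ℤ) :
    SmoothNear (fun w => A (reindex (C.yBase φ) i w)) (C.yWindow φ a b C.base) :=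
  hA.comp_of_eq ((contDiff_reindex _ i).smoothNear _)
    (by rw [yWindow_base, yWindow_base, reindex_const])

theorem tendsto_reindex {a b a' b' : Fin 2 → ℤ} (i : ℤ) :
    Tendsto (reindex (C.yBase φ) i) (𝓝 (C.yWindow φ a b C.base))
      (𝓝 (C.yWindow φ a' b' C.base)) := by
  have := ((contDiff_reindex (a := a) (b := b) (a' := a') (b' := b') (C.yBase φ) i).continuous).tendsto
    (C.yWindow φ a b C.base)
  rwa [yWindow_base, reindex_const, ← C.yWindow_base, ← C.yWindow_base] at this

/-! ### Consequences of the parameterization -/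

section Param

variable {R₁ R₂ : Fin 2 → ℕ} {Fx : (Window (lo R₁) (hi' R₂) → ℝ) → Vec n}
  {Fu : (Window (lo R₁) (hi R₂) → ℝ) → Vec 2}

variable {C}

theorem IsParam.enlarge (hF : C.IsParam φ R₁ R₂ Fx Fu) {R₁' R₂' : Fin 2 → ℕ} (h₁ : R₁ ≤ R₁')
    (h₂ : R₂ ≤ R₂') :
    C.IsParam φ R₁' R₂' (fun w => Fx (reindex (C.yBase φ) 0 w))
      (fun w => Fu (reindex (C.yBase φ) 0 w)) := by
  refine ⟨C.smoothNear_comp_reindex hF.1 0, C.smoothNear_comp_reindex hF.2.1 0, ?_, ?_⟩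
  · filter_upwards [hF.2.2.1] with p hp
    rw [reindex_zero_yWindow, hp]
    intro j; have : R₁ j ≤ R₁' j := h₁ j; have : R₂ j ≤ R₂' j := h₂ j; simp only [lo, hi']; omega
  · filter_upwards [hF.2.2.2] with p hp
    rw [reindex_zero_yWindow, hp]
    intro j; have : R₁ j ≤ R₁' j := h₁ j; have : R₂ j ≤ R₂' j := h₂ j; simp only [lo, hi]; omega

/-- The variables `y_[-R₁,R₂]` are functionally independent. -/
theorem IsParam.eventuallyEq (hφ : C.IsFlatOutput φ) (hF : C.IsParam φ R₁ R₂ Fx Fu)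
    {G H : (Window (lo R₁) (hi R₂) → ℝ) → ℝ} (hG : SmoothNear G (C.yWindow φ _ _ C.base))
    (hH : SmoothNear H (C.yWindow φ _ _ C.base))
    (h : ∀ᶠ p in 𝓝 C.base, G (C.yWindow φ _ _ p) = H (C.yWindow φ _ _ p)) :
    G =ᶠ[𝓝 (C.yWindow φ _ _ C.base)] H := by
  -- Adding G - H to every component of F_u gives another parameterization of the same functions, so
  -- uniqueness forces G = H as germs.
  have hF' : C.IsParam φ R₁ R₂ Fx (fun w i => Fu w i + (G w - H w)) := by
    refine ⟨hF.1, smoothNear_pi.2 fun i => ?_, hF.2.2.1, ?_⟩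
    · exact (smoothNear_pi.1 hF.2.1 i).add (hG.sub hH)
    · filter_upwards [h, hF.2.2.2] with p h1 h2
      ext i
      rw [h1, h2, sub_self, add_zero]
  filter_upwards [(hφ.2.2 _ _ _ _ _ _ hF hF').2] with w hw
  have := congrFun hw 0
  simp only [left_eq_add] at this
  exact sub_eq_zero.1 this

theorem IsParam.eventuallyEq_pi (hφ : C.IsFlatOutput φ) (hF : C.IsParam φ R₁ R₂ Fx Fu)
    {ι : Type*} [Fintype ι] {G H : (Window (lo R₁) (hi R₂) → ℝ) → ι → ℝ}
    (hG : SmoothNear G (C.yWindow φ _ _ C.base)) (hH : SmoothNear H (C.yWindow φ _ _ C.base))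
    (h : ∀ᶠ p in 𝓝 C.base, G (C.yWindow φ _ _ p) = H (C.yWindow φ _ _ p)) :
    G =ᶠ[𝓝 (C.yWindow φ _ _ C.base)] H := by
  have : ∀ᶠ w in 𝓝 (C.yWindow φ _ _ C.base), ∀ i, G w i = H w i :=
    eventually_all.2 fun i => hF.eventuallyEq hφ (smoothNear_pi.1 hG i) (smoothNear_pi.1 hH i)
      (h.mono fun p hp => congrFun hp i)
  exact this.mono fun w hw => funext hw

end Param

end Completion

/-! ### Linearization of the shifts of y along curves of points -/

theorem SmoothNear.hasDerivAt_line {E F : Type*} [NormedAddCommGroup E] [NormedSpace ℝ E]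
    [NormedAddCommGroup F] [NormedSpace ℝ F] {A : E → F} {w : E} (hA : SmoothNear A w) (v : E) :
    HasDerivAt (fun t : ℝ => A (w + t • v)) (fderiv ℝ A w v) 0 := by
  have hl : HasDerivAt (fun t : ℝ => w + t • v) v 0 := by
    simpa using ((hasDerivAt_id (0 : ℝ)).smul_const v).const_add w
  exact hA.differentiableAt.hasFDerivAt.comp_hasDerivAt_of_eq 0 hl (by simp)

theorem tendsto_line {E : Type*} [NormedAddCommGroup E] [NormedSpace ℝ E] (w v : E) :
    Tendsto (fun t : ℝ => w + t • v) (𝓝 0) (𝓝 w) := by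
  have : ContinuousAt (fun t : ℝ => w + t • v) 0 := by fun_prop
  simpa [ContinuousAt] using this

namespace Completion

variable {n : ℕ} {S : DTSystem n 2} (C : Completion S) {φ : Vec n × Vec 2 → Vec 2}

/-- The system with output `y^j`. -/
def forwardSystem (_ : Completion S) (hφ : SmoothNear φ (S.x₀, S.u₀)) (j : Fin 2) :
    ObservedSystem (Vec n) where
  h := S.f
  out q := φ q j
  x₀ := S.x₀
  v₀ := S.u₀
  smooth_h := S.smooth
  smooth_out := smoothNear_pi.1 hφ j
  equilibrium := S.equilibrium

/-- The time-reversed system with output `y^j_[-1]`. -/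
def backwardSystem (hφ : SmoothNear φ (S.x₀, S.u₀)) (j : Fin 2) : ObservedSystem (Vec n) where
  h q := (C.ψ q).1
  out q := φ (C.ψ q) j
  x₀ := S.x₀
  v₀ := C.ζ₀
  smooth_h := C.smooth_ψ.fst
  smooth_out := (smoothNear_pi.1 hφ j).comp_of_eq C.smooth_ψ C.ψ_equilibrium
  equilibrium := congrArg Prod.fst C.ψ_equilibrium

/-- The linearization of `y^j_[k]` at the base point. -/
noncomputable def variation (hφ : SmoothNear φ (S.x₀, S.u₀)) (j : Fin 2) :
    ℤ → Point n 2 → ℝ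
  | Int.ofNat k, ξ => (C.forwardSystem hφ j).linObs ξ.2 k
  | Int.negSucc k, ξ => (C.backwardSystem hφ j).linObs (ξ.2.1, ξ.1) k

theorem variation_add (hφ : SmoothNear φ (S.x₀, S.u₀)) (j : Fin 2) (k : ℤ) (ξ ξ' : Point n 2) :
    C.variation hφ j k (ξ + ξ') = C.variation hφ j k ξ + C.variation hφ j k ξ' := by
  cases k with
  | ofNat k => exact (C.forwardSystem hφ j).linObs_add _ _ k
  | negSucc k => exact (C.backwardSystem hφ j).linObs_add (ξ.2.1, ξ.1) (ξ'.2.1, ξ'.1) k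

/-- The curve `c` through the base point has velocity `ξ`. -/
structure HasVelocity (c : ℝ → Point n 2) (ξ : Point n 2) : Prop where
  eq_base : c 0 = C.base
  past : ∀ i, HasDerivAt (fun t => (c t).1 i) (ξ.1 i) 0
  state : HasDerivAt (fun t => (c t).2.1) ξ.2.1 0
  future : ∀ i, HasDerivAt (fun t => (c t).2.2 i) (ξ.2.2 i) 0

theorem hasVelocity_line (ξ : Point n 2) :
    C.HasVelocity (fun t => (fun i => C.base.1 i + t • ξ.1 i, C.base.2.1 + t • ξ.2.1,
      fun i => C.base.2.2 i + t • ξ.2.2 i)) ξ := by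
  have hl : ∀ {k : ℕ} (a b : Vec k), HasDerivAt (fun t : ℝ => a + t • b) b 0 := fun a b => by
    simpa using ((hasDerivAt_id (0 : ℝ)).smul_const b).const_add a
  exact ⟨by simp, fun i => hl _ _, hl _ _, fun i => hl _ _⟩

variable {C}

theorem HasVelocity.tendsto {c : ℝ → Point n 2} {ξ : Point n 2} (h : C.HasVelocity c ξ) :
    Tendsto c (𝓝 0) (𝓝 C.base) := by
  have : ContinuousAt c 0 :=
    (continuousAt_pi.2 fun i => (h.past i).continuousAt).prodMk
      (h.state.continuousAt.prodMk (continuousAt_pi.2 fun i => (h.future i).continuousAt))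
  rw [← h.eq_base]
  exact this

theorem HasVelocity.hasDerivAt_yShift {c : ℝ → Point n 2} {ξ : Point n 2}
    (h : C.HasVelocity c ξ) (hφ : SmoothNear φ (S.x₀, S.u₀)) (j : Fin 2) (k : ℤ) :
    HasDerivAt (fun t => C.yShift φ j k (c t)) (C.variation hφ j k ξ) 0 := by
  cases k with
  | ofNat k =>
    have := (C.forwardSystem hφ j).hasDerivAt_obs h.state (by rw [h.eq_base]; rfl) h.future
      (fun i => by rw [h.eq_base]; rfl) k
    refine this.congr_of_eventuallyEq (Eventually.of_forall fun t => ?_)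
    exact C.yShift_natCast j k (c t)
  | negSucc k =>
    have := (C.backwardSystem hφ j).hasDerivAt_obs h.state (by rw [h.eq_base]; rfl) h.past
      (fun i => by rw [h.eq_base]; rfl) k
    refine this.congr_of_eventuallyEq (Eventually.of_forall fun t => ?_)
    exact C.yShift_negSucc j k (c t)

theorem HasVelocity.hasDerivAt_yWindow {c : ℝ → Point n 2} {ξ : Point n 2}
    (h : C.HasVelocity c ξ) (hφ : SmoothNear φ (S.x₀, S.u₀)) (a b : Fin 2 → ℤ) :
    HasDerivAt (fun t => C.yWindow φ a b (c t)) (fun q => C.variation hφ q.1 q.2 ξ) 0 :=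
  hasDerivAt_pi.2 fun q => h.hasDerivAt_yShift hφ q.1 q.2

variable (C) in
/-- Differentiating an identity between functions of the window and of the point. -/
theorem fderiv_variation {F : Type*} [NormedAddCommGroup F] [NormedSpace ℝ F] {a b : Fin 2 → ℤ}
    {A : (Window a b → ℝ) → F} (hφ : SmoothNear φ (S.x₀, S.u₀))
    (hA : SmoothNear A (C.yWindow φ a b C.base)) {B : Point n 2 → F} {ξ : Point n 2} {β : F}
    (hAB : ∀ᶠ p in 𝓝 C.base, A (C.yWindow φ a b p) = B p)
    (hB : ∀ c, C.HasVelocity c ξ → HasDerivAt (fun t => B (c t)) β 0) :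
    fderiv ℝ A (C.yWindow φ a b C.base) (fun q => C.variation hφ q.1 q.2 ξ) = β := by
  have hc := C.hasVelocity_line ξ
  have h1 := hA.differentiableAt.hasFDerivAt.comp_hasDerivAt_of_eq 0
    (hc.hasDerivAt_yWindow hφ a b) (by rw [hc.eq_base])
  refine h1.unique ((hB _ hc).congr_of_eventuallyEq ?_)
  exact hc.tendsto.eventually hAB

section Param

variable {R₁ R₂ : Fin 2 → ℕ} {Fx : (Window (lo R₁) (hi' R₂) → ℝ) → Vec n}
  {Fu : (Window (lo R₁) (hi R₂) → ℝ) → Vec 2}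

theorem IsParam.fderiv_Fx (hF : C.IsParam φ R₁ R₂ Fx Fu) (hφ : SmoothNear φ (S.x₀, S.u₀))
    (ξ : Point n 2) :
    fderiv ℝ Fx (C.yWindow φ _ _ C.base) (fun q => C.variation hφ q.1 q.2 ξ) = ξ.2.1 :=
  C.fderiv_variation hφ hF.1 hF.2.2.1 fun _ hc => hc.state

theorem IsParam.fderiv_Fu (hF : C.IsParam φ R₁ R₂ Fx Fu) (hφ : SmoothNear φ (S.x₀, S.u₀))
    (ξ : Point n 2) :
    fderiv ℝ Fu (C.yWindow φ _ _ C.base) (fun q => C.variation hφ q.1 q.2 ξ) = ξ.2.2 0 :=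
  C.fderiv_variation hφ hF.2.1 hF.2.2.2 fun _ hc => hc.future 0

variable (C) in
/-- The parameterization of `(x,u)` by `y_[-R₁,R₂]`. -/
noncomputable def paramXU (φ : Vec n × Vec 2 → Vec 2)
    (Fx : (Window (lo R₁) (hi' R₂) → ℝ) → Vec n)
    (Fu : (Window (lo R₁) (hi R₂) → ℝ) → Vec 2) (w : Window (lo R₁) (hi R₂) → ℝ) : Vec n × Vec 2 :=
  (Fx (reindex (C.yBase φ) 0 w), Fu w)

theorem IsParam.smoothNear_paramXU (hF : C.IsParam φ R₁ R₂ Fx Fu) :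
    SmoothNear (C.paramXU φ Fx Fu) (C.yWindow φ _ _ C.base) :=
  (C.smoothNear_comp_reindex hF.1 0).prodMk hF.2.1

theorem IsParam.eventually_paramXU (hF : C.IsParam φ R₁ R₂ Fx Fu) :
    ∀ᶠ p in 𝓝 C.base, C.paramXU φ Fx Fu (C.yWindow φ _ _ p) = (p.2.1, p.2.2 0) := by
  filter_upwards [hF.2.2.1, hF.2.2.2] with p h1 h2
  rw [paramXU, reindex_zero_yWindow, h1, h2]
  intro j; simp

theorem IsParam.paramXU_base (hF : C.IsParam φ R₁ R₂ Fx Fu) :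
    C.paramXU φ Fx Fu (C.yWindow φ _ _ C.base) = (S.x₀, S.u₀) :=
  hF.eventually_paramXU.self_of_nhds

theorem IsParam.smoothNear_g_paramXU (hF : C.IsParam φ R₁ R₂ Fx Fu) :
    SmoothNear (fun w => C.g (C.paramXU φ Fx Fu w)) (C.yWindow φ _ _ C.base) :=
  C.smooth_g.comp_of_eq hF.smoothNear_paramXU hF.paramXU_base

/-- The variable ζ_[-(i+1)] is g(x,u) shifted back by i + 1 steps. -/
theorem IsParam.eventually_past (hF : C.IsParam φ R₁ R₂ Fx Fu) (i : ℕ) :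
    ∀ᶠ p in 𝓝 C.base,
      C.g (C.paramXU φ Fx Fu (C.yWindow φ _ _ (C.bwd^[i + 1] p))) = p.1 i := by
  filter_upwards [(C.tendsto_bwd_iterate (i + 1)).eventually hF.eventually_paramXU,
    (C.tendsto_bwd_iterate i).eventually C.eventually_fwd_bwd] with p h1 h2
  rw [h1, Function.iterate_succ_apply']
  have := congrFun (congrArg Prod.fst h2) 0
  rw [(C.bwd_iterate i p).1] at this
  exact this

/-- Since ζ_[-1] is g(x,u) one step earlier, the window is evaluated at the backward-shifted point;
hence the variations of y_[k-1] in place of y_[k]. -/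
theorem IsParam.fderiv_g_paramXU (hF : C.IsParam φ R₁ R₂ Fx Fu)
    (hφ : SmoothNear φ (S.x₀, S.u₀)) (ξ : Point n 2) :
    fderiv ℝ (fun w => C.g (C.paramXU φ Fx Fu w)) (C.yWindow φ _ _ C.base)
      (fun q => C.variation hφ q.1 (q.2 - 1) ξ) = ξ.1 0 := by
  have hc := C.hasVelocity_line ξ
  have hd : HasDerivAt (fun t : ℝ => fun q : Window (lo R₁) (hi R₂) =>
      C.yShift φ q.1 (q.2 - 1) ((fun i => C.base.1 i + t • ξ.1 i, C.base.2.1 + t • ξ.2.1,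
      fun i => C.base.2.2 i + t • ξ.2.2 i)))
      (fun q => C.variation hφ q.1 (q.2 - 1) ξ) 0 :=
    hasDerivAt_pi.2 fun q => hc.hasDerivAt_yShift hφ q.1 _
  have h1 := hF.smoothNear_g_paramXU.differentiableAt.hasFDerivAt.comp_hasDerivAt_of_eq 0 hd (by
    ext q
    rw [yWindow_base, hc.eq_base, yShift, shift_base]
    rfl)
  refine h1.unique ((hc.past 0).congr_of_eventuallyEq ?_)
  filter_upwards [hc.tendsto.eventually (hF.eventually_past 0),
    hc.tendsto.eventually (C.eventually_yShift_bwd_iterate φ 1)] with t h2 h3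
  rw [← h2]
  refine congrArg (fun w => C.g (C.paramXU φ Fx Fu w)) (funext fun q => ?_)
  rw [yWindow, h3]
  rfl

/-- The point with given values of a window of `y`. -/
noncomputable def pointOf (C : Completion S) (φ : Vec n × Vec 2 → Vec 2)
    (Fx : (Window (lo R₁) (hi' R₂) → ℝ) → Vec n)
    (Fu : (Window (lo R₁) (hi R₂) → ℝ) → Vec 2) {a b : Fin 2 → ℤ} (w : Window a b → ℝ) :
    Point n 2 :=
  (fun i => C.g (C.paramXU φ Fx Fu (reindex (C.yBase φ) (-((i + 1 : ℕ) : ℤ)) w)),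
    Fx (reindex (C.yBase φ) 0 w), fun i => Fu (reindex (C.yBase φ) i w))

theorem IsParam.smoothNear_pointOf (hF : C.IsParam φ R₁ R₂ Fx Fu) (a b : Fin 2 → ℤ) :
    (∀ i, SmoothNear (fun w => (C.pointOf φ Fx Fu w).1 i) (C.yWindow φ a b C.base)) ∧
    SmoothNear (fun w => (C.pointOf φ Fx Fu w).2.1) (C.yWindow φ a b C.base) ∧
    ∀ i, SmoothNear (fun w => (C.pointOf φ Fx Fu w).2.2 i) (C.yWindow φ a b C.base) :=
  ⟨fun _ => C.smoothNear_comp_reindex hF.smoothNear_g_paramXU _, C.smoothNear_comp_reindex hF.1 _,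
    fun _ => C.smoothNear_comp_reindex hF.2.1 _⟩

theorem IsParam.pointOf_base (hF : C.IsParam φ R₁ R₂ Fx Fu) (a b : Fin 2 → ℤ) :
    C.pointOf φ Fx Fu (C.yWindow φ a b C.base) = C.base := by
  have hx := hF.2.2.1.self_of_nhds
  have hu := hF.2.2.2.self_of_nhds
  have hxu := hF.paramXU_base
  rw [yWindow_base] at hx hu hxu
  simp only [pointOf, yWindow_base, reindex_const, hx, hu, hxu]
  rfl

/-- Widening the window by M on both sides makes all shifted copies of the original window available
that are needed to recover x, u, …, u_[M] and ζ_[-1], …, ζ_[-M]. -/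
theorem IsParam.eventually_pointOf (hF : C.IsParam φ R₁ R₂ Fx Fu) (M : ℕ) :
    ∀ᶠ p in 𝓝 C.base, ∀ i ≤ M,
      (i < M → (C.pointOf φ Fx Fu (C.yWindow φ (lo fun j => R₁ j + M) (hi fun j => R₂ j + M) p)).1 i
        = p.1 i) ∧
      (C.pointOf φ Fx Fu (C.yWindow φ (lo fun j => R₁ j + M) (hi fun j => R₂ j + M) p)).2.1 = p.2.1 ∧
      (C.pointOf φ Fx Fu (C.yWindow φ (lo fun j => R₁ j + M) (hi fun j => R₂ j + M) p)).2.2 i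
        = p.2.2 i := by
  refine (eventually_all_finite (Set.finite_Iic M)).2 fun i hiM => ?_
  rw [Set.mem_Iic] at hiM
  filter_upwards [hF.2.2.1, (C.tendsto_fwd_iterate i).eventually hF.2.2.2, hF.eventually_past i,
    C.eventually_yShift_fwd_iterate φ i, C.eventually_yShift_bwd_iterate φ (i + 1)]
    with p h1 h2 h3 h4 h5
  refine ⟨fun _ => ?_, ?_, ?_⟩
  · simp only [pointOf]
    rw [C.reindex_yWindow (p' := C.bwd^[i + 1] p), h3]
    · intro j; simp only [lo, hi]; push_cast; omega
    · intro j k; rw [h5]; rfl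
  · simp only [pointOf]
    rw [C.reindex_zero_yWindow, h1]
    intro j; simp only [lo, hi, hi']; push_cast; omega
  · simp only [pointOf]
    rw [C.reindex_yWindow (p' := C.fwd^[i] p), h2, fwd_iterate]
    · rfl
    · intro j; simp only [lo, hi]; push_cast; omega
    · exact h4

theorem yShift_congr {p p' : Point n 2} {j : Fin 2} {k : ℤ} {M : ℕ} (hk : -(M : ℤ) ≤ k)
    (hk' : k ≤ M)
    (h : ∀ i ≤ M, (i < M → p.1 i = p'.1 i) ∧ p.2.1 = p'.2.1 ∧ p.2.2 i = p'.2.2 i) :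
    C.yShift φ j k p = C.yShift φ j k p' := by
  cases k with
  | ofNat k =>
    have e1 := C.yShift_natCast (φ := φ) j k p
    have e2 := C.yShift_natCast (φ := φ) j k p'
    refine e1.trans (Eq.trans ?_ e2.symm)
    have hk' : k ≤ M := by simpa using hk'
    exact obs_congr _ _ (h 0 (by omega)).2.1 fun i hi => (h i (by omega)).2.2
  | negSucc k =>
    rw [yShift_negSucc, yShift_negSucc]
    have : k < M := by omega
    exact obs_congr _ _ (h 0 (by omega)).2.1 fun i hi => (h i (by omega)).1 (by omega)

/-- On windows that come from points the equality is immediate, and independence of the enlarged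
window extends it to all nearby windows. Window values can therefore be prescribed freely and
realized by a point. -/
theorem IsParam.eventuallyEq_yShift_pointOf (hφ : C.IsFlatOutput φ)
    (hF : C.IsParam φ R₁ R₂ Fx Fu) {M : ℕ}
    (q : Window (lo fun j => R₁ j + M) (hi fun j => R₂ j + M))
    (h₁ : -(M : ℤ) ≤ q.2) (h₂ : (q.2 : ℤ) ≤ M) :
    (fun w : Window (lo fun j => R₁ j + M) (hi fun j => R₂ j + M) → ℝ =>
      C.yShift φ q.1 q.2 (C.pointOf φ Fx Fu w)) =ᶠ[𝓝 (C.yWindow φ _ _ C.base)] fun w => w q := by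
  have hF' := hF.enlarge (R₁' := fun j => R₁ j + M) (R₂' := fun j => R₂ j + M)
    (fun j => Nat.le_add_right _ _) (fun j => Nat.le_add_right _ _)
  refine hF'.eventuallyEq hφ ?_ ((contDiff_apply _ _ _).smoothNear _) ?_
  · obtain ⟨hs1, hs2, hs3⟩ := hF.smoothNear_pointOf (lo fun j => R₁ j + M) (hi fun j => R₂ j + M)
    have hb := hF.pointOf_base (lo fun j => R₁ j + M) (hi fun j => R₂ j + M)
    rcases hq : (q.2 : ℤ) with k | k
    · refine ((C.forwardSystem hφ.1 q.1).smoothNear_obs hs2 (by rw [hb]; rfl) hs3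
        (fun i => by rw [hb]; rfl) k).congr (Eventually.of_forall fun w => ?_)
      exact C.yShift_natCast q.1 k _
    · refine ((C.backwardSystem hφ.1 q.1).smoothNear_obs hs2 (by rw [hb]; rfl) hs1
        (fun i => by rw [hb]; rfl) k).congr (Eventually.of_forall fun w => ?_)
      exact C.yShift_negSucc q.1 k _
  · filter_upwards [hF.eventually_pointOf M] with p hp
    exact yShift_congr h₁ h₂ hp

/-- The linearizations of the variables `y_[-R₁,R₂-1]` are independent. -/
theorem IsParam.exists_variation (hφ : C.IsFlatOutput φ) (hF : C.IsParam φ R₁ R₂ Fx Fu)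
    (z : Window (lo R₁) (hi' R₂) → ℝ) : ∃ ξ, ∀ q, C.variation hφ.1 q.1 q.2 ξ = z q := by
  -- M bounds every order in the window, so all its entries depend only on coordinates of the point
  -- that `pointOf` recovers.
  obtain ⟨M, hM⟩ : ∃ M : ℕ, ∀ j, R₁ j + R₂ j ≤ M :=
    ⟨∑ j, (R₁ j + R₂ j), fun j =>
      Finset.single_le_sum (f := fun j => R₁ j + R₂ j) (fun _ _ => Nat.zero_le _)
        (Finset.mem_univ j)⟩
  have hmem : ∀ q : Window (lo R₁) (hi' R₂),
      (q.2 : ℤ) ∈ Finset.Icc (lo (fun j => R₁ j + M) q.1) (hi (fun j => R₂ j + M) q.1) :=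
    fun q => by
      have := Finset.mem_Icc.1 q.2.2
      simp only [lo, hi, hi', Finset.mem_Icc] at this ⊢
      push_cast
      omega
  have hmul : ∀ q : Window (lo R₁) (hi' R₂), -(M : ℤ) ≤ q.2 ∧ (q.2 : ℤ) ≤ M := fun q => by
    have h1 := Finset.mem_Icc.1 q.2.2
    have h2 := hM q.1
    simp only [lo, hi'] at h1
    omega
  obtain ⟨hs1, hs2, hs3⟩ := hF.smoothNear_pointOf (lo fun j => R₁ j + M) (hi fun j => R₂ j + M)
  have hb := hF.pointOf_base (lo fun j => R₁ j + M) (hi fun j => R₂ j + M)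
  have key := fun q : Window (lo R₁) (hi' R₂) =>
    hF.eventuallyEq_yShift_pointOf hφ (M := M) ⟨q.1, ⟨q.2, hmem q⟩⟩ (hmul q).1 (hmul q).2
  generalize C.yWindow φ (lo fun j => R₁ j + M) (hi fun j => R₂ j + M) C.base = w₀
    at hs1 hs2 hs3 hb key
  obtain ⟨v, hv'⟩ := exists_window_extension (lo fun j => R₁ j + M) (hi fun j => R₂ j + M) z
  have hv := fun q => hv' q (hmem q)
  obtain ⟨ξ, hvel⟩ : ∃ ξ, C.HasVelocity (fun t => C.pointOf φ Fx Fu (w₀ + t • v)) ξ :=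
    ⟨(_, _, _), by rw [zero_smul, add_zero]; exact hb, fun i => (hs1 i).hasDerivAt_line v,
      hs2.hasDerivAt_line v, fun i => (hs3 i).hasDerivAt_line v⟩
  refine ⟨ξ, fun q => ?_⟩
  have h1 := hvel.hasDerivAt_yShift hφ.1 q.1 q.2
  have h2 := ((contDiff_apply ℝ ℝ (⟨q.1, ⟨q.2, hmem q⟩⟩ :
    Window (lo fun j => R₁ j + M) (hi fun j => R₂ j + M))).smoothNear w₀).hasDerivAt_line v
  rw [(hasFDerivAt_apply _ w₀).fderiv] at h2
  rw [← hv q]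
  exact h1.unique (h2.congr_of_eventuallyEq ((tendsto_line w₀ v).eventually (key q)))

end Param

end Completion

/-! ### Coordinate directions of windows -/

section Direction

variable {a b a' b' : Fin 2 → ℤ}

/-- The coordinate direction of `y^j_[k]`; zero if this variable is not in the window. -/
noncomputable def dir (j : Fin 2) (k : ℤ) : Window a b → ℝ :=
  fun q => if q.1 = j ∧ (q.2 : ℤ) = k then 1 else 0

theorem dir_eq_zero {j : Fin 2} {k : ℤ} (h : k ∉ Finset.Icc (a j) (b j)) :
    (dir j k : Window a b → ℝ) = 0 := by
  ext ⟨j', k', hk'⟩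
  simp only [dir, Pi.zero_apply, ite_eq_right_iff, one_ne_zero, imp_false, not_and]
  rintro rfl rfl
  exact h hk'

theorem reindex_add_smul_dir {j : Fin 2} {k : ℤ} (h : k ∈ Finset.Icc (a j) (b j)) (y₀ : Vec 2)
    (i : ℤ) (w : Window a b → ℝ) (t : ℝ) :
    (reindex y₀ i (w + t • dir j k) : Window a' b' → ℝ) = reindex y₀ i w + t • dir j (k - i) := by
  ext ⟨j', k', hk'⟩
  simp only [reindex, dir, Pi.add_apply, Pi.smul_apply]
  by_cases hm : k' + i ∈ Finset.Icc (a j') (b j')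
  · simp only [hm, dif_pos, eq_sub_iff_add_eq]
  · have : ¬ (j' = j ∧ k' = k - i) := by
      rintro ⟨rfl, rfl⟩
      exact hm (by simpa using h)
    simp only [hm, dif_neg, not_false_eq_true, this, if_neg, smul_zero, add_zero]

theorem fderiv_comp_reindex {F : Type*} [NormedAddCommGroup F] [NormedSpace ℝ F]
    {A : (Window a' b' → ℝ) → F} {y₀ : Vec 2} {i : ℤ} {w : Window a b → ℝ}
    (hA : DifferentiableAt ℝ A (reindex y₀ i w)) {j : Fin 2} {k : ℤ}
    (h : k ∈ Finset.Icc (a j) (b j)) :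
    fderiv ℝ (fun w => A (reindex y₀ i w)) w (dir j k) =
      fderiv ℝ A (reindex y₀ i w) (dir j (k - i)) := by
  have hr : DifferentiableAt ℝ (reindex y₀ i : (Window a b → ℝ) → (Window a' b' → ℝ)) w :=
    (contDiff_reindex y₀ i).contDiffAt.differentiableAt (by simp)
  have hd : DifferentiableAt ℝ (fun w => A (reindex y₀ i w)) w := hA.comp w hr
  rw [← hd.lineDeriv_eq_fderiv, ← hA.lineDeriv_eq_fderiv]
  simp only [lineDeriv, reindex_add_smul_dir h]

theorem reindex_reindex_neg {y₀ : Vec 2} {i : ℤ}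
    (h : ∀ j, a j ≤ a' j + i ∧ b' j + i ≤ b j) (z : Window a' b' → ℝ) :
    reindex y₀ i (reindex y₀ (-i) z : Window a b → ℝ) = z := by
  ext ⟨j, l, hl⟩
  have h1 := h j
  have h2 := Finset.mem_Icc.1 hl
  rw [reindex_mk rfl (Finset.mem_Icc.2 ⟨by omega, by omega⟩), reindex_mk (by ring) hl]

/-- A function that does not depend on `y^j_[k]` factors through the window without it. -/
theorem eventually_reindex_reindex {F : Type*} [NormedAddCommGroup F] [NormedSpace ℝ F]
    {A : (Window a b → ℝ) → F} {y₀ : Vec 2} (hA : SmoothNear A (fun q => y₀ q.1)) {j : Fin 2}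
    {k : ℤ} (h0 : ∀ᶠ w in 𝓝 (fun q : Window a b => y₀ q.1), fderiv ℝ A w (dir j k) = 0)
    (hj : k ∉ Finset.Icc (a' j) (b' j))
    (hdiff : ∀ j' k', k' ∈ Finset.Icc (a j') (b j') → k' ∉ Finset.Icc (a' j') (b' j') →
      j' = j ∧ k' = k) :
    ∀ᶠ w in 𝓝 (fun q : Window a b => y₀ q.1),
      A (reindex y₀ 0 (reindex y₀ 0 w : Window a' b' → ℝ)) = A w := by
  have key : ∀ w : Window a b → ℝ, (reindex y₀ 0 (reindex y₀ 0 w : Window a' b' → ℝ)) =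
      w - (if h : k ∈ Finset.Icc (a j) (b j) then w ⟨j, ⟨k, h⟩⟩ - y₀ j else 0) • dir j k := by
    intro w
    ext ⟨j', k', hk'⟩
    by_cases hm : k' ∈ Finset.Icc (a' j') (b' j')
    · have : ¬ (j' = j ∧ k' = k) := by
        rintro ⟨rfl, rfl⟩
        exact hj hm
      rw [reindex_mk (add_zero _) hm, reindex_mk (add_zero _) hk']
      simp only [Pi.sub_apply, Pi.smul_apply, dir, this, if_neg, not_false_eq_true, smul_zero,
        sub_zero]
    · obtain ⟨rfl, rfl⟩ := hdiff j' k' hk' hm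
      simp only [reindex, add_zero, hm, dif_neg, not_false_eq_true, Pi.sub_apply, hk', dif_pos,
        Pi.smul_apply, dir, and_self, if_true, smul_eq_mul, mul_one]
      ring
  simp only [key]
  refine eventually_eq_of_fderiv_apply_eq_zero hA h0 ?_ ?_
  · split_ifs with h
    · exact ((continuous_apply _).sub continuous_const).continuousAt
    · exact continuousAt_const
  · split_ifs <;> simp

end Direction

/-! ### Changing a single input, and the entries on which F_x depends -/

/-- A function that is constant along a curve has no derivative in the direction of the curve. -/
theorem fderiv_apply_eq_zero_of_const {E F : Type*} [NormedAddCommGroup E] [NormedSpace ℝ E]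
    [NormedAddCommGroup F] [NormedSpace ℝ F] {A : E → F} {w d : E} {h : Vec 2 → ℝ} {t₀ : Vec 2}
    {h' : Vec 2 →L[ℝ] ℝ} (hA : DifferentiableAt ℝ A w) (h0 : h t₀ = 0) (hh : HasFDerivAt h h' t₀)
    (hne : h' ≠ 0) (hc : ∀ᶠ t in 𝓝 t₀, A (w + h t • d) = A w) : fderiv ℝ A w d = 0 := by
  have h1 : HasFDerivAt (fun t => w + h t • d) (h'.smulRight d) t₀ :=
    (hh.smul_const d).const_add w
  have h2 := HasFDerivAt.comp (g := A) (f := fun t => w + h t • d) t₀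
    (g' := fderiv ℝ A w) (by rw [h0, zero_smul, add_zero]; exact hA.hasFDerivAt) h1
  have h3 := h2.unique ((hasFDerivAt_const (A w) t₀).congr_of_eventuallyEq hc)
  obtain ⟨b, hb⟩ : ∃ b, h' b ≠ 0 := by
    by_contra! hcon
    exact hne (ContinuousLinearMap.ext hcon)
  have h4 := congrArg (fun L : Vec 2 →L[ℝ] F => L b) h3
  simp only [ContinuousLinearMap.comp_apply, ContinuousLinearMap.smulRight_apply, map_smul,
    _root_.zero_apply] at h4
  exact (smul_eq_zero.1 h4).resolve_left hb

namespace ObservedSystem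

variable {X : Type*} [NormedAddCommGroup X] [NormedSpace ℝ X] {O : ObservedSystem X}

/-- Changing only the input at time `s` affects the output from time `s + ρ` on. -/
theorem IsDegree.eventually_perturb {ρ : ℕ} (hρ : O.IsDegree ρ) (s : ℕ) :
    ∀ᶠ q in 𝓝 O.base, ∀ᶠ t in 𝓝 (q.2 s),
      (∀ k < s + ρ, obs O.h O.out (q.1, Function.update q.2 s t) k = obs O.h O.out q k) ∧
      obs O.h O.out (q.1, Function.update q.2 s t) (s + ρ) =
        obs O.h O.out q (s + ρ) + (O.η ρ (traj O.h q.1 q.2 s, t) - O.η ρ (traj O.h q.1 q.2 s, q.2 s)) := by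
  have h1 : ∀ᶠ q in 𝓝 O.base, (∀ k < ρ, obs O.h O.out q (s + k) = O.κ k (traj O.h q.1 q.2 s)) ∧
      obs O.h O.out q (s + ρ) = O.η ρ (traj O.h q.1 q.2 s, q.2 s) := by
    refine Eventually.and ?_ (hρ.eventually_obs_add s)
    exact (eventually_all_finite (Set.finite_Iio ρ)).2 fun k hk => hρ.eventually_obs_add_lt s hk
  filter_upwards [h1.eventually_nhds] with q hq
  have hc : Tendsto (fun t => (q.1, Function.update q.2 s t)) (𝓝 (q.2 s)) (𝓝 q) := by
    have : ContinuousAt (fun t => (q.1, Function.update q.2 s t)) (q.2 s) :=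
      continuousAt_const.prodMk (continuous_const.update s continuous_id).continuousAt
    simpa [ContinuousAt] using this
  have hq0 := hq.self_of_nhds
  filter_upwards [hc.eventually hq] with t ht
  have htr : traj O.h q.1 (Function.update q.2 s t) s = traj O.h q.1 q.2 s :=
    traj_congr _ _ fun i hi => by rw [Function.update_of_ne hi.ne]
  simp only [htr, Function.update_self] at ht
  refine ⟨fun k hk => ?_, ?_⟩
  · rcases lt_or_ge k s with h | h
    · exact obs_congr _ _ rfl fun i hi => by
        simp only [Function.update_of_ne (show i ≠ s by omega)]
    · obtain ⟨l, rfl⟩ := Nat.exists_eq_add_of_le h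
      rw [ht.1 l (by omega), hq0.1 l (by omega)]
  · rw [ht.2, hq0.2]; ring

theorem IsDegree.eventually_hasFDerivAt_η {ρ : ℕ} (hρ : O.IsDegree ρ) :
    ∀ᶠ q in 𝓝 (O.x₀, O.v₀), ∃ L : Vec 2 →L[ℝ] ℝ, L ≠ 0 ∧
      HasFDerivAt (fun v => O.η ρ (q.1, v)) L q.2 := by
  have hs := O.smoothNear_η ρ
  have hc : ContinuousAt (fun q => fderiv ℝ (O.η ρ) q ∘L ContinuousLinearMap.inr ℝ X (Vec 2))
      (O.x₀, O.v₀) :=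
    (hs.contDiffAt.fderiv_right (m := ∞) (by simp)).continuousAt.clm_comp continuousAt_const
  filter_upwards [hs.eventually_differentiableAt,
    hc.eventually (isOpen_ne.mem_nhds hρ.fderiv_η_ne_zero)] with q h1 h2
  exact ⟨_, h2, h1.hasFDerivAt.comp q.2 (hasFDerivAt_prodMk_right q.1 q.2)⟩

end ObservedSystem

namespace Completion

variable {n : ℕ} {S : DTSystem n 2} {C : Completion S} {φ : Vec n × Vec 2 → Vec 2}

theorem IsRelativeDegree.isDegree {j : Fin 2} {ρ : ℕ} (h : C.IsRelativeDegree φ j ρ)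
    (hφ : SmoothNear φ (S.x₀, S.u₀)) : (C.forwardSystem hφ j).IsDegree ρ := by
  have ht : Tendsto (fun q : Vec n × (ℕ → Vec 2) => (C.base.1, q))
      (𝓝 (C.forwardSystem hφ j).base) (𝓝 C.base) :=
    (by fun_prop : ContinuousAt (fun q : Vec n × (ℕ → Vec 2) => (C.base.1, q)) _)
  refine ⟨fun k hk => ?_, ?_⟩
  · filter_upwards [ht.eventually (h.1 k hk)] with q hq
    simp only [dyDu, yShift_natCast] at hq
    exact hq
  · have := h.2
    simp only [dyDu, yShift_natCast] at this
    exact this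

theorem IsBackwardDegree.isDegree {j : Fin 2} {γ : ℕ} (h : C.IsBackwardDegree φ j γ)
    (hφ : SmoothNear φ (S.x₀, S.u₀)) : (C.backwardSystem hφ j).IsDegree (γ - 1) := by
  have ht : Tendsto (fun q : Vec n × (ℕ → Vec 2) => ((q.2, q.1, C.base.2.2) : Point n 2))
      (𝓝 (C.backwardSystem hφ j).base) (𝓝 C.base) :=
    (by fun_prop : ContinuousAt
      (fun q : Vec n × (ℕ → Vec 2) => ((q.2, q.1, C.base.2.2) : Point n 2)) _)
  have hcast : ∀ k : ℕ, -((k + 1 : ℕ) : ℤ) = Int.negSucc k := fun k => rfl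
  refine ⟨fun k hk => ?_, ?_⟩
  · filter_upwards [ht.eventually (h.2.1 (k + 1) (by omega) (by omega))] with q hq
    simp only [dyDζ, hcast, yShift_negSucc] at hq
    exact hq
  · have := h.2.2
    rw [show γ = (γ - 1) + 1 by have := h.1; omega, hcast] at this
    simp only [dyDζ, yShift_negSucc] at this
    exact this

section Param

variable {R₁ R₂ : Fin 2 → ℕ} {Fx : (Window (lo R₁) (hi' R₂) → ℝ) → Vec n}
  {Fu : (Window (lo R₁) (hi R₂) → ℝ) → Vec 2}

/-- A directional derivative of `F_x` that vanishes along points near the base vanishes. -/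
theorem IsParam.eventually_fderiv_Fx_eq_zero (hφ : C.IsFlatOutput φ)
    (hF : C.IsParam φ R₁ R₂ Fx Fu) {d : Window (lo R₁) (hi' R₂) → ℝ}
    (h : ∀ᶠ p in 𝓝 C.base, fderiv ℝ Fx (C.yWindow φ _ _ p) d = 0) :
    ∀ᶠ z in 𝓝 (C.yWindow φ _ _ C.base), fderiv ℝ Fx z d = 0 := by
  -- Independence is available for the window up to R₂, so the derivative is first regarded as a
  -- function there and afterwards restricted back to the window up to R₂ - 1.
  have h1 := hF.eventuallyEq_pi hφ (C.smoothNear_comp_reindex (hF.1.fderiv_apply d) 0)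
    (smoothNear_const 0 _) (h.mono fun p hp => by
      rw [reindex_zero_yWindow, hp]; intro j; simp)
  have h2 := (C.tendsto_reindex (φ := φ) (a := lo R₁) (b := hi' R₂) (a' := lo R₁) (b' := hi R₂)
    (-0)).eventually h1
  filter_upwards [h2] with z hz
  rwa [reindex_reindex_neg] at hz
  intro j; simp

/-- Changing u_[s] at a suitable time s moves y^i_[R₂ i - 1] and no other entry of the window, while
x stays fixed. So F_x is constant along a curve in this coordinate direction, whose speed is nonzero
because s + ρ i is exactly the time at which u_[s] first enters y^i. -/
theorem IsParam.fderiv_Fx_hi_eq_zero (hφ : C.IsFlatOutput φ) (hF : C.IsParam φ R₁ R₂ Fx Fu)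
    {ρ : Fin 2 → ℕ} (hρ : ∀ j, (C.forwardSystem hφ.1 j).IsDegree (ρ j)) {i j : Fin 2} (hij : i ≠ j)
    (hi : ρ i < R₂ i) (hlt : R₂ j + ρ i < R₂ i + ρ j) :
    ∀ᶠ z in 𝓝 (C.yWindow φ _ _ C.base), fderiv ℝ Fx z (dir i (R₂ i - 1)) = 0 := by
  -- The effect on output i begins at s + ρ i = R₂ i - 1, the last entry; on output j it begins at s
  -- + ρ j ≥ R₂ j, outside the window.
  obtain ⟨s, hs⟩ : ∃ s, R₂ i = s + ρ i + 1 := ⟨R₂ i - 1 - ρ i, by omega⟩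
  refine hF.eventually_fderiv_Fx_eq_zero hφ ?_
  have ht : Tendsto (fun p : Point n 2 => p.2) (𝓝 C.base) (𝓝 (S.x₀, fun _ => S.u₀)) :=
    continuous_snd.tendsto _
  filter_upwards [hF.2.2.1.eventually_nhds, ht.eventually ((hρ i).eventually_perturb s),
    ht.eventually ((hρ j).eventually_perturb s), ht.eventually
      (((C.forwardSystem hφ.1 i).tendsto_initial s).eventually (hρ i).eventually_hasFDerivAt_η),
    (C.tendsto_yWindow hφ.1 (lo R₁) (hi' R₂)).eventually hF.1.eventually_differentiableAt]
    with p h1 h2 h3 ⟨L, hL, hL'⟩ h5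
  refine fderiv_apply_eq_zero_of_const h5 (sub_self _) (hL'.sub_const _) hL ?_
  have hc : Tendsto (fun t => (p.1, p.2.1, Function.update p.2.2 s t)) (𝓝 (p.2.2 s)) (𝓝 p) := by
    have : ContinuousAt (fun t => (p.1, p.2.1, Function.update p.2.2 s t)) (p.2.2 s) :=
      continuousAt_const.prodMk (continuousAt_const.prodMk
        (continuous_const.update s continuous_id).continuousAt)
    simpa [ContinuousAt] using this
  filter_upwards [hc.eventually h1, h2, h3] with t k1 k2 k3
  rw [h1.self_of_nhds]
  refine Eq.trans (congrArg Fx ?_) k1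
  ext ⟨j', k, hk⟩
  have hk' := Finset.mem_Icc.1 hk
  simp only [yWindow, Pi.add_apply, Pi.smul_apply, dir, smul_eq_mul]
  rcases k with k | k
  · have e1 := C.yShift_natCast (φ := φ) j' k p
    have e2 := C.yShift_natCast (φ := φ) j' k (p.1, p.2.1, Function.update p.2.2 s t)
    simp only [Int.ofNat_eq_natCast]
    rw [e1, e2]
    have hk2 : k + 1 ≤ R₂ j' := by
      have := hk'.2
      simp only [hi', Int.ofNat_eq_natCast] at this
      omega
    by_cases hj' : j' = i
    · subst hj'
      by_cases hks : k = s + ρ j'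
      · subst hks
        rw [if_pos ⟨rfl, by rw [hs]; push_cast; ring⟩, mul_one]
        exact k2.2.symm
      · rw [if_neg (by rintro ⟨-, h⟩; omega), mul_zero, add_zero]
        exact (k2.1 k (by omega)).symm
    · obtain rfl : j' = j := by omega
      rw [if_neg (fun h => hj' h.1), mul_zero, add_zero]
      exact (k3.1 k (by omega)).symm
  · rw [yShift_negSucc, yShift_negSucc, if_neg (by rintro ⟨-, h⟩; omega), mul_zero, add_zero]

/-- The same argument in reversed time: ζ_[-(s+1)] is changed so that y^i_[-R₁ i] alone moves in the
window. -/
theorem IsParam.fderiv_Fx_lo_eq_zero (hφ : C.IsFlatOutput φ) (hF : C.IsParam φ R₁ R₂ Fx Fu)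
    {ρ : Fin 2 → ℕ} (hρ : ∀ j, (C.backwardSystem hφ.1 j).IsDegree (ρ j)) {i j : Fin 2} (hij : i ≠ j)
    (hi : ρ i < R₁ i) (hlt : R₁ j + ρ i < R₁ i + ρ j) :
    ∀ᶠ z in 𝓝 (C.yWindow φ _ _ C.base), fderiv ℝ Fx z (dir i (-R₁ i)) = 0 := by
  obtain ⟨s, hs⟩ : ∃ s, R₁ i = s + ρ i + 1 := ⟨R₁ i - 1 - ρ i, by omega⟩
  refine hF.eventually_fderiv_Fx_eq_zero hφ ?_
  have ht : Tendsto (fun p : Point n 2 => (p.2.1, p.1)) (𝓝 C.base) (𝓝 (S.x₀, fun _ => C.ζ₀)) :=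
    (by fun_prop : Continuous fun p : Point n 2 => (p.2.1, p.1)).tendsto _
  filter_upwards [hF.2.2.1.eventually_nhds, ht.eventually ((hρ i).eventually_perturb s),
    ht.eventually ((hρ j).eventually_perturb s), ht.eventually
      (((C.backwardSystem hφ.1 i).tendsto_initial s).eventually (hρ i).eventually_hasFDerivAt_η),
    (C.tendsto_yWindow hφ.1 (lo R₁) (hi' R₂)).eventually hF.1.eventually_differentiableAt]
    with p h1 h2 h3 ⟨L, hL, hL'⟩ h5
  refine fderiv_apply_eq_zero_of_const h5 (sub_self _) (hL'.sub_const _) hL ?_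
  have hc : Tendsto (fun t => (Function.update p.1 s t, p.2)) (𝓝 (p.1 s)) (𝓝 p) := by
    have : ContinuousAt (fun t => (Function.update p.1 s t, p.2)) (p.1 s) :=
      (continuous_const.update s continuous_id).continuousAt.prodMk continuousAt_const
    simpa [ContinuousAt] using this
  filter_upwards [hc.eventually h1, h2, h3] with t k1 k2 k3
  rw [h1.self_of_nhds]
  refine Eq.trans (congrArg Fx ?_) k1
  ext ⟨j', k, hk⟩
  have hk' := Finset.mem_Icc.1 hk
  simp only [yWindow, Pi.add_apply, Pi.smul_apply, dir, smul_eq_mul]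
  rcases k with k | k
  · have e1 := C.yShift_natCast (φ := φ) j' k p
    have e2 := C.yShift_natCast (φ := φ) j' k (Function.update p.1 s t, p.2)
    simp only [Int.ofNat_eq_natCast]
    rw [e1, e2, if_neg (by rintro ⟨-, h⟩; omega), mul_zero, add_zero]
  · rw [yShift_negSucc, yShift_negSucc]
    have hk2 : k + 1 ≤ R₁ j' := by
      have := hk'.1
      simp only [lo] at this
      omega
    by_cases hj' : j' = i
    · subst hj'
      by_cases hks : k = s + ρ j'
      · subst hks
        rw [if_pos ⟨rfl, by rw [hs]; omega⟩, mul_one]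
        exact k2.2.symm
      · rw [if_neg (by rintro ⟨-, h⟩; omega), mul_zero, add_zero]
        exact (k2.1 k (by omega)).symm
    · obtain rfl : j' = j := by omega
      rw [if_neg (fun h => hj' h.1), mul_zero, add_zero]
      exact (k3.1 k (by omega)).symm

end Param

end Completion

/-- The map τ places the coefficients in the window: τ k = k in forward time and τ k = -k in
backward time. Entries of the window at other positions have to vanish. -/
theorem sum_dir {r : Fin 2 → ℕ} {a b : Fin 2 → ℤ} (v : Window a b → ℝ) (τ : ℕ → ℤ)
    (hτ : Function.Injective τ) (c : Fin 2 → ℕ → ℝ)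
    (hv : ∀ q : Window a b, (∃ k ≤ r q.1, τ k = q.2 ∧ v q = c q.1 k) ∨
      (∀ k ≤ r q.1, τ k ≠ q.2) ∧ v q = 0) :
    v = ∑ j, ∑ k ∈ Finset.range (r j + 1), c j k • (dir j (τ k) : Window a b → ℝ) := by
  ext q
  simp only [Finset.sum_apply, Pi.smul_apply, smul_eq_mul, dir]
  rw [Finset.sum_eq_single q.1 (fun j _ hj => Finset.sum_eq_zero fun k _ => by
    rw [if_neg (fun h => hj h.1.symm), mul_zero]) (by simp)]
  rcases hv q with ⟨k, hk, hτk, hvk⟩ | ⟨hne, hv0⟩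
  · rw [Finset.sum_eq_single k (fun l _ hl => by
      rw [if_neg (fun h => hl (hτ (h.2.symm.trans hτk.symm))), mul_zero])
      (fun h => absurd (Finset.mem_range.2 (by omega)) h)]
    rw [if_pos ⟨rfl, hτk.symm⟩, mul_one, hvk]
  · rw [hv0, eq_comm]
    refine Finset.sum_eq_zero fun k hk => ?_
    rw [if_neg (fun h => hne k (by have := Finset.mem_range.1 hk; omega) h.2.symm), mul_zero]

theorem eq_zero_of_rank_eq_zero {l m : ℕ} {A : Matrix (Fin l) (Fin m) ℝ} (h : A.rank = 0) :
    A = 0 := by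
  have h1 : LinearMap.range A.mulVecLin = ⊥ := Submodule.finrank_eq_zero.1 h
  rw [LinearMap.range_eq_bot] at h1
  ext i j
  have := congrFun (LinearMap.congr_fun h1 (Pi.single j 1)) i
  simpa using this

/-- Constant rank: if the coordinate derivatives all vanish at the point, they vanish near it. -/
theorem HasConstRankAt.eventually_eq_zero {l : ℕ} {a b : Fin 2 → ℤ} {F : (Window a b → ℝ) → Vec l}
    {k : Fin 2 → ℤ} {w₀ : Window a b → ℝ} (h : HasConstRankAt F k w₀)
    (h0 : ∀ j, fderiv ℝ F w₀ (dir j (k j)) = 0) (j : Fin 2) :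
    ∀ᶠ w in 𝓝 w₀, fderiv ℝ F w (dir j (k j)) = 0 := by
  have hz : jacobianAt F k w₀ = 0 := by
    ext i j
    exact congrFun (h0 j) i
  rw [HasConstRankAt, hz, Matrix.rank_zero] at h
  filter_upwards [h] with w hw
  ext i
  exact congrFun (congrFun (eq_zero_of_rank_eq_zero hw) i) j

/-! ### Derivatives of F_x and F_u linked by the dynamics -/

namespace Completion

variable {n : ℕ} {S : DTSystem n 2} {C : Completion S} {φ : Vec n × Vec 2 → Vec 2}

section Param

variable {R₁ R₂ : Fin 2 → ℕ} {Fx : (Window (lo R₁) (hi' R₂) → ℝ) → Vec n}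
  {Fu : (Window (lo R₁) (hi R₂) → ℝ) → Vec 2}

/-- The parameterization of `x⁺` is the shifted parameterization of `x`. -/
theorem IsParam.f_paramXU (hφ : C.IsFlatOutput φ) (hF : C.IsParam φ R₁ R₂ Fx Fu) :
    (fun w => S.f (C.paramXU φ Fx Fu w)) =ᶠ[𝓝 (C.yWindow φ _ _ C.base)]
      fun w => Fx (reindex (C.yBase φ) 1 w) := by
  refine hF.eventuallyEq_pi hφ (S.smooth.comp_of_eq hF.smoothNear_paramXU hF.paramXU_base)
    (C.smoothNear_comp_reindex hF.1 1) ?_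
  filter_upwards [hF.eventually_paramXU, C.tendsto_fwd.eventually hF.2.2.1,
    C.eventually_yShift_fwd_iterate φ 1] with p h1 h2 h3
  rw [h1, C.reindex_yWindow (p' := C.fwd p), h2]
  · rfl
  · intro j; simp
  · exact h3

theorem IsParam.fderiv_paramXU (hF : C.IsParam φ R₁ R₂ Fx Fu) :
    ∀ᶠ w in 𝓝 (C.yWindow φ _ _ C.base), ∀ j k, k ∈ Finset.Icc (lo R₁ j) (hi R₂ j) →
      fderiv ℝ (C.paramXU φ Fx Fu) w (dir j k) =
        (fderiv ℝ Fx (reindex (C.yBase φ) 0 w) (dir j k), fderiv ℝ Fu w (dir j k)) := by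
  filter_upwards [(C.tendsto_reindex 0).eventually hF.1.eventually_differentiableAt,
    (C.smoothNear_comp_reindex hF.1 0).eventually_differentiableAt,
    hF.2.1.eventually_differentiableAt] with w h1 h2 h3 j k hk
  have : HasFDerivAt (C.paramXU φ Fx Fu) _ w := h2.hasFDerivAt.prodMk h3.hasFDerivAt
  rw [this.fderiv]
  refine Prod.ext ?_ rfl
  have := fderiv_comp_reindex h1 hk
  rw [sub_zero] at this
  exact this

/-- The chain rule applied to f(F_x,F_u) = F_x of the shifted window. It transfers dependence
between neighbouring shifts of y. -/
theorem IsParam.fderiv_f_paramXU (hφ : C.IsFlatOutput φ) (hF : C.IsParam φ R₁ R₂ Fx Fu) :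
    ∀ᶠ w in 𝓝 (C.yWindow φ _ _ C.base), ∀ j k, k ∈ Finset.Icc (lo R₁ j) (hi R₂ j) →
      fderiv ℝ S.f (C.paramXU φ Fx Fu w)
        (fderiv ℝ Fx (reindex (C.yBase φ) 0 w) (dir j k), fderiv ℝ Fu w (dir j k)) =
        fderiv ℝ Fx (reindex (C.yBase φ) 1 w) (dir j (k - 1)) := by
  have ht : Tendsto (C.paramXU φ Fx Fu) (𝓝 (C.yWindow φ _ _ C.base)) (𝓝 (S.x₀, S.u₀)) := by
    have := hF.smoothNear_paramXU.continuousAt.tendsto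
    rwa [hF.paramXU_base] at this
  filter_upwards [(hF.f_paramXU hφ).eventually_nhds, hF.fderiv_paramXU,
    hF.smoothNear_paramXU.eventually_differentiableAt,
    ht.eventually S.smooth.eventually_differentiableAt,
    (C.tendsto_reindex 1).eventually hF.1.eventually_differentiableAt] with w h1 h2 h3 h4 h5 j k hk
  rw [← h2 j k hk, ← fderiv_comp_reindex h5 hk, ← Filter.EventuallyEq.fderiv_eq h1]
  exact congrArg (fun L => L (dir j k)) (h4.hasFDerivAt.comp w h3.hasFDerivAt).fderiv.symm

theorem fderiv_f_injective (S : DTSystem n 2) :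
    ∀ᶠ q in 𝓝 (S.x₀, S.u₀), ∀ v, fderiv ℝ S.f q (0, v) = 0 → v = 0 := by
  have hc : ContinuousAt (fun q => fderiv ℝ S.f q ∘L ContinuousLinearMap.inr ℝ (Vec n) (Vec 2))
      (S.x₀, S.u₀) :=
    (S.smooth.contDiffAt.fderiv_right (m := ∞) (by simp)).continuousAt.clm_comp continuousAt_const
  have hinj : Function.Injective
      (fderiv ℝ S.f (S.x₀, S.u₀) ∘L ContinuousLinearMap.inr ℝ (Vec n) (Vec 2)) := by
    have : HasFDerivAt (fun u => S.f (S.x₀, u)) _ S.u₀ :=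
      S.smooth.differentiableAt.hasFDerivAt.comp S.u₀ (hasFDerivAt_prodMk_right S.x₀ S.u₀)
    rw [← this.fderiv]
    exact S.rank_u
  filter_upwards [hc.eventually (ContinuousLinearMap.isOpen_injective.mem_nhds hinj)] with q hq v hv
  exact hq (hv.trans (map_zero _).symm)

/-- Dependence of `F_u` on `y^j_[r_2j]` and of `F_x` on `y^j_[r_2j-1]` are equivalent. -/
theorem IsParam.fderiv_Fu_hi_iff (hφ : C.IsFlatOutput φ) (hF : C.IsParam φ R₁ R₂ Fx Fu)
    (j : Fin 2) :
    (∀ᶠ w in 𝓝 (C.yWindow φ _ _ C.base), fderiv ℝ Fu w (dir j (R₂ j)) = 0) ↔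
      ∀ᶠ z in 𝓝 (C.yWindow φ _ _ C.base), fderiv ℝ Fx z (dir j (R₂ j - 1)) = 0 := by
  have ht : Tendsto (C.paramXU φ Fx Fu) (𝓝 (C.yWindow φ _ _ C.base)) (𝓝 (S.x₀, S.u₀)) := by
    have := hF.smoothNear_paramXU.continuousAt.tendsto
    rwa [hF.paramXU_base] at this
  have hmem : (R₂ j : ℤ) ∈ Finset.Icc (lo R₁ j) (hi R₂ j) := by simp [lo, hi]
  -- F_x ends at R₂ - 1, so along y^j_[R₂ j] only the input varies, and ∂_u f is injective near the
  -- equilibrium.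
  have hz : (dir j (R₂ j) : Window (lo R₁) (hi' R₂) → ℝ) = 0 := dir_eq_zero (by simp [hi'])
  constructor
  · intro h
    have h1 : ∀ᶠ w in 𝓝 (C.yWindow φ (lo R₁) (hi R₂) C.base),
        fderiv ℝ Fx (reindex (C.yBase φ) 1 w) (dir j (R₂ j - 1)) = 0 := by
      filter_upwards [h, hF.fderiv_f_paramXU hφ] with w h1 h2
      rw [← h2 j _ hmem, h1, hz, map_zero, ← Prod.zero_eq_mk, map_zero]
    have h2 := (C.tendsto_reindex (φ := φ) (a := lo R₁) (b := hi' R₂) (a' := lo R₁) (b' := hi R₂)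
      (-1)).eventually h1
    filter_upwards [h2] with z hz
    rwa [reindex_reindex_neg] at hz
    intro j; simp
  · intro h
    filter_upwards [(C.tendsto_reindex 1).eventually h, hF.fderiv_f_paramXU hφ,
      ht.eventually (fderiv_f_injective S)] with w h1 h2 h3
    have := h2 j _ hmem
    rw [h1, hz, map_zero] at this
    exact h3 _ this

/-- If `F_x` does not depend on `y^j_[-r_1j]`, neither does `F_u`. -/
theorem IsParam.fderiv_Fu_lo (hφ : C.IsFlatOutput φ) (hF : C.IsParam φ R₁ R₂ Fx Fu)
    {j : Fin 2}
    (h : ∀ᶠ z in 𝓝 (C.yWindow φ _ _ C.base), fderiv ℝ Fx z (dir j (-R₁ j)) = 0) :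
    ∀ᶠ w in 𝓝 (C.yWindow φ _ _ C.base), fderiv ℝ Fu w (dir j (-R₁ j)) = 0 := by
  have ht : Tendsto (C.paramXU φ Fx Fu) (𝓝 (C.yWindow φ _ _ C.base)) (𝓝 (S.x₀, S.u₀)) := by
    have := hF.smoothNear_paramXU.continuousAt.tendsto
    rwa [hF.paramXU_base] at this
  have hmem : (-R₁ j : ℤ) ∈ Finset.Icc (lo R₁ j) (hi R₂ j) := by simp [lo, hi]
  -- The shifted window starts at -R₁ + 1, so x⁺ does not depend on y^j_[-R₁ j]; if x does not
  -- either, then ∂_u f annihilates the derivative of F_u.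
  have hz : (dir j (-R₁ j - 1) : Window (lo R₁) (hi' R₂) → ℝ) = 0 := dir_eq_zero (by simp [lo])
  filter_upwards [(C.tendsto_reindex 0).eventually h, hF.fderiv_f_paramXU hφ,
    ht.eventually (fderiv_f_injective S)] with w h1 h2 h3
  have := h2 j _ hmem
  rw [h1, hz, map_zero] at this
  exact h3 _ this

/-! ### Reduction of the orders -/

theorem IsParam.reduce (hF : C.IsParam φ R₁ R₂ Fx Fu) {R₁' R₂' : Fin 2 → ℕ} (h₁ : R₁' ≤ R₁)
    (h₂ : R₂' ≤ R₂)
    (hx : ∀ᶠ z in 𝓝 (C.yWindow φ _ _ C.base), Fx (reindex (C.yBase φ) 0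
      (reindex (C.yBase φ) 0 z : Window (lo R₁') (hi' R₂') → ℝ)) = Fx z)
    (hu : ∀ᶠ w in 𝓝 (C.yWindow φ _ _ C.base), Fu (reindex (C.yBase φ) 0
      (reindex (C.yBase φ) 0 w : Window (lo R₁') (hi R₂') → ℝ)) = Fu w)
    (hφ : SmoothNear φ (S.x₀, S.u₀)) :
    C.IsParam φ R₁' R₂' (fun z => Fx (reindex (C.yBase φ) 0 z))
      (fun w => Fu (reindex (C.yBase φ) 0 w)) := by
  refine ⟨C.smoothNear_comp_reindex hF.1 0, C.smoothNear_comp_reindex hF.2.1 0, ?_, ?_⟩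
  · filter_upwards [hF.2.2.1, (C.tendsto_yWindow hφ _ _).eventually hx] with p h1 h2
    rw [reindex_zero_yWindow, h1] at h2
    · exact h2
    · intro j
      have : R₁' j ≤ R₁ j := h₁ j
      have : R₂' j ≤ R₂ j := h₂ j
      simp only [lo, hi']; omega
  · filter_upwards [hF.2.2.2, (C.tendsto_yWindow hφ _ _).eventually hu] with p h1 h2
    rw [reindex_zero_yWindow, h1] at h2
    · exact h2
    · intro j
      have : R₁' j ≤ R₁ j := h₁ j
      have : R₂' j ≤ R₂ j := h₂ j
      simp only [lo, hi]; omega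

/-- If F_x is independent of its last entry of y^j, then F_u is independent of the next one;
deleting both lowers r_2j by one and contradicts minimality. -/
theorem IsMinimalParam.not_reduce_hi (hF : C.IsMinimalParam φ R₁ R₂ Fx Fu)
    (hφ : C.IsFlatOutput φ) {j : Fin 2} (hj : 0 < R₂ j)
    (h : ∀ᶠ z in 𝓝 (C.yWindow φ _ _ C.base), fderiv ℝ Fx z (dir j (R₂ j - 1)) = 0) : False := by
  have hu := (hF.1.fderiv_Fu_hi_iff hφ j).2 h
  have hup : ∀ i, (Function.update R₂ j (R₂ j - 1) i : ℤ) = if i = j then (R₂ i : ℤ) - 1 else R₂ i := by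
    intro i
    by_cases hij : i = j
    · subst hij
      simp only [Function.update_self, if_true]
      omega
    · simp [hij]
  have hle : Function.update R₂ j (R₂ j - 1) ≤ R₂ := by
    intro i
    have := hup i
    change Function.update R₂ j (R₂ j - 1) i ≤ R₂ i
    split_ifs at this <;> omega
  have := (hF.2 _ _ _ _ (hF.1.reduce (R₁' := R₁) le_rfl hle ?_ ?_ hφ.1)).2 j
  · simp at this
    omega
  · have hs := hF.1.1
    rw [yWindow_base] at h hs ⊢
    refine eventually_reindex_reindex hs h ?_ ?_
    · simp only [hi', Finset.mem_Icc, hup]; simp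
    · intro j' k'
      simp only [hi', Finset.mem_Icc, hup]
      by_cases hij : j' = j
      · subst hij; rw [if_pos rfl]; intro h1 h2; exact ⟨rfl, by omega⟩
      · simp only [hij, if_false]; omega
  · have hs := hF.1.2.1
    rw [yWindow_base] at hu hs ⊢
    refine eventually_reindex_reindex hs hu ?_ ?_
    · simp only [hi, Finset.mem_Icc, hup]; simp
    · intro j' k'
      simp only [hi, Finset.mem_Icc, hup]
      by_cases hij : j' = j
      · subst hij; rw [if_pos rfl]; intro h1 h2; exact ⟨rfl, by omega⟩
      · simp only [hij, if_false]; omega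

/-- Here F_x and F_u lose the same variable y^j_[-r_1j], which lowers r_1j by one. -/
theorem IsMinimalParam.not_reduce_lo (hF : C.IsMinimalParam φ R₁ R₂ Fx Fu)
    (hφ : C.IsFlatOutput φ) {j : Fin 2} (hj : 0 < R₁ j)
    (h : ∀ᶠ z in 𝓝 (C.yWindow φ _ _ C.base), fderiv ℝ Fx z (dir j (-R₁ j)) = 0) : False := by
  have hu := hF.1.fderiv_Fu_lo hφ h
  have hup : ∀ i, (Function.update R₁ j (R₁ j - 1) i : ℤ) = if i = j then (R₁ i : ℤ) - 1 else R₁ i := by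
    intro i
    by_cases hij : i = j
    · subst hij
      simp only [Function.update_self, if_true]
      omega
    · simp [hij]
  have hle : Function.update R₁ j (R₁ j - 1) ≤ R₁ := by
    intro i
    have := hup i
    change Function.update R₁ j (R₁ j - 1) i ≤ R₁ i
    split_ifs at this <;> omega
  have := (hF.2 _ _ _ _ (hF.1.reduce (R₂' := R₂) hle le_rfl ?_ ?_ hφ.1)).1 j
  · simp at this
    omega
  · have hs := hF.1.1
    rw [yWindow_base] at h hs ⊢
    refine eventually_reindex_reindex hs h ?_ ?_
    · simp only [lo, Finset.mem_Icc, hup]; simp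
    · intro j' k'
      simp only [lo, Finset.mem_Icc, hup]
      by_cases hij : j' = j
      · subst hij; rw [if_pos rfl]; intro h1 h2; exact ⟨rfl, by omega⟩
      · simp only [hij, if_false]; omega
  · have hs := hF.1.2.1
    rw [yWindow_base] at hu hs ⊢
    refine eventually_reindex_reindex hs hu ?_ ?_
    · simp only [lo, Finset.mem_Icc, hup]; simp
    · intro j' k'
      simp only [lo, Finset.mem_Icc, hup]
      by_cases hij : j' = j
      · subst hij; rw [if_pos rfl]; intro h1 h2; exact ⟨rfl, by omega⟩
      · simp only [hij, if_false]; omega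

/-! ### The two time directions -/

theorem variation_future (hφ : SmoothNear φ (S.x₀, S.u₀)) (j : Fin 2) (u : ℕ → Vec 2) :
    (∀ k : ℕ, C.variation hφ j k (0, 0, u) = response (C.forwardSystem hφ j).impulse u k) ∧
    ∀ k : ℤ, k < 0 → C.variation hφ j k (0, 0, u) = 0 := by
  refine ⟨fun k => (C.forwardSystem hφ j).linObs_zero u k, fun k hk => ?_⟩
  cases k with
  | ofNat k => simp at hk; omega
  | negSucc k =>
    refine ((C.backwardSystem hφ j).linObs_zero 0 k).trans ?_
    simp [response]

theorem variation_past (hφ : SmoothNear φ (S.x₀, S.u₀)) (j : Fin 2) (u : ℕ → Vec 2) :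
    (∀ k : ℕ, C.variation hφ j (Int.negSucc k) (u, 0, 0) =
      response (C.backwardSystem hφ j).impulse u k) ∧
    ∀ k : ℤ, 0 ≤ k → C.variation hφ j k (u, 0, 0) = 0 := by
  refine ⟨fun k => (C.backwardSystem hφ j).linObs_zero u k, fun k hk => ?_⟩
  cases k with
  | ofNat k =>
    refine ((C.forwardSystem hφ j).linObs_zero 0 k).trans ?_
    simp [response]
  | negSucc k => exact absurd hk (by omega)

/-- The linear core with the reconstruction of u from y_[0], …, y_[R₂] when the past and the initial
state are not varied; the negative shifts then have zero variation. -/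
theorem IsMinimalParam.exists_forward_length (hφ : C.IsFlatOutput φ)
    (hF : C.IsMinimalParam φ R₁ R₂ Fx Fu)
    (hFu : HasConstRankAt Fu (hi R₂) (C.yWindow φ _ _ C.base)) {ρ : Fin 2 → ℕ}
    (hρ : ∀ j, (C.forwardSystem hφ.1 j).IsDegree (ρ j)) :
    ∃ e, (∀ j, R₂ j = ρ j + e) ∧
      (∀ u, (∀ k < R₂ 0, response (C.forwardSystem hφ.1 0).impulse u k = 0) →
        ∀ k < R₂ 1, response (C.forwardSystem hφ.1 1).impulse u k = 0) ∧
      fderiv ℝ Fu (C.yWindow φ _ _ C.base) (dir 1 (R₂ 1)) ≠ 0 := by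
  refine exists_common_length (H := fun j => (C.forwardSystem hφ.1 j).impulse)
    (c := fun j k => fderiv ℝ Fu (C.yWindow φ _ _ C.base) (dir j k))
    (fun j => (hρ j).impulse_eq_zero) (fun j => (hρ j).impulse_ne_zero) (fun u => ?_)
    (fun i j hi => ?_) (fun hlt => ?_)
  · have h1 := hF.1.fderiv_Fu hφ.1 (0, 0, u)
    rw [sum_dir (r := R₂) (fun q => C.variation hφ.1 q.1 q.2 (0, 0, u))
      (fun k : ℕ => (k : ℤ)) Nat.cast_injective
      (fun j k => response (C.forwardSystem hφ.1 j).impulse u k)] at h1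
    · simpa only [map_sum, map_smul] using h1.symm
    · rintro ⟨j, k, hk⟩
      have hk' := (Finset.mem_Icc.1 hk).2
      simp only [hi] at hk'
      obtain ⟨h2, h3⟩ := C.variation_future hφ.1 j u
      rcases lt_or_ge k 0 with h | h
      · exact Or.inr ⟨fun l _ => by simp only; omega, h3 k h⟩
      · lift k to ℕ using h
        exact Or.inl ⟨k, by simp only; omega, rfl, h2 k⟩
  · by_contra hlt
    have hij : i ≠ j := by rintro rfl; omega
    exact hF.not_reduce_hi hφ (by omega) (hF.1.fderiv_Fx_hi_eq_zero hφ hρ hij hi (by omega))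
  · by_contra! hcon
    -- Rank zero at the equilibrium would persist nearby, so F_u would not depend on y^j_[R₂ j] at
    -- all and the order could be lowered; the choice of the component 0 is arbitrary.
    have h1 := hFu.eventually_eq_zero hcon 0
    exact hF.not_reduce_hi hφ (by have := hlt 0; omega) ((hF.1.fderiv_Fu_hi_iff hφ 0).1 h1)

/-- The linear core with ζ_[-1] = g(x,u)_[-1] as the reconstructed input. The rank hypothesis
concerns F_x and not this parameterization of ζ, and the two are linked by the immersivity of (f,g).
-/
theorem IsMinimalParam.exists_backward_length (hφ : C.IsFlatOutput φ)
    (hF : C.IsMinimalParam φ R₁ R₂ Fx Fu)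
    (hFx : HasConstRankAt Fx (lo R₁) (C.yWindow φ _ _ C.base)) {ρ : Fin 2 → ℕ}
    (hρ : ∀ j, (C.backwardSystem hφ.1 j).IsDegree (ρ j)) :
    ∃ e, (∀ j, R₁ j = ρ j + e) ∧
      ∀ u, (∀ k < R₁ 0, response (C.backwardSystem hφ.1 0).impulse u k = 0) →
        ∀ k < R₁ 1, response (C.backwardSystem hφ.1 1).impulse u k = 0 := by
  refine (exists_common_length (H := fun j => (C.backwardSystem hφ.1 j).impulse)
    (c := fun j k => fderiv ℝ (fun w => C.g (C.paramXU φ Fx Fu w)) (C.yWindow φ _ _ C.base)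
      (dir j (-(k : ℤ)))) (r := R₁)
    (fun j => (hρ j).impulse_eq_zero) (fun j => (hρ j).impulse_ne_zero) (fun u => ?_)
    (fun i j hi => ?_) (fun hlt => ?_)).imp fun e h => ⟨h.1, h.2.1⟩
  · have h1 := hF.1.fderiv_g_paramXU hφ.1 (u, 0, 0)
    rw [sum_dir (r := R₁) (fun q => C.variation hφ.1 q.1 (q.2 - 1) (u, 0, 0))
      (fun k : ℕ => -(k : ℤ)) (fun a b h => by simpa using h)
      (fun j k => response (C.backwardSystem hφ.1 j).impulse u k)] at h1
    · simpa only [map_sum, map_smul] using h1.symm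
    · rintro ⟨j, k, hk⟩
      have hk' := (Finset.mem_Icc.1 hk).1
      simp only [lo] at hk'
      obtain ⟨h2, h3⟩ := C.variation_past hφ.1 j u
      rcases lt_or_ge 0 k with h | h
      -- Entries with k > 0 carry the variation of y_[k-1] with k - 1 ≥ 0, which a variation of the
      -- past inputs alone leaves at zero.
      · exact Or.inr ⟨fun l _ => by simp only; omega, h3 (k - 1) (by omega)⟩
      · obtain ⟨l, rfl⟩ : ∃ l : ℕ, k = -(l : ℤ) := ⟨k.natAbs, by omega⟩
        refine Or.inl ⟨l, by simp only; omega, rfl, ?_⟩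
        have := h2 l
        rwa [Int.negSucc_eq, show -((l : ℤ) + 1) = -(l : ℤ) - 1 by ring] at this
  · by_contra hlt
    have hij : i ≠ j := by rintro rfl; omega
    exact hF.not_reduce_lo hφ (by omega) (hF.1.fderiv_Fx_lo_eq_zero hφ hρ hij hi (by omega))
  · by_contra! hcon
    refine hF.not_reduce_lo hφ (j := 0) (by have := hlt 0; omega)
      (hFx.eventually_eq_zero (fun j => ?_) 0)
    have hmem : (-R₁ j : ℤ) ∈ Finset.Icc (lo R₁ j) (hi R₂ j) := by simp [lo, hi]
    have hz : (dir j (-R₁ j - 1) : Window (lo R₁) (hi' R₂) → ℝ) = 0 := dir_eq_zero (by simp [lo])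
    -- Along y^j_[-R₁ j] the derivative of x⁺ vanishes because of the shifted window, and that of g
    -- by assumption. The local inverse ψ then forces the derivatives of F_x and F_u to vanish as
    -- well.
    have e1 := (hF.1.fderiv_f_paramXU hφ).self_of_nhds j _ hmem
    have e2 := hF.1.fderiv_paramXU.self_of_nhds j _ hmem
    rw [hz, map_zero, hF.1.paramXU_base] at e1
    have hfg : HasFDerivAt C.g (fderiv ℝ C.g (S.x₀, S.u₀))
        (C.paramXU φ Fx Fu (C.yWindow φ _ _ C.base)) := by
      rw [hF.1.paramXU_base]
      exact C.smooth_g.differentiableAt.hasFDerivAt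
    have e3 := hcon j
    have e4 : HasFDerivAt (fun w => C.g (C.paramXU φ Fx Fu w)) _ _ :=
      hfg.comp _ hF.1.smoothNear_paramXU.differentiableAt.hasFDerivAt
    rw [e4.fderiv, ContinuousLinearMap.comp_apply, e2] at e3
    have e5 : HasFDerivAt (fun p => C.ψ (S.f p, C.g p)) _ (S.x₀, S.u₀) :=
      (C.inverse.2.1.differentiableAt.hasFDerivAt).comp (S.x₀, S.u₀)
        (S.smooth.differentiableAt.hasFDerivAt.prodMk C.smooth_g.differentiableAt.hasFDerivAt)
    have e6 := e5.unique ((hasFDerivAt_id (𝕜 := ℝ) (S.x₀, S.u₀)).congr_of_eventuallyEq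
      C.inverse.2.2.1)
    have e7 := congrArg (fun L => L (fderiv ℝ Fx (reindex (C.yBase φ) 0
      (C.yWindow φ (lo R₁) (hi R₂) C.base)) (dir j (-R₁ j)),
      fderiv ℝ Fu (C.yWindow φ _ _ C.base) (dir j (-R₁ j)))) e6
    simp only [ContinuousLinearMap.comp_apply, ContinuousLinearMap.prod_apply, e1, e3] at e7
    rw [← Prod.zero_eq_mk, map_zero] at e7
    have e8 := (congrArg Prod.fst e7).symm
    rw [yWindow_base, reindex_const, ← C.yWindow_base] at e8
    exact e8

end Param

end Completion

/-! ### The chains of shifts of `y` as a linear system -/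

section Chain

variable {a b : Fin 2 → ℤ}

/-- The coordinate `y^j_[k]` of a window; zero if this variable is not in the window. -/
noncomputable def coord (j : Fin 2) (k : ℤ) : (Window a b → ℝ) →L[ℝ] ℝ :=
  if h : k ∈ Finset.Icc (a j) (b j) then ContinuousLinearMap.proj ⟨j, ⟨k, h⟩⟩ else 0

theorem coord_of_mem {j : Fin 2} {k : ℤ} (h : k ∈ Finset.Icc (a j) (b j)) (w : Window a b → ℝ) :
    coord j k w = w ⟨j, ⟨k, h⟩⟩ := by
  rw [coord, dif_pos h]
  rfl

theorem coord_mk (w : Window a b → ℝ) (q : Window a b) : coord q.1 q.2 w = w q :=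
  coord_of_mem q.2.2 w

theorem window_ext {w w' : Window a b → ℝ}
    (h : ∀ j k, k ∈ Finset.Icc (a j) (b j) → coord j k w = coord j k w') : w = w' := by
  ext q
  rw [← coord_mk w, ← coord_mk w']
  exact h _ _ q.2.2

theorem coord_dir (j : Fin 2) (k : ℤ) {j' : Fin 2} {k' : ℤ} (h : k' ∈ Finset.Icc (a j') (b j')) :
    coord j' k' (dir j k : Window a b → ℝ) = if j' = j ∧ k' = k then 1 else 0 :=
  coord_of_mem h _

theorem coord_reindex {a' b' : Fin 2 → ℤ} {j : Fin 2} {k : ℤ} {y₀ : Vec 2} {i : ℤ}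
    (h : k ∈ Finset.Icc (a' j) (b' j)) (h' : k + i ∈ Finset.Icc (a j) (b j)) (w : Window a b → ℝ) :
    coord j k (reindex y₀ i w : Window a' b' → ℝ) = coord j (k + i) w := by
  rw [coord_of_mem h, coord_of_mem h', reindex_mk rfl h']

variable {R₁ R₂ : Fin 2 → ℕ}

/-- The window `y_[-R₁,R₂]` that consists of `y_[-R₁,R₂-1]` and `y_[R₂]`. -/
noncomputable def joinMap (R₁ R₂ : Fin 2 → ℕ) :
    (Window (lo R₁) (hi' R₂) → ℝ) × Vec 2 →L[ℝ] (Window (lo R₁) (hi R₂) → ℝ) :=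
  ContinuousLinearMap.pi fun q =>
    if (q.2 : ℤ) = R₂ q.1 then ContinuousLinearMap.proj q.1 ∘L ContinuousLinearMap.snd ℝ _ _
    else coord q.1 q.2 ∘L ContinuousLinearMap.fst ℝ _ _

theorem coord_joinMap {j : Fin 2} {k : ℤ} (h : k ∈ Finset.Icc (lo R₁ j) (hi R₂ j))
    (p : (Window (lo R₁) (hi' R₂) → ℝ) × Vec 2) :
    coord j k (joinMap R₁ R₂ p) = if k = R₂ j then p.2 j else coord j k p.1 := by
  rw [coord_of_mem h]
  change (if k = R₂ j then _ else _ : _ →L[ℝ] ℝ) p = _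
  split_ifs <;> rfl

/-- The right-hand side of the chains `y^j_[k]⁺ = y^j_[k+1]` with input `y_[R₂]`. -/
noncomputable def chainMap (R₁ R₂ : Fin 2 → ℕ) :
    (Window (lo R₁) (hi' R₂) → ℝ) × Vec 2 →L[ℝ] (Window (lo R₁) (hi' R₂) → ℝ) :=
  ContinuousLinearMap.pi fun q => coord q.1 (q.2 + 1) ∘L joinMap R₁ R₂

theorem coord_chainMap {j : Fin 2} {k : ℤ} (h : k ∈ Finset.Icc (lo R₁ j) (hi' R₂ j))
    (p : (Window (lo R₁) (hi' R₂) → ℝ) × Vec 2) :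
    coord j k (chainMap R₁ R₂ p) = coord j (k + 1) (joinMap R₁ R₂ p) := by
  rw [coord_of_mem h]
  rfl

theorem reindex_zero_joinMap (y₀ : Vec 2) (p : (Window (lo R₁) (hi' R₂) → ℝ) × Vec 2) :
    reindex y₀ 0 (joinMap R₁ R₂ p) = p.1 := by
  refine window_ext fun j k h => ?_
  have h' := Finset.mem_Icc.1 h
  simp only [lo, hi'] at h'
  have h2 : k + 0 ∈ Finset.Icc (lo R₁ j) (hi R₂ j) := by
    simp only [lo, hi, Finset.mem_Icc]; omega
  rw [coord_reindex h h2, coord_joinMap h2, if_neg (by omega), add_zero]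

theorem reindex_one_joinMap (y₀ : Vec 2) (p : (Window (lo R₁) (hi' R₂) → ℝ) × Vec 2) :
    reindex y₀ 1 (joinMap R₁ R₂ p) = chainMap R₁ R₂ p := by
  refine window_ext fun j k h => ?_
  have h' := Finset.mem_Icc.1 h
  simp only [lo, hi'] at h'
  have h2 : k + 1 ∈ Finset.Icc (lo R₁ j) (hi R₂ j) := by
    simp only [lo, hi, Finset.mem_Icc]; omega
  rw [coord_reindex h h2, coord_chainMap h]

theorem joinMap_const (y₀ : Vec 2) :
    joinMap R₁ R₂ (fun q => y₀ q.1, y₀) = fun q => y₀ q.1 := by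
  refine window_ext fun j k h => ?_
  rw [coord_joinMap h, coord_of_mem h]
  split_ifs with hk
  · rfl
  · have h' := Finset.mem_Icc.1 h
    simp only [lo, hi] at h'
    rw [coord_of_mem (by simp only [lo, hi', Finset.mem_Icc]; omega)]

theorem joinMap_zero_single (j : Fin 2) :
    joinMap R₁ R₂ (0, Pi.single j 1) = dir j (R₂ j) := by
  refine window_ext fun j' k h => ?_
  rw [coord_joinMap h, coord_dir _ _ h]
  by_cases hj : j' = j
  · subst hj; simp
  · simp [hj]

theorem chainMap_zero_single (j : Fin 2) :
    chainMap R₁ R₂ (0, Pi.single j 1) = dir j (R₂ j - 1) := by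
  refine window_ext fun j' k' h => ?_
  have h' := Finset.mem_Icc.1 h
  simp only [lo, hi'] at h'
  have h2 : k' + 1 ∈ Finset.Icc (lo R₁ j') (hi R₂ j') := by
    simp only [lo, hi, Finset.mem_Icc]; omega
  rw [coord_chainMap h, joinMap_zero_single, coord_dir _ _ h, coord_dir _ _ h2]
  simp only [eq_sub_iff_add_eq]

theorem chainMap_dir {j : Fin 2} {k : ℤ} (hk : k < R₂ j) :
    chainMap R₁ R₂ (dir j k, 0) = dir j (k - 1) := by
  refine window_ext fun j' k' h => ?_
  have h' := Finset.mem_Icc.1 h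
  simp only [lo, hi'] at h'
  have h2 : k' + 1 ∈ Finset.Icc (lo R₁ j') (hi R₂ j') := by
    simp only [lo, hi, Finset.mem_Icc]; omega
  rw [coord_chainMap h, coord_joinMap h2, coord_dir _ _ h]
  by_cases h3 : k' + 1 = R₂ j'
  · rw [if_pos h3, if_neg]
    · rfl
    · rintro ⟨rfl, h4⟩; omega
  · rw [if_neg h3, coord_dir _ _ (by simp only [lo, hi', Finset.mem_Icc]; omega)]
    simp only [eq_sub_iff_add_eq]

/-- Applying A i times to the j-th input direction yields the coordinate direction of y^j_[R₂ j - 1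
- i]; these exhaust the window. -/
theorem controllable_chainMap (R₁ R₂ : Fin 2 → ℕ) :
    Controllable ((chainMap R₁ R₂).toLinearMap ∘ₗ LinearMap.inl ℝ _ _)
      ((chainMap R₁ R₂).toLinearMap ∘ₗ LinearMap.inr ℝ _ _) := by
  set A := (chainMap R₁ R₂).toLinearMap ∘ₗ LinearMap.inl ℝ _ (Vec 2)
  set B := (chainMap R₁ R₂).toLinearMap ∘ₗ LinearMap.inr ℝ (Window (lo R₁) (hi' R₂) → ℝ) _
  have hAB : ∀ (j : Fin 2) (i : ℕ), (A ^ i) (B (Pi.single j 1)) = dir j (R₂ j - 1 - i) := by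
    intro j i
    induction i with
    | zero =>
      rw [pow_zero, Nat.cast_zero, sub_zero]
      exact chainMap_zero_single j
    | succ i ih =>
      rw [pow_succ', Module.End.mul_apply, ih]
      refine (chainMap_dir (by omega)).trans ?_
      congr 1
      push_cast; ring
  have hdir : ∀ q : Window (lo R₁) (hi' R₂),
      (Pi.single q 1 : Window (lo R₁) (hi' R₂) → ℝ) ∈ ⨆ k : ℕ, LinearMap.range ((A ^ k) ∘ₗ B) := by
    intro q
    have hq := Finset.mem_Icc.1 q.2.2
    simp only [lo, hi'] at hq
    refine Submodule.mem_iSup_of_mem (R₂ q.1 - 1 - q.2 : ℤ).toNat ⟨Pi.single q.1 1, ?_⟩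
    rw [LinearMap.comp_apply, hAB, Int.toNat_of_nonneg (by omega)]
    ext ⟨j, k, hk⟩
    rcases q with ⟨j', k', hk'⟩
    simp only [dir, Pi.single_apply]
    congr 1
    simp only [Sigma.mk.injEq, eq_iff_iff]
    constructor
    · rintro ⟨rfl, h⟩
      refine ⟨rfl, heq_of_eq (Subtype.ext ?_)⟩
      simp only at h ⊢
      omega
    · rintro ⟨rfl, h⟩
      obtain rfl := congrArg Subtype.val (eq_of_heq h)
      exact ⟨rfl, by simp only; omega⟩
  refine eq_top_iff.2 fun z _ => ?_
  rw [pi_eq_sum_univ' z]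
  refine Submodule.sum_mem _ fun q _ => Submodule.smul_mem _ _ ?_
  convert hdir q using 1

theorem card_window (R₁ R₂ : Fin 2 → ℕ) :
    Fintype.card (Window (lo R₁) (hi' R₂)) = ∑ j, (R₁ j + R₂ j) := by
  rw [Fintype.card_sigma]
  refine Finset.sum_congr rfl fun j _ => ?_
  rw [Fintype.card_coe, Int.card_Icc]
  simp only [lo, hi']
  omega

end Chain

/-! ### The chart of the extended state and its leading functions -/

/-- Controllability is invariant under linear changes of the state. -/
theorem Controllable.conj {Z Z' V : Type*} [AddCommGroup Z] [Module ℝ Z] [AddCommGroup Z']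
    [Module ℝ Z'] [AddCommGroup V] [Module ℝ V] {A : Z →ₗ[ℝ] Z} {B : V →ₗ[ℝ] Z}
    (h : Controllable A B) (ℓ : Z ≃ₗ[ℝ] Z') :
    Controllable (ℓ.toLinearMap ∘ₗ A ∘ₗ ℓ.symm.toLinearMap) (ℓ.toLinearMap ∘ₗ B) := by
  have hpow : ∀ k : ℕ, ((ℓ.toLinearMap ∘ₗ A ∘ₗ ℓ.symm.toLinearMap) ^ k) ∘ₗ ℓ.toLinearMap ∘ₗ B =
      ℓ.toLinearMap ∘ₗ (A ^ k) ∘ₗ B := by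
    intro k
    induction k with
    | zero => rfl
    | succ k ih =>
      rw [pow_succ', Module.End.mul_eq_comp, LinearMap.comp_assoc, ih, pow_succ',
        Module.End.mul_eq_comp]
      ext v
      simp
  unfold Controllable at h ⊢
  simp only [hpow, LinearMap.range_comp _ ℓ.toLinearMap, ← Submodule.map_iSup, h]
  simp

theorem LocalInverse.comp {E F G : Type*} [NormedAddCommGroup E] [NormedSpace ℝ E]
    [NormedAddCommGroup F] [NormedSpace ℝ F] [NormedAddCommGroup G] [NormedSpace ℝ G]
    {a : E → F} {b : F → E} {a' : F → G} {b' : G → F} {p : E} (h' : LocalInverse a' b' (a p))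
    (h : LocalInverse a b p) : LocalInverse (fun q => a' (a q)) (fun q => b (b' q)) p := by
  refine ⟨h'.1.comp h.1, h.2.1.comp_of_eq h'.2.1 h'.eq, ?_, ?_⟩
  · filter_upwards [h.2.2.1, h.1.continuousAt.eventually h'.2.2.1] with q h1 h2
    rw [h2, h1]
  · have hc := h'.2.1.continuousAt.tendsto
    rw [h'.eq] at hc
    filter_upwards [h'.2.2.2, hc.eventually h.2.2.2] with q h1 h2
    rw [h2, h1]

namespace ObservedSystem

variable {X : Type*} [NormedAddCommGroup X] [NormedSpace ℝ X] (O : ObservedSystem X)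

theorem η_base (k : ℕ) : O.η k (O.x₀, O.v₀) = O.out (O.x₀, O.v₀) := by
  rw [← κ_eq_η]
  exact O.obs_base k

end ObservedSystem

namespace Completion

variable {n : ℕ} {S : DTSystem n 2} {C : Completion S} {φ : Vec n × Vec 2 → Vec 2}

section Chart

variable {R₁ R₂ : Fin 2 → ℕ} {Fx : (Window (lo R₁) (hi' R₂) → ℝ) → Vec n}
  {Fu : (Window (lo R₁) (hi R₂) → ℝ) → Vec 2}

/-- The state of the extended system as a function of `y_[-R₁,R₂-1]`, where the added variables
are shifts of `y¹`. -/
noncomputable def extChart (Fx : (Window (lo R₁) (hi' R₂) → ℝ) → Vec n) (β ρ d₁ d₂ : ℕ)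
    (z : Window (lo R₁) (hi' R₂) → ℝ) : ExtState n d₁ d₂ :=
  (fun k => coord 0 (Int.negSucc (β + k)) z, Fx z, fun k => coord 0 ((ρ + k : ℕ) : ℤ) z)

theorem smoothNear_extChart {z₀ : Window (lo R₁) (hi' R₂) → ℝ} (hFx : SmoothNear Fx z₀)
    (β ρ d₁ d₂ : ℕ) :
    SmoothNear (extChart Fx β ρ d₁ d₂) z₀ ∧ ∀ v, fderiv ℝ (extChart Fx β ρ d₁ d₂) z₀ v =
      (fun k : Fin d₁ => coord 0 (Int.negSucc (β + k)) v, fderiv ℝ Fx z₀ v,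
        fun k : Fin d₂ => coord 0 ((ρ + k : ℕ) : ℤ) v) := by
  let A : (Window (lo R₁) (hi' R₂) → ℝ) →L[ℝ] Vec d₁ :=
    ContinuousLinearMap.pi fun k => coord 0 (Int.negSucc (β + k))
  let B : (Window (lo R₁) (hi' R₂) → ℝ) →L[ℝ] Vec d₂ :=
    ContinuousLinearMap.pi fun k => coord 0 ((ρ + k : ℕ) : ℤ)
  refine ⟨(A.contDiff.smoothNear z₀).prodMk (hFx.prodMk (B.contDiff.smoothNear z₀)), fun v => ?_⟩
  have : HasFDerivAt (extChart Fx β ρ d₁ d₂) (A.prod ((fderiv ℝ Fx z₀).prod B)) z₀ :=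
    A.hasFDerivAt.prodMk (hFx.differentiableAt.hasFDerivAt.prodMk B.hasFDerivAt)
  rw [this.fderiv]
  rfl

/-- Every window variation comes from a variation of a point. With x fixed, the forward and backward
entries are pure responses; those of y¹ below the degrees vanish automatically and the others are
components of the chart, so y¹ vanishes and takes y² with it. Conversely, x is free and the listed
shifts of y¹ can be steered at will. -/
theorem IsParam.extChart_bijective (hφ : C.IsFlatOutput φ) (hF : C.IsParam φ R₁ R₂ Fx Fu)
    {ρ β : Fin 2 → ℕ} {d₁ d₂ : ℕ} (hρ : ∀ j, (C.forwardSystem hφ.1 j).IsDegree (ρ j))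
    (hβ : ∀ j, (C.backwardSystem hφ.1 j).IsDegree (β j)) (hd₁ : R₁ 0 = β 0 + d₁)
    (hd₂ : R₂ 0 = ρ 0 + d₂)
    (hfut : ∀ u, (∀ k < R₂ 0, response (C.forwardSystem hφ.1 0).impulse u k = 0) →
        ∀ k < R₂ 1, response (C.forwardSystem hφ.1 1).impulse u k = 0)
    (hpast : ∀ u, (∀ k < R₁ 0, response (C.backwardSystem hφ.1 0).impulse u k = 0) →
        ∀ k < R₁ 1, response (C.backwardSystem hφ.1 1).impulse u k = 0) :
    Function.Bijective (fderiv ℝ (extChart Fx (β 0) (ρ 0) d₁ d₂) (C.yWindow φ _ _ C.base)) := by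
  have hder := (smoothNear_extChart hF.1 (β 0) (ρ 0) d₁ d₂).2
  have hmemf : ∀ (j : Fin 2) (k : ℕ), k < R₂ j → (k : ℤ) ∈ Finset.Icc (lo R₁ j) (hi' R₂ j) :=
    fun j k h => by simp only [lo, hi', Finset.mem_Icc]; omega
  have hmemp : ∀ (j : Fin 2) (k : ℕ), k < R₁ j → Int.negSucc k ∈ Finset.Icc (lo R₁ j) (hi' R₂ j) :=
    fun j k h => by simp only [lo, hi', Finset.mem_Icc]; omega
  have hsplit : ∀ ξ : Point n 2, ξ = (ξ.1, 0, 0) + ((0, ξ.2.1, 0) + (0, 0, ξ.2.2)) := fun ξ =>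
    Prod.ext (by simp) (Prod.ext (by simp) (by simp))
  have hvarf : ∀ (ξ : Point n 2) (j : Fin 2) (k : ℕ), C.variation hφ.1 j k ξ =
      C.variation hφ.1 j k (0, ξ.2.1, 0) + response (C.forwardSystem hφ.1 j).impulse ξ.2.2 k := by
    intro ξ j k
    conv_lhs => rw [hsplit ξ]
    rw [variation_add, variation_add, (C.variation_past hφ.1 j ξ.1).2 k (by omega), zero_add,
      (C.variation_future hφ.1 j ξ.2.2).1]
  have hvarp : ∀ (ξ : Point n 2) (j : Fin 2) (k : ℕ), C.variation hφ.1 j (Int.negSucc k) ξ =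
      C.variation hφ.1 j (Int.negSucc k) (0, ξ.2.1, 0) +
        response (C.backwardSystem hφ.1 j).impulse ξ.1 k := by
    intro ξ j k
    conv_lhs => rw [hsplit ξ]
    rw [variation_add, variation_add, (C.variation_future hφ.1 j ξ.2.2).2 _ (by omega), add_zero,
      (C.variation_past hφ.1 j ξ.1).1, add_comm]
  have hvar0 : ∀ j k, C.variation hφ.1 j k 0 = 0 := fun j k => by
    have := C.variation_add hφ.1 j k 0 0
    rw [add_zero] at this
    linarith
  constructor
  · rw [injective_iff_map_eq_zero]
    intro v hv
    rw [hder, Prod.mk_eq_zero, Prod.mk_eq_zero] at hv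
    obtain ⟨hv1, hv2, hv3⟩ := hv
    obtain ⟨ξ, hξ⟩ := hF.exists_variation hφ v
    have hx : ξ.2.1 = 0 := by
      rw [← hF.fderiv_Fx hφ.1 ξ, ← hv2]
      exact congrArg _ (funext hξ)
    have hcf : ∀ (j : Fin 2) (k : ℕ), k < R₂ j →
        coord j k v = response (C.forwardSystem hφ.1 j).impulse ξ.2.2 k := fun j k hk => by
      rw [coord_of_mem (hmemf j k hk), ← hξ]
      refine (hvarf ξ j k).trans ?_
      rw [hx]
      exact (congrArg (· + _) (hvar0 j k)).trans (zero_add _)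
    have hcp : ∀ (j : Fin 2) (k : ℕ), k < R₁ j →
        coord j (Int.negSucc k) v = response (C.backwardSystem hφ.1 j).impulse ξ.1 k :=
      fun j k hk => by
        rw [coord_of_mem (hmemp j k hk), ← hξ]
        refine (hvarp ξ j k).trans ?_
        rw [hx]
        exact (congrArg (· + _) (hvar0 j _)).trans (zero_add _)
    have h0f : ∀ k < R₂ 0, response (C.forwardSystem hφ.1 0).impulse ξ.2.2 k = 0 := fun k hk => by
      rcases lt_or_ge k (ρ 0) with h | h
      · exact response_of_lt (hρ 0).impulse_eq_zero _ h
      · obtain ⟨i, rfl⟩ := Nat.exists_eq_add_of_le h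
        rw [← hcf 0 _ hk]
        exact congrFun hv3 ⟨i, by omega⟩
    have h0p : ∀ k < R₁ 0, response (C.backwardSystem hφ.1 0).impulse ξ.1 k = 0 := fun k hk => by
      rcases lt_or_ge k (β 0) with h | h
      · exact response_of_lt (hβ 0).impulse_eq_zero _ h
      · obtain ⟨i, rfl⟩ := Nat.exists_eq_add_of_le h
        rw [← hcp 0 _ hk]
        exact congrFun hv1 ⟨i, by omega⟩
    have hf : ∀ j, ∀ k < R₂ j, response (C.forwardSystem hφ.1 j).impulse ξ.2.2 k = 0 :=
      Fin.forall_fin_two.2 ⟨h0f, hfut _ h0f⟩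
    have hp : ∀ j, ∀ k < R₁ j, response (C.backwardSystem hφ.1 j).impulse ξ.1 k = 0 :=
      Fin.forall_fin_two.2 ⟨h0p, hpast _ h0p⟩
    refine window_ext fun j k hk => ?_
    have hk' := Finset.mem_Icc.1 hk
    simp only [lo, hi'] at hk'
    rw [map_zero]
    rcases k with k | k
    · have hk2 : k < R₂ j := by have := hk'.2; simp only [Int.ofNat_eq_natCast] at this; omega
      exact (hcf j k hk2).trans (hf j k hk2)
    · have hk2 : k < R₁ j := by omega
      exact (hcp j k hk2).trans (hp j k hk2)
  · rintro ⟨α, x, δ⟩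
    -- The inputs must supply the prescribed values minus the free response of x; the value 0 beyond
    -- index d₂ is arbitrary.
    obtain ⟨u, hu⟩ := exists_response_eq (hρ 0).impulse_eq_zero (hρ 0).impulse_ne_zero
      (fun i => (if h : i < d₂ then δ ⟨i, h⟩ else 0) - C.variation hφ.1 0 ((ρ 0 + i : ℕ) : ℤ) (0, x, 0))
    obtain ⟨ζ, hζ⟩ := exists_response_eq (hβ 0).impulse_eq_zero (hβ 0).impulse_ne_zero
      (fun i => (if h : i < d₁ then α ⟨i, h⟩ else 0) -
        C.variation hφ.1 0 (Int.negSucc (β 0 + i)) (0, x, 0))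
    refine ⟨fun q => C.variation hφ.1 q.1 q.2 (ζ, x, u), ?_⟩
    rw [hder, hF.fderiv_Fx hφ.1]
    refine Prod.ext (funext fun i => ?_) (Prod.ext rfl (funext fun i => ?_))
    · simp only
      rw [coord_of_mem (hmemp 0 _ (by omega)), hvarp, hζ]
      simp
    · simp only
      rw [coord_of_mem (hmemf 0 _ (by omega)), hvarf, hu]
      simp

/-- The forward leading function recovers `y¹_[ρ]` from the parameterization. -/
theorem IsParam.η_forward (hφ : C.IsFlatOutput φ) (hF : C.IsParam φ R₁ R₂ Fx Fu) {j : Fin 2}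
    {ρ : ℕ} (hρ : (C.forwardSystem hφ.1 j).IsDegree ρ) (hle : ρ ≤ R₂ j) :
    (fun w => (C.forwardSystem hφ.1 j).η ρ (C.paramXU φ Fx Fu w)) =ᶠ[𝓝 (C.yWindow φ _ _ C.base)]
      fun w => coord j (ρ : ℤ) w := by
  have hmem : (ρ : ℤ) ∈ Finset.Icc (lo R₁ j) (hi R₂ j) := by
    simp only [lo, hi, Finset.mem_Icc]; omega
  refine hF.eventuallyEq hφ (((C.forwardSystem hφ.1 j).smoothNear_η ρ).comp_of_eq
    hF.smoothNear_paramXU hF.paramXU_base) ((coord j (ρ : ℤ)).contDiff.smoothNear _) ?_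
  have ht : Tendsto (fun p : Point n 2 => p.2) (𝓝 C.base) (𝓝 (C.forwardSystem hφ.1 j).base) :=
    continuous_snd.tendsto _
  filter_upwards [hF.eventually_paramXU, ht.eventually ((hρ.eventually_obs ρ).1 le_rfl)]
    with p h1 h2
  rw [h1, coord_of_mem hmem]
  exact h2.symm.trans (C.yShift_natCast j ρ p).symm

/-- The forward-shift of the backward leading function is `y¹_[-β]`. -/
theorem IsParam.η_backward (hφ : C.IsFlatOutput φ) (hF : C.IsParam φ R₁ R₂ Fx Fu) {j : Fin 2}
    {β : ℕ} (hβ : (C.backwardSystem hφ.1 j).IsDegree β) (hle : β ≤ R₁ j) :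
    (fun w => (C.backwardSystem hφ.1 j).η β (S.f (C.paramXU φ Fx Fu w),
      C.g (C.paramXU φ Fx Fu w))) =ᶠ[𝓝 (C.yWindow φ _ _ C.base)] fun w => coord j (-(β : ℤ)) w := by
  have hmem : (-β : ℤ) ∈ Finset.Icc (lo R₁ j) (hi R₂ j) := by
    simp only [lo, hi, Finset.mem_Icc]; omega
  have hfg : (S.f (S.x₀, S.u₀), C.g (S.x₀, S.u₀)) = (S.x₀, C.ζ₀) := Prod.ext S.equilibrium rfl
  refine hF.eventuallyEq hφ (((C.backwardSystem hφ.1 j).smoothNear_η β).comp_of_eq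
    (C.smooth_fg.comp_of_eq hF.smoothNear_paramXU hF.paramXU_base) ?_)
    ((coord j (-(β : ℤ))).contDiff.smoothNear _) ?_
  · rw [hF.paramXU_base]; exact hfg
  have ht : Tendsto (fun p : Point n 2 => ((C.fwd p).2.1, (C.fwd p).1)) (𝓝 C.base)
      (𝓝 (C.backwardSystem hφ.1 j).base) :=
    ((by fun_prop : Continuous fun p : Point n 2 => (p.2.1, p.1)).tendsto C.base).comp C.tendsto_fwd
  filter_upwards [hF.eventually_paramXU, ht.eventually ((hβ.eventually_obs β).1 le_rfl),
    C.eventually_yShift_fwd_iterate φ 1] with p h1 h2 h3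
  rw [h1, coord_of_mem hmem]
  refine h2.symm.trans ((C.yShift_negSucc j β (C.fwd p)).symm.trans ?_)
  refine (h3 j (Int.negSucc β)).trans ?_
  rw [yWindow, Int.negSucc_eq]
  congr 1
  push_cast; ring

end Chart

end Completion

/-! ### The extended system in chain coordinates and its feedback -/

namespace Completion

variable {n : ℕ} {S : DTSystem n 2} {C : Completion S} {φ : Vec n × Vec 2 → Vec 2}

section Extension

variable {R₁ R₂ : Fin 2 → ℕ} {Fx : (Window (lo R₁) (hi' R₂) → ℝ) → Vec n}
  {Fu : (Window (lo R₁) (hi R₂) → ℝ) → Vec 2}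

theorem joinMap_base (C : Completion S) (φ : Vec n × Vec 2 → Vec 2) (R₁ R₂ : Fin 2 → ℕ) :
    joinMap R₁ R₂ (C.yWindow φ _ _ C.base, C.yBase φ) = C.yWindow φ _ _ C.base := by
  rw [yWindow_base, yWindow_base, joinMap_const]

theorem chainMap_base (C : Completion S) (φ : Vec n × Vec 2 → Vec 2) (R₁ R₂ : Fin 2 → ℕ) :
    chainMap R₁ R₂ (C.yWindow φ _ _ C.base, C.yBase φ) = C.yWindow φ _ _ C.base := by
  rw [← reindex_one_joinMap (C.yBase φ), joinMap_base, yWindow_base, reindex_const, yWindow_base]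

/-- The input transformation of the extended system in terms of `y_[-R₁,R₂]`. -/
noncomputable def chainFeedback (C : Completion S) (φ : Vec n × Vec 2 → Vec 2)
    (Fx : (Window (lo R₁) (hi' R₂) → ℝ) → Vec n) (Fu : (Window (lo R₁) (hi R₂) → ℝ) → Vec 2)
    (θ : Vec n × Vec 2 → Vec 2) (p : (Window (lo R₁) (hi' R₂) → ℝ) × Vec 2) : Vec 2 :=
  ![p.2 0, θ (C.paramXU φ Fx Fu (joinMap R₁ R₂ p)) 1]

/-- The chart `extChart` intertwines the chains of shifts of `y` with the extended system. -/
theorem IsParam.extend_extChart (hφ : C.IsFlatOutput φ) (hF : C.IsParam φ R₁ R₂ Fx Fu)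
    {ρ β d₁ d₂ : ℕ} (hρ : (C.forwardSystem hφ.1 0).IsDegree ρ)
    (hβ : (C.backwardSystem hφ.1 0).IsDegree β) (hd₁ : R₁ 0 = β + d₁) (hd₂ : R₂ 0 = ρ + d₂)
    {θu Φu θζ : Vec n × Vec 2 → Vec 2} (hθu : ∀ q, θu q 0 = (C.forwardSystem hφ.1 0).η ρ q)
    (hΦu : ∀ᶠ q in 𝓝 (S.x₀, S.u₀), Φu (q.1, θu q) = q.2)
    (hθζ : ∀ q, θζ q 0 = (C.backwardSystem hφ.1 0).η β q) :
    ∀ᶠ p in 𝓝 (C.yWindow φ (lo R₁) (hi' R₂) C.base, C.yBase φ),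
      extend S.f (fun q => θζ (S.f q, C.g q) 0) Φu
        (extChart Fx β ρ d₁ d₂ p.1, C.chainFeedback φ Fx Fu θu p) =
      extChart Fx β ρ d₁ d₂ (chainMap R₁ R₂ p) := by
  have ht : Tendsto (joinMap R₁ R₂) (𝓝 (C.yWindow φ (lo R₁) (hi' R₂) C.base, C.yBase φ))
      (𝓝 (C.yWindow φ _ _ C.base)) := by
    have := (joinMap R₁ R₂).continuous.tendsto (C.yWindow φ (lo R₁) (hi' R₂) C.base, C.yBase φ)
    rwa [joinMap_base] at this
  have hp : Tendsto (C.paramXU φ Fx Fu) (𝓝 (C.yWindow φ _ _ C.base)) (𝓝 (S.x₀, S.u₀)) := by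
    have := hF.smoothNear_paramXU.continuousAt.tendsto
    rwa [hF.paramXU_base] at this
  filter_upwards [ht.eventually (hF.f_paramXU hφ), ht.eventually (hF.η_forward hφ hρ (by omega)),
    ht.eventually (hF.η_backward hφ hβ (by omega)), ht.eventually (hp.eventually hΦu)]
    with p h1 h2 h3 h4
  set W := joinMap R₁ R₂ p with hW
  have hx : (C.paramXU φ Fx Fu W).1 = Fx p.1 := congrArg Fx (reindex_zero_joinMap _ p)
  -- Appending the new input to the chain gives y¹_[ρ], …, y¹_[R₂], whose first entry is ū¹. This
  -- also covers d₂ = 0, where ū¹ is itself an input.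
  have hsnoc : ∀ k : Fin (d₂ + 1), (Fin.snoc (α := fun _ => ℝ)
      (fun k : Fin d₂ => coord 0 ((ρ + k : ℕ) : ℤ) p.1) (p.2 0) : Vec (d₂ + 1)) k =
      coord 0 ((ρ + k : ℕ) : ℤ) W := by
    intro k
    have hk : ((ρ + k : ℕ) : ℤ) ∈ Finset.Icc (lo R₁ 0) (hi R₂ 0) := by
      simp only [lo, hi, Finset.mem_Icc]; omega
    rw [hW, coord_joinMap hk]
    cases k using Fin.lastCases with
    | last => rw [Fin.snoc_last, if_pos (by rw [Fin.val_last, hd₂])]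
    | cast k => rw [Fin.snoc_castSucc, if_neg (by rw [Fin.val_castSucc]; omega), Fin.val_castSucc]
  have hub : ubar (fun k : Fin d₂ => coord 0 ((ρ + k : ℕ) : ℤ) p.1) (C.chainFeedback φ Fx Fu θu p) =
      θu (C.paramXU φ Fx Fu W) := by
    ext i
    fin_cases i
    · exact (hsnoc 0).trans (h2.symm.trans (hθu _).symm)
    · rfl
  have hu : (Fx p.1, Φu (Fx p.1, ubar (fun k : Fin d₂ => coord 0 ((ρ + k : ℕ) : ℤ) p.1)
      (C.chainFeedback φ Fx Fu θu p))) = C.paramXU φ Fx Fu W := by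
    rw [hub, ← hx, h4]
  -- In front of y¹_[-β-1], … stands the forward-shift of ζ̄¹_[-1] = y¹_[-β-1], which is y¹_[-β];
  -- hence indices -(β + k) with k starting at 0.
  have hcons : ∀ k : Fin (d₁ + 1), (Fin.cons (α := fun _ => ℝ)
      (θζ (S.f (C.paramXU φ Fx Fu W), C.g (C.paramXU φ Fx Fu W)) 0)
      (fun k : Fin d₁ => coord 0 (Int.negSucc (β + k)) p.1) : Vec (d₁ + 1)) k =
      coord 0 (-((β + k : ℕ) : ℤ)) W := by
    intro k
    cases k using Fin.cases with
    | zero => exact (hθζ _).trans h3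
    | succ k =>
      have hk : -((β + k.succ : ℕ) : ℤ) ∈ Finset.Icc (lo R₁ 0) (hi R₂ 0) := by
        simp only [lo, hi, Finset.mem_Icc, Fin.val_succ]; omega
      have hne : -((β + k.succ : ℕ) : ℤ) ≠ R₂ 0 := by rw [Fin.val_succ]; omega
      rw [Fin.cons_succ, hW, coord_joinMap hk, if_neg hne]
      rfl
  simp only [extend, extChart]
  rw [hu]
  refine Prod.ext (funext fun k => ?_) (Prod.ext ?_ (funext fun k => ?_))
  · refine (hcons k.castSucc).trans ?_
    simp only
    rw [coord_chainMap (by simp only [lo, hi', Finset.mem_Icc]; omega), ← hW]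
    congr 2
    rw [Fin.val_castSucc]; omega
  · refine h1.trans ?_
    rw [hW, reindex_one_joinMap]
  · refine (hsnoc k.succ).trans ?_
    simp only
    rw [coord_chainMap (by simp only [lo, hi', Finset.mem_Icc]; omega), ← hW]
    rfl

theorem IsParam.chainFeedback_base (hφ : C.IsFlatOutput φ) (hF : C.IsParam φ R₁ R₂ Fx Fu) {ρ : ℕ}
    {θ : Vec n × Vec 2 → Vec 2} (hθ : ∀ q, θ q 0 = (C.forwardSystem hφ.1 0).η ρ q) :
    C.chainFeedback φ Fx Fu θ (C.yWindow φ _ _ C.base, C.yBase φ) = θ (S.x₀, S.u₀) := by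
  rw [chainFeedback, joinMap_base, hF.paramXU_base]
  ext i
  fin_cases i
  · exact ((C.forwardSystem hφ.1 0).η_base ρ).symm.trans (hθ _).symm
  · rfl

/-- The second component of the transformed input depends on `y²_[r_22]`. -/
theorem IsParam.fderiv_chain_ne_zero (hφ : C.IsFlatOutput φ) (hF : C.IsParam φ R₁ R₂ Fx Fu)
    {ρ : ℕ} (hρ : (C.forwardSystem hφ.1 0).IsDegree ρ) (hle : ρ ≤ R₂ 0)
    (hFu : fderiv ℝ Fu (C.yWindow φ _ _ C.base) (dir 1 (R₂ 1)) ≠ 0)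
    {θ : Vec n × Vec 2 → Vec 2} (hθ : ∀ q, θ q 0 = (C.forwardSystem hφ.1 0).η ρ q)
    (hs : SmoothNear θ (S.x₀, S.u₀)) (hinj : ∀ v, fderiv ℝ θ (S.x₀, S.u₀) (0, v) = 0 → v = 0) :
    fderiv ℝ (fun w => θ (C.paramXU φ Fx Fu w)) (C.yWindow φ _ _ C.base) (dir 1 (R₂ 1)) 1 ≠ 0 := by
  have hmem : (R₂ 1 : ℤ) ∈ Finset.Icc (lo R₁ 1) (hi R₂ 1) := by simp [lo, hi]
  have hρm : (ρ : ℤ) ∈ Finset.Icc (lo R₁ 0) (hi R₂ 0) := by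
    simp only [lo, hi, Finset.mem_Icc]; omega
  have hc : fderiv ℝ (fun w => θ (C.paramXU φ Fx Fu w)) (C.yWindow φ _ _ C.base) (dir 1 (R₂ 1)) =
      fderiv ℝ θ (S.x₀, S.u₀) (0, fderiv ℝ Fu (C.yWindow φ _ _ C.base) (dir 1 (R₂ 1))) := by
    have h1 : HasFDerivAt θ (fderiv ℝ θ (S.x₀, S.u₀))
        (C.paramXU φ Fx Fu (C.yWindow φ _ _ C.base)) := by
      rw [hF.paramXU_base]; exact hs.differentiableAt.hasFDerivAt
    have h2 : HasFDerivAt (fun w => θ (C.paramXU φ Fx Fu w)) _ (C.yWindow φ _ _ C.base) :=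
      h1.comp _ hF.smoothNear_paramXU.differentiableAt.hasFDerivAt
    rw [h2.fderiv, ContinuousLinearMap.comp_apply, hF.fderiv_paramXU.self_of_nhds 1 _ hmem,
      dir_eq_zero (a := lo R₁) (b := hi' R₂) (j := 1) (k := R₂ 1) (by simp [hi']), map_zero]
  -- The first component of the transformed input is the coordinate y¹_[ρ], which does not involve
  -- y². As θ is injective to first order in u, a nonzero derivative of F_u must appear in the
  -- second component.
  have h0 : fderiv ℝ (fun w => θ (C.paramXU φ Fx Fu w)) (C.yWindow φ _ _ C.base)
      (dir 1 (R₂ 1)) 0 = 0 := by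
    have hsm : SmoothNear (fun w => θ (C.paramXU φ Fx Fu w)) (C.yWindow φ _ _ C.base) :=
      hs.comp_of_eq hF.smoothNear_paramXU hF.paramXU_base
    have h1 := hasFDerivAt_pi'.1 hsm.differentiableAt.hasFDerivAt 0
    have h2 : (fun w => θ (C.paramXU φ Fx Fu w) 0) =ᶠ[𝓝 (C.yWindow φ _ _ C.base)]
        fun w => coord 0 (ρ : ℤ) w := by
      filter_upwards [hF.η_forward hφ hρ hle] with w hw
      rw [hθ, hw]
    have h3 := h1.unique ((coord 0 (ρ : ℤ)).hasFDerivAt.congr_of_eventuallyEq h2)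
    refine (congrArg (fun L => L (dir 1 (R₂ 1))) h3).trans ?_
    rw [coord_dir _ _ hρm, if_neg (by simp)]
  intro h
  rw [hc] at h h0
  refine hFu (hinj _ ?_)
  ext i
  fin_cases i
  · exact h0
  · exact h

/-- The feedback that leads to the chains of shifts of `y` is invertible. -/
theorem isLocalDiffeo_chainFeedback {Q : Type*} [NormedAddCommGroup Q] [NormedSpace ℝ Q]
    [FiniteDimensional ℝ Q] {q₀ : Q} {b : Q → Window (lo R₁) (hi' R₂) → ℝ}
    (hb : SmoothNear b q₀) (hb₀ : b q₀ = C.yWindow φ _ _ C.base)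
    (hF : C.IsParam φ R₁ R₂ Fx Fu) {θ : Vec n × Vec 2 → Vec 2} (hs : SmoothNear θ (S.x₀, S.u₀))
    (hne : fderiv ℝ (fun w => θ (C.paramXU φ Fx Fu w)) (C.yWindow φ _ _ C.base)
      (dir 1 (R₂ 1)) 1 ≠ 0) :
    IsLocalDiffeo (fun q : Q × Vec 2 => (q.1, C.chainFeedback φ Fx Fu θ (b q.1, q.2)))
      (q₀, C.yBase φ) := by
  set G : (Window (lo R₁) (hi R₂) → ℝ) → Vec 2 := fun w => θ (C.paramXU φ Fx Fu w)
  have hG : SmoothNear G (C.yWindow φ _ _ C.base) :=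
    hs.comp_of_eq hF.smoothNear_paramXU hF.paramXU_base
  have hbs : SmoothNear (fun q : Q × Vec 2 => (b q.1, q.2)) (q₀, C.yBase φ) :=
    (hb.comp_of_eq (contDiff_fst.smoothNear _) rfl).prodMk (contDiff_snd.smoothNear _)
  have hjs : SmoothNear (fun q : Q × Vec 2 => joinMap R₁ R₂ (b q.1, q.2)) (q₀, C.yBase φ) :=
    ((joinMap R₁ R₂).contDiff.smoothNear _).comp hbs
  have hj₀ : joinMap R₁ R₂ (b q₀, C.yBase φ) = C.yWindow φ _ _ C.base := by
    rw [hb₀, joinMap_base]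
  have hα : SmoothNear (fun q : Q × Vec 2 => C.chainFeedback φ Fx Fu θ (b q.1, q.2))
      (q₀, C.yBase φ) := by
    refine smoothNear_pi.2 fun i => ?_
    fin_cases i
    · exact ((ContinuousLinearMap.proj (R := ℝ) (φ := fun _ : Fin 2 => ℝ) 0).contDiff.comp
        contDiff_snd).smoothNear _
    · exact smoothNear_pi.1 (hG.comp_of_eq hjs hj₀) 1
  -- In the new input, the Jacobian of the feedback is triangular: the first component is the first
  -- new input itself, and the remaining diagonal entry is `hne`.
  obtain ⟨Φ, hΦ⟩ := exists_localInverse_prodMk_fst hα fun v hv => by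
    have h1 : HasFDerivAt (fun w => C.chainFeedback φ Fx Fu θ (b q₀, w)) _ (C.yBase φ) :=
      hα.differentiableAt.hasFDerivAt.comp (C.yBase φ) (hasFDerivAt_prodMk_right q₀ _)
    have h2 := hasFDerivAt_pi'.1 h1
    have hv0 : v 0 = 0 := by
      have := (h2 0).unique (ContinuousLinearMap.proj (R := ℝ) (φ := fun _ : Fin 2 => ℝ) 0).hasFDerivAt
      exact (congrArg (fun L => L v) this).symm.trans (congrFun hv 0)
    have hv1 : v = v 1 • Pi.single 1 1 := by
      ext i; fin_cases i
      · simpa using hv0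
      · simp
    have hG' : HasFDerivAt G (fderiv ℝ G (C.yWindow φ _ _ C.base))
        (joinMap R₁ R₂ (b q₀, C.yBase φ)) := by
      rw [hj₀]; exact hG.differentiableAt.hasFDerivAt
    have h3 : HasFDerivAt (G ∘ fun w => joinMap R₁ R₂ (b q₀, w)) _ (C.yBase φ) :=
      hG'.comp (C.yBase φ) ((joinMap R₁ R₂).hasFDerivAt.comp (C.yBase φ)
        (hasFDerivAt_prodMk_right (b q₀) _))
    have h4 : fderiv ℝ G (C.yWindow φ _ _ C.base) (joinMap R₁ R₂ (0, v)) 1 = 0 := by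
      have := (h2 1).unique (hasFDerivAt_pi'.1 h3 1)
      exact (congrArg (fun L => L v) this).symm.trans (congrFun hv 1)
    have h5 : ((0 : Window (lo R₁) (hi' R₂) → ℝ), v) = v 1 • (0, Pi.single 1 1) := by
      conv_lhs => rw [hv1]
      rw [Prod.smul_mk, smul_zero]
    rw [h5, map_smul, joinMap_zero_single, map_smul, Pi.smul_apply, smul_eq_mul] at h4
    rw [hv1, (mul_eq_zero.1 h4).resolve_right hne, zero_smul]
  exact ⟨_, hΦ⟩

end Extension

end Completion

/-! ### Static feedback linearization of the extended system -/

namespace Completion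

variable {n : ℕ} {S : DTSystem n 2} {C : Completion S} {φ : Vec n × Vec 2 → Vec 2}

section Linearization

variable {R₁ R₂ : Fin 2 → ℕ} {Fx : (Window (lo R₁) (hi' R₂) → ℝ) → Vec n}
  {Fu : (Window (lo R₁) (hi R₂) → ℝ) → Vec 2}

/-- At the equilibrium all shifts of y¹ and both leading functions have the same value, so the chart
sends the base window to the equilibrium of the extended system. -/
theorem IsParam.extChart_base (hφ : C.IsFlatOutput φ) (hF : C.IsParam φ R₁ R₂ Fx Fu)
    {ρ β d₁ d₂ : ℕ} (hd₁ : R₁ 0 = β + d₁) (hd₂ : R₂ 0 = ρ + d₂) :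
    extChart Fx β ρ d₁ d₂ (C.yWindow φ _ _ C.base) =
      (fun _ => (C.backwardSystem hφ.1 0).η β (S.x₀, C.ζ₀), S.x₀,
        fun _ => (C.forwardSystem hφ.1 0).η ρ (S.x₀, S.u₀)) := by
  refine Prod.ext (funext fun k => ?_) (Prod.ext hF.2.2.1.self_of_nhds (funext fun k => ?_))
  · refine Eq.trans ?_ ((C.backwardSystem hφ.1 0).η_base β).symm
    change coord 0 _ _ = φ (C.ψ (S.x₀, C.ζ₀)) 0
    rw [coord_of_mem (by simp only [lo, hi', Finset.mem_Icc]; omega), yWindow_base, ψ_equilibrium]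
    rfl
  · refine Eq.trans ?_ ((C.forwardSystem hφ.1 0).η_base ρ).symm
    change coord 0 _ _ = φ (S.x₀, S.u₀) 0
    rw [coord_of_mem (by simp only [lo, hi', Finset.mem_Icc]; omega), yWindow_base]
    rfl

/-- The dimension of the extended state is the number of variables `y_[-R₁,R₂-1]`. -/
theorem dim_eq_of_extChart_bijective {z₀ : Window (lo R₁) (hi' R₂) → ℝ} {ρ β d₁ d₂ : ℕ}
    (hbij : Function.Bijective (fderiv ℝ (extChart Fx β ρ d₁ d₂) z₀)) :
    d₁ + (n + d₂) = ∑ j, (R₁ j + R₂ j) := by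
  have h := (LinearEquiv.ofBijective ((fderiv ℝ (extChart Fx β ρ d₁ d₂) z₀) :
    (Window (lo R₁) (hi' R₂) → ℝ) →ₗ[ℝ] ExtState n d₁ d₂)
    hbij).finrank_eq
  rw [Module.finrank_fintype_fun_eq_card, card_window, Module.finrank_prod, Module.finrank_prod,
    Module.finrank_fin_fun, Module.finrank_fin_fun, Module.finrank_fin_fun] at h
  exact h.symm

/-- In the chart `extChart`, suitable feedback turns the extended system into the chains of shifts
of `y`. -/
theorem IsParam.staticFeedbackLinearizable_extend (hφ : C.IsFlatOutput φ)
    (hF : C.IsParam φ R₁ R₂ Fx Fu) {ρ β d₁ d₂ : ℕ}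
    (hbij : Function.Bijective (fderiv ℝ (extChart Fx β ρ d₁ d₂) (C.yWindow φ _ _ C.base)))
    (hρ : (C.forwardSystem hφ.1 0).IsDegree ρ) (hβ : (C.backwardSystem hφ.1 0).IsDegree β)
    (hd₁ : R₁ 0 = β + d₁) (hd₂ : R₂ 0 = ρ + d₂)
    (hFu : fderiv ℝ Fu (C.yWindow φ _ _ C.base) (dir 1 (R₂ 1)) ≠ 0)
    {θu Φu θζ : Vec n × Vec 2 → Vec 2} (hθu : ∀ q, θu q 0 = (C.forwardSystem hφ.1 0).η ρ q)
    (hs : SmoothNear θu (S.x₀, S.u₀))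
    (hinj : ∀ v, fderiv ℝ θu (S.x₀, S.u₀) (0, v) = 0 → v = 0)
    (hΦu : ∀ᶠ q in 𝓝 (S.x₀, S.u₀), Φu (q.1, θu q) = q.2)
    (hθζ : ∀ q, θζ q 0 = (C.backwardSystem hφ.1 0).η β q) :
    StaticFeedbackLinearizable
      (extend (d₁ := d₁) (d₂ := d₂) S.f (fun q => θζ (S.f q, C.g q) 0) Φu)
      (extChart Fx β ρ d₁ d₂ (C.yWindow φ _ _ C.base)) (θu (S.x₀, S.u₀)) := by
  set z₀ := C.yWindow φ (lo R₁) (hi' R₂) C.base with hz₀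
  set Ψ : (Window (lo R₁) (hi' R₂) → ℝ) → ExtState n d₁ d₂ := extChart Fx β ρ d₁ d₂
  obtain ⟨b, hb⟩ := exists_localInverse (smoothNear_extChart hF.1 β ρ d₁ d₂).1 hbij
  -- The inverse chart takes values in the window space, whereas the state transformation has to map
  -- the extended state space to itself. Any linear isomorphism back would do; the derivative of the
  -- chart is one at hand.
  let ℓ : (Window (lo R₁) (hi' R₂) → ℝ) ≃L[ℝ] ExtState n d₁ d₂ :=
    (LinearEquiv.ofBijective (fderiv ℝ Ψ z₀ : (Window (lo R₁) (hi' R₂) → ℝ) →ₗ[ℝ] _)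
      hbij).toContinuousLinearEquiv
  have hℓ : LocalInverse ℓ ℓ.symm (b (Ψ z₀)) :=
    ⟨ℓ.contDiff.smoothNear _, ℓ.symm.contDiff.smoothNear _,
      Eventually.of_forall ℓ.symm_apply_apply, Eventually.of_forall ℓ.apply_symm_apply⟩
  refine ⟨fun q => ℓ (b q), fun q => C.chainFeedback φ Fx Fu θu (b q.1, q.2), C.yBase φ, _, _,
    ⟨_, hℓ.comp hb.symm⟩, ?_, isLocalDiffeo_chainFeedback hb.2.1 hb.eq hF hs
      (hF.fderiv_chain_ne_zero hφ hρ (by omega) hFu hθu hs hinj),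
    (controllable_chainMap R₁ R₂).conj ℓ.toLinearEquiv, ?_⟩
  · change C.chainFeedback φ Fx Fu θu (b (Ψ z₀), C.yBase φ) = _
    rw [hb.eq]
    exact hF.chainFeedback_base hφ hθu
  · have ht : Tendsto (fun q : ExtState n d₁ d₂ × Vec 2 => (b q.1, q.2)) (𝓝 (Ψ z₀, C.yBase φ))
        (𝓝 (z₀, C.yBase φ)) := by
      have : ContinuousAt (fun q : ExtState n d₁ d₂ × Vec 2 => (b q.1, q.2)) (Ψ z₀, C.yBase φ) :=
        (hb.2.1.continuousAt.comp_of_eq continuousAt_fst rfl).prodMk continuousAt_snd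
      have := this.tendsto
      rwa [show b (Ψ z₀, C.yBase φ).1 = z₀ from hb.eq] at this
    have hc : Tendsto (chainMap R₁ R₂) (𝓝 (z₀, C.yBase φ)) (𝓝 z₀) := by
      have := (chainMap R₁ R₂).continuous.tendsto (z₀, C.yBase φ)
      rwa [hz₀, chainMap_base, ← hz₀] at this
    filter_upwards [ht.eventually (hF.extend_extChart hφ hρ hβ hd₁ hd₂ hθu hΦu hθζ),
      ht.eventually (hc.eventually hb.2.2.1), continuousAt_fst.tendsto.eventually hb.2.2.2]
      with q h1 h2 h3
    have h4 : extend (d₁ := d₁) (d₂ := d₂) S.f (fun q => θζ (S.f q, C.g q) 0) Φu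
        (q.1, C.chainFeedback φ Fx Fu θu (b q.1, q.2)) = Ψ (chainMap R₁ R₂ (b q.1, q.2)) := by
      refine Eq.trans ?_ h1
      rw [h3]
    have h5 : (b q.1, q.2) = (b q.1, 0) + (0, q.2) := by simp
    rw [h4, h2, h5, map_add, map_add]
    simp

end Linearization

end Completion

end FlatDT

/-- Every two-input flat system with an `(x,u)`-flat output can be rendered static feedback
linearizable by a `d₁`-fold prelongation and a `d₂`-fold prolongation. -/
theorem mainTheorem5 {n : ℕ} (S : FlatDT.DTSystem n 2) (C : FlatDT.Completion S)
    (φ : FlatDT.Vec n × FlatDT.Vec 2 → FlatDT.Vec 2) (hφ : C.IsFlatOutput φ)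
    (R₁ R₂ : Fin 2 → ℕ)
    (Fx : (FlatDT.Window (FlatDT.lo R₁) (FlatDT.hi' R₂) → ℝ) → FlatDT.Vec n)
    (Fu : (FlatDT.Window (FlatDT.lo R₁) (FlatDT.hi R₂) → ℝ) → FlatDT.Vec 2)
    (hF : C.IsMinimalParam φ R₁ R₂ Fx Fu)
    (hFx : FlatDT.HasConstRankAt Fx (FlatDT.lo R₁) (C.yWindow φ _ _ C.base))
    (hFu : FlatDT.HasConstRankAt Fu (FlatDT.hi R₂) (C.yWindow φ _ _ C.base))
    (ρ γ : Fin 2 → ℕ)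
    (hρ : ∀ j, C.IsRelativeDegree φ j (ρ j))
    (hγ : ∀ j, C.IsBackwardDegree φ j (γ j)) :
    ∃ d₁ d₂ : ℕ,
      (d₁ : ℤ) = R₁ 0 + 1 - γ 0 ∧
      (d₂ : ℤ) = R₂ 0 - ρ 0 ∧
      (d₁ : ℤ) + d₂ = (∑ j, (R₁ j + R₂ j) : ℤ) - n ∧
      ∃ (Φu : FlatDT.Vec n × FlatDT.Vec 2 → FlatDT.Vec 2) (ubar₀ : FlatDT.Vec 2)
        (Φζ θ : FlatDT.Vec n × FlatDT.Vec 2 → FlatDT.Vec 2) (ζbar₀ : FlatDT.Vec 2),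
        -- `u = Φu(x,ū)` is an invertible input transformation
        Φu (S.x₀, ubar₀) = S.u₀ ∧
        FlatDT.IsLocalDiffeo (fun q : FlatDT.Vec n × FlatDT.Vec 2 => (q.1, Φu q)) (S.x₀, ubar₀) ∧
        -- `ζ_[-1] = Φζ(x,ζ̄_[-1])` is an invertible transformation, with inverse `ζ̄_[-1] = θ(x,ζ_[-1])`
        Φζ (S.x₀, ζbar₀) = C.ζ₀ ∧
        FlatDT.LocalInverse (fun q : FlatDT.Vec n × FlatDT.Vec 2 => (q.1, Φζ q))
          (fun q => (q.1, θ q)) (S.x₀, ζbar₀) ∧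
        -- with `ḡ¹(x,u) = θ¹(f(x,u),g(x,u))`, the forward-shift of `ζ̄¹_[-1]`
        FlatDT.StaticFeedbackLinearizable
          (FlatDT.extend (d₁ := d₁) (d₂ := d₂) S.f (fun q => θ (S.f q, C.g q) 0) Φu)
          (fun _ => ζbar₀ 0, S.x₀, fun _ => ubar₀ 0) ubar₀ := by
  have hρ' := fun j => (hρ j).isDegree hφ.1
  have hβ' := fun j => (hγ j).isDegree hφ.1
  obtain ⟨d₂, hd₂, hfut, hc⟩ := hF.exists_forward_length hφ hFu hρ'
  obtain ⟨d₁, hd₁, hpast⟩ := hF.exists_backward_length hφ hFx hβ'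
  have hbij := hF.1.extChart_bijective hφ hρ' hβ' (hd₁ 0) (hd₂ 0) hfut hpast
  obtain ⟨θu, Φu, hθu, hu, hinj⟩ := FlatDT.exists_completion
    ((C.forwardSystem hφ.1 0).smoothNear_η (ρ 0)) (hρ' 0).fderiv_η_ne_zero
  obtain ⟨θζ, Φζ, hθζ, hζ, -⟩ := FlatDT.exists_completion
    ((C.backwardSystem hφ.1 0).smoothNear_η (γ 0 - 1)) (hβ' 0).fderiv_η_ne_zero
  refine ⟨d₁, d₂, ?_, ?_, ?_, Φu, θu (S.x₀, S.u₀), Φζ, θζ, θζ (S.x₀, C.ζ₀),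
    congrArg Prod.snd hu.eq, ⟨_, hu.symm⟩, congrArg Prod.snd hζ.eq, hζ.symm, ?_⟩
  · have h1 := hd₁ 0
    have h2 := (hγ 0).1
    omega
  · have h1 := hd₂ 0
    omega
  · have h1 : ((d₁ + (n + d₂) : ℕ) : ℤ) = ((∑ j, (R₁ j + R₂ j) : ℕ) : ℤ) :=
      congrArg _ (FlatDT.Completion.dim_eq_of_extChart_bijective hbij)
    push_cast at h1
    linarith
  · have h := hF.1.staticFeedbackLinearizable_extend hφ hbij (hρ' 0) (hβ' 0) (hd₁ 0) (hd₂ 0) hc hθu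
      hu.1.snd hinj (Φu := Φu) (hu.2.2.1.mono fun _ hq => (Prod.ext_iff.1 hq).2) hθζ
    rw [hF.1.extChart_base hφ (hd₁ 0) (hd₂ 0)] at h
    rw [hθu, hθζ]
    exact h
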